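/- **Setting.** A rational space is a finite-dimensional real vector space $W$ with a lattice $\Lambda$ (a discrete subgroup spanning $W$), equipped here with a scalar product $Q$ that takes rational values on $\Lambda\times\Lambda$. For a rational subspace $L$ of $W$ the quotient $W/L$ is again a rational space with scalar product: its lattice is the image of $\Lambda$, and its scalar product comes from identifying $W/L$ with the orthogonal complement of $L$. A function on $(W/L)^*=L^\perp\subset W^*$ is regarded as a function on $W^*$ by composing it with the orthogonal projection $W^*\to L^\perp$. A point $x$ is rational if $qx\in\Lambda$ for some integer $q\ne0$; a cone is $\sum_{i=1}^k\mathbb R_{\ge0}v_i$ with $v_i$ rational; an affine cone is $s+c$ with $s$ rational and $c$ a cone; a polyhedron is an intersection of finitely many closed half-spaces bounded by rational affine hyperplanes. $\mathcal F(p)$ is the set of non-empty faces of $p$, and $\operatorname{lin}(f)$ is the vector subspace parallel to the affine span $\langle f\rangle$ of $f$. The transverse cone $t(p,f)$ is the image in $W/\operatorname{lin}(f)$ of $\langle f\rangle+c(p,f)$, where $c(p,f)$ is the cone of feasible directions of $p$ at a relative interior point of $f$. For a polyhedron $p$, let $S(p)$ and $I(p)$ be the meromorphic functions near $0$ on $W^*$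 that are $0$ if $p$ contains a straight line and otherwise are given by $$S(p)(\xi)=\sum_{x\in p\cap\Lambda}e^{\langle\xi,x\rangle},\qquad I(p)(\xi)=\int_p e^{\langle\xi,x\rangle}\,dm(x)$$ wherever the sum, respectively the integral, converges absolutely; here $m$ is the Lebesgue measure on $\langle p\rangle$ normalized by the lattice $\Lambda\cap\operatorname{lin}(p)$ of $\operatorname{lin}(p)$. For an affine cone $a$ in a rational space $W$ define the meromorphic function $\mu(a)$ near $0$ on $W^*$, by recursion on the dimension of $a$: $\mu(a)=0$ if $a$ contains a straight line; if $a$ is pointed with vertex $s$, then $$\mu(a)(\xi)=e^{-\langle\xi,s\rangle}\Big(S(a)(\xi)-\sum_{f\in\mathcal F(a),\ \dim f>0}\mu(t(a,f))(\xi)\,I(f)(\xi)\Big),$$ where $\mu(t(a,f))$ is the function of the affine cone $t(a,f)$ in the rational space $W/\operatorname{lin}(f)$. **Theorem.** For every rational space $W$ with lattice $\Lambda$ and rational scalar product, the following equalities of meromorphic functions near $0$ on $W^*$ hold. (a) $\mu(x+a)=\mu(a)$ for every affine cone $a$ in $W$ and every $x\in\Lambda$. (b) If $g$ is a linear isometry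 of $W$ with $g(\Lambda)=\Lambda$, then $\mu(g(a))({}^tg^{-1}\xi)=\mu(a)(\xi)$ for every affine cone $a$ in $W$. (c) If $W=W_1\oplus W_2$ is an orthogonal sum of rational spaces (so $\Lambda=\Lambda_1\oplus\Lambda_2$, with $\Lambda_i$ the lattice of $W_i$) and $a_i$ is an affine cone in $W_i$ for $i=1,2$, then $\mu(a_1+a_2)=\mu(a_1)\mu(a_2)$. (d) For a fixed rational point $s\in W$, the map $c\mapsto\mu(s+c)$ is a valuation on cones: if $c_1,\dots,c_n$ are cones in $W$ and $r_1,\dots,r_n\in\mathbb R$ satisfy $\sum_i r_i\chi(c_i)=0$, where $\chi$ denotes the indicator function, then $\sum_i r_i\,\mu(s+c_i)=0$. (e) Every polyhedron $p\subset W$ has finitely many faces, and $$S(p)=\sum_{f\in\mathcal F(p)}\mu(t(p,f))\,I(f).$$ -/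

import Mathlib

open scoped Pointwise Topology
open MeasureTheory

namespace LocalEM

noncomputable section

/-! ### Germs at `0` of meromorphic functions on the dual space -/

section Germs

variable (E : Type*) [NormedAddCommGroup E] [NormedSpace ℝ E]

/-- The ring of germs at `0` of (real-)analytic functions on the dual space `E^*`, that is, of
convergent power series with real coefficients on `E^*`; equivalently, germs of holomorphic
functions on the complexification of `E^*` with real Taylor coefficients. -/
def AnGerm : Subring (Filter.Germ (𝓝 (0 : StrongDual ℝ E)) ℝ) where
  carrier := {φ | ∃ f : StrongDual ℝ E → ℝ, AnalyticAt ℝ f 0 ∧ φ = Filter.Germ.ofFun f}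
  mul_mem' := by
    rintro _ _ ⟨f, hf, rfl⟩ ⟨g, hg, rfl⟩
    exact ⟨f * g, hf.mul hg, rfl⟩
  one_mem' := ⟨fun _ => 1, analyticAt_const, rfl⟩
  add_mem' := by
    rintro _ _ ⟨f, hf, rfl⟩ ⟨g, hg, rfl⟩
    exact ⟨f + g, hf.add hg, rfl⟩
  zero_mem' := ⟨fun _ => 0, analyticAt_const, rfl⟩
  neg_mem' := by
    rintro _ ⟨f, hf, rfl⟩
    exact ⟨-f, hf.neg, rfl⟩

/-- The ring of germs at `0` of meromorphic functions on `E^*`: quotients of analytic germs. -/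
abbrev Mer : Type _ := FractionRing (AnGerm E)

variable {E}

/-- The germ at `0` of a function on `E^*` that is analytic at `0`. -/
def anGerm (f : StrongDual ℝ E → ℝ) (hf : AnalyticAt ℝ f 0) : AnGerm E :=
  ⟨Filter.Germ.ofFun f, f, hf, rfl⟩

/-- A function analytic at `0`, regarded as a meromorphic germ. -/
def toMer (f : StrongDual ℝ E → ℝ) (hf : AnalyticAt ℝ f 0) : Mer E :=
  algebraMap (AnGerm E) (Mer E) (anGerm f hf)

/-- The constant function with value `r`. -/
def constMer (r : ℝ) : Mer E := toMer (fun _ => r) analyticAt_const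

theorem analyticAt_exp_pairing (x : E) :
    AnalyticAt ℝ (fun ξ : StrongDual ℝ E => Real.exp (ξ x)) 0 :=
  ((ContinuousLinearMap.apply ℝ ℝ x).analyticAt 0).rexp

/-- The function `ξ ↦ e^{⟨ξ, x⟩}`. -/
def expMer (x : E) : Mer E := toMer (fun ξ => Real.exp (ξ x)) (analyticAt_exp_pairing x)

/-- `AgreesOn φ D F`: the meromorphic germ `φ` can be written as a quotient `f / g` of functions
analytic at `0`, with `g` not identically zero near `0`, such that `F = f / g` on the points of
`D` close to `0`. -/
def AgreesOn (φ : Mer E) (D : Set (StrongDual ℝ E)) (F : StrongDual ℝ E → ℝ) : Prop :=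
  ∃ (f g : StrongDual ℝ E → ℝ) (hf : AnalyticAt ℝ f 0) (hg : AnalyticAt ℝ g 0),
    ¬ (∀ᶠ ξ in 𝓝 0, g ξ = 0) ∧ φ * toMer g hg = toMer f hf ∧
      ∀ᶠ ξ in 𝓝 0, ξ ∈ D → F ξ * g ξ = f ξ

theorem tendsto_equiv_zero (T : StrongDual ℝ E ≃L[ℝ] StrongDual ℝ E) :
    Filter.Tendsto T (𝓝 0) (𝓝 0) := by
  simpa using T.continuous.tendsto 0

/-- Composition of analytic germs with a linear map of `E^*`: `f ↦ f ∘ T`. -/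
def AnGerm.comp (T : StrongDual ℝ E ≃L[ℝ] StrongDual ℝ E) (φ : AnGerm E) : AnGerm E :=
  ⟨φ.1.compTendsto T (tendsto_equiv_zero T), by
    obtain ⟨_, f, hf, rfl⟩ := φ
    refine ⟨f ∘ T, ?_, rfl⟩
    exact AnalyticAt.comp (by simpa using hf) (T.analyticAt 0)⟩

/-- Composition with a linear automorphism of `E^*`, as an automorphism of the ring of analytic
germs. -/
def AnGerm.compEquiv (T : StrongDual ℝ E ≃L[ℝ] StrongDual ℝ E) : AnGerm E ≃+* AnGerm E where
  toFun := AnGerm.comp T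
  invFun := AnGerm.comp T.symm
  left_inv := by
    rintro ⟨_, f, hf, rfl⟩
    apply Subtype.ext
    change Filter.Germ.ofFun ((f ∘ T) ∘ T.symm) = Filter.Germ.ofFun f
    congr 1
    funext ξ
    simp
  right_inv := by
    rintro ⟨_, f, hf, rfl⟩
    apply Subtype.ext
    change Filter.Germ.ofFun ((f ∘ T.symm) ∘ T) = Filter.Germ.ofFun f
    congr 1
    funext ξ
    simp
  map_mul' := by
    rintro ⟨_, f, hf, rfl⟩ ⟨_, g, hg, rfl⟩
    rfl
  map_add' := by
    rintro ⟨_, f, hf, rfl⟩ ⟨_, g, hg, rfl⟩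
    rfl

/-- Composition of meromorphic germs with a linear automorphism of `E^*`: `φ ↦ φ ∘ T`. -/
def Mer.comp (T : StrongDual ℝ E ≃L[ℝ] StrongDual ℝ E) : Mer E ≃+* Mer E :=
  IsLocalization.ringEquivOfRingEquiv (M := nonZeroDivisors (AnGerm E))
    (T := nonZeroDivisors (AnGerm E)) (Mer E) (Mer E) (AnGerm.compEquiv T)
    (MulEquivClass.map_nonZeroDivisors (AnGerm.compEquiv T))

end Germs

/-! ### Rational spaces, polyhedra and cones

A rational space with a scalar product is given, inside an ambient Euclidean space `E`, by a
discrete subgroup `Λ` of `E`: it is the subspace `W` spanned by `Λ`, with lattice `Λ` and with the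
scalar product of `E`.  Linear forms on `W` are restrictions of linear forms on `E`, and a function
on `W^*` is regarded as the function `ξ ↦ φ (ξ|_W)` on `E^*`; by means of the identification of
`W^*` with a subspace of `E^*` through the scalar product, this is the extension of `φ` by
orthogonal projection. -/

section Rational

variable {E : Type*} [NormedAddCommGroup E] [InnerProductSpace ℝ E] [FiniteDimensional ℝ E]

/-- The subspace parallel to the affine subspace generated by `p`. -/
abbrev lin (p : Set E) : Submodule ℝ E := vectorSpan ℝ p

/-- The orthogonal projection of `E` onto the orthogonal complement of `L`.  For a subspace `L` of
`W` it restricts to the quotient map `W → W / L`, with `W / L` identified with the orthogonal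
complement of `L` in `W`. -/
abbrev quotProj (L : Submodule ℝ E) : E →L[ℝ] E := Lᗮ.starProjection

/-- The lattice of the quotient space `W / L`: the image of the lattice of `W`. -/
def quotLattice (Λ : Submodule ℤ E) (L : Submodule ℝ E) : Submodule ℤ E :=
  Λ.map ((quotProj L : E →ₗ[ℝ] E).restrictScalars ℤ)

/-- Rational points of the rational space with lattice `Λ`. -/
def IsRationalPoint (Λ : Submodule ℤ E) (x : E) : Prop := ∃ q : ℤ, q ≠ 0 ∧ q • x ∈ Λ

/-- (Convex rational) polyhedra in the rational space `W` with lattice `Λ`: finite intersections of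
half-spaces `{x ∈ W | ⟨η, x⟩ ≤ c}`, with `η` integral on `Λ` and `c` rational. -/
def IsPolyhedron (Λ : Submodule ℤ E) (p : Set E) : Prop :=
  ∃ H : Finset (StrongDual ℝ E × ℚ), (∀ h ∈ H, ∀ x ∈ Λ, ∃ n : ℤ, h.1 x = n) ∧
    p = {x | x ∈ Submodule.span ℝ (Λ : Set E) ∧ ∀ h ∈ H, h.1 x ≤ h.2}

/-- (Convex rational) cones: generated by finitely many rational points. -/
def IsCone (Λ : Submodule ℤ E) (c : Set E) : Prop :=
  ∃ G : Finset E, (∀ v ∈ G, IsRationalPoint Λ v) ∧ c = (PointedCone.hull ℝ (G : Set E) : Set E)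

/-- Affine (rational) cones: translates of cones by rational points. -/
def IsAffineCone (Λ : Submodule ℤ E) (a : Set E) : Prop :=
  ∃ (s : E) (c : Set E), IsRationalPoint Λ s ∧ IsCone Λ c ∧ a = s +ᵥ c

/-- `p` contains a straight line. -/
def ContainsLine (p : Set E) : Prop := ∃ x v : E, v ≠ 0 ∧ ∀ t : ℝ, x + t • v ∈ p

/-- The (non-empty) faces of a polyhedron. -/
def faces (p : Set E) : Set (Set E) := {f | f.Nonempty ∧ IsExposed ℝ p f}

/-- The cone of feasible directions of `p` at a point of the relative interior of `f`. -/
def feasibleCone (p f : Set E) : Set E :=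
  {v | ∃ x ∈ intrinsicInterior ℝ f, ∀ᶠ ε : ℝ in 𝓝[>] 0, x + ε • v ∈ p}

/-- The transverse cone of `p` along its face `f`: the projection of the supporting cone to the
quotient by `lin f`. -/
def transverseCone (p f : Set E) : Set E :=
  quotProj (lin f) '' ((affineSpan ℝ f : Set E) + feasibleCone p f)

theorem finrank_lin_transverseCone_lt {a f : Set E} (hf : f ∈ faces a)
    (h0 : 0 < Module.finrank ℝ (lin f)) :
    Module.finrank ℝ (lin (transverseCone a f)) < Module.finrank ℝ (lin a) := by
  have hfa : f ⊆ a := hf.2.subset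
  have hL : lin f ≤ lin a := vectorSpan_mono ℝ hfa
  have hfeas : ∀ v ∈ feasibleCone a f, v ∈ lin a := by
    rintro v ⟨x, hx, hv⟩
    have hxa : x ∈ a := hfa (intrinsicInterior_subset hx)
    obtain ⟨ε, hε, hpos⟩ := (hv.and self_mem_nhdsWithin).exists
    have h1 := vsub_mem_vectorSpan ℝ hε hxa
    have h2 : ε • v ∈ lin a := by simpa using h1
    exact ((lin a).smul_mem_iff (ne_of_gt hpos)).1 h2
  have hle : lin (transverseCone a f) ≤
      (lin a).map (quotProj (lin f) : E →ₗ[ℝ] E) := by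
    rw [lin, vectorSpan_def, Submodule.span_le]
    rintro _ ⟨_, ⟨_, ⟨y₁, hy₁, v₁, hv₁, rfl⟩, rfl⟩, _, ⟨_, ⟨y₂, hy₂, v₂, hv₂, rfl⟩, rfl⟩, rfl⟩
    refine ⟨(y₁ - y₂) + (v₁ - v₂), ?_, ?_⟩
    · refine (lin a).add_mem (hL ?_) ((lin a).sub_mem (hfeas _ hv₁) (hfeas _ hv₂))
      have h3 := AffineSubspace.vsub_mem_direction hy₁ hy₂
      rwa [direction_affineSpan] at h3
    · simp only [vsub_eq_sub, ContinuousLinearMap.coe_coe, map_add, map_sub]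
      abel
  refine lt_of_le_of_lt (Submodule.finrank_mono hle) ?_
  have hrn := LinearMap.finrank_range_add_finrank_ker
    ((quotProj (lin f) : E →ₗ[ℝ] E).domRestrict (lin a))
  rw [LinearMap.range_domRestrict] at hrn
  have hker : 0 < Module.finrank ℝ
      (LinearMap.ker ((quotProj (lin f) : E →ₗ[ℝ] E).domRestrict (lin a))) := by
    obtain ⟨⟨z, hz⟩, hz0⟩ := (Module.finrank_pos_iff_exists_ne_zero (R := ℝ)).1 h0
    refine (Module.finrank_pos_iff_exists_ne_zero (R := ℝ)).2 ⟨⟨⟨z, hL hz⟩, ?_⟩, ?_⟩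
    · rw [LinearMap.mem_ker, LinearMap.domRestrict_apply, ContinuousLinearMap.coe_coe,
        Submodule.starProjection_apply_eq_zero_iff]
      simpa using hz
    · intro h
      apply hz0
      apply Subtype.ext
      exact congrArg (fun w => ((w : lin a) : E)) (congrArg Subtype.val h)
  omega

open Classical in
/-- The vertex of a pointed affine cone, as its unique extreme point. -/
def vertex (a : Set E) : E :=
  if h : (a.extremePoints ℝ).Nonempty then h.some else 0

/-! ### The meromorphic functions `S(p)` and `I(p)` -/

open Classical in
/-- The meromorphic function `S(p)`: it is `0` if `p` contains a straight line, and otherwise it is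
the meromorphic function equal to the sum of `e^{⟨ξ, x⟩}` over the lattice points `x` of `p`
wherever that sum converges. -/
def S (Λ : Submodule ℤ E) (p : Set E) : Mer E :=
  if h : ¬ ContainsLine p ∧ ∃ φ : Mer E, AgreesOn φ
      {ξ | Summable fun x : ↥(p ∩ (Λ : Set E)) => Real.exp (ξ x)}
      (fun ξ => ∑' x : ↥(p ∩ (Λ : Set E)), Real.exp (ξ x))
  then h.2.choose else 0

variable [MeasurableSpace E] [BorelSpace E]

/-- The Haar measure on a subspace `L` for which `L / (L ∩ Λ)` has measure `1`. -/
def latticeMeasure (Λ : Submodule ℤ E) (L : Submodule ℝ E) : Measure L :=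
  (ENNReal.ofReal (ZLattice.covolume (ZLattice.comap ℝ Λ L.subtype)
    (Measure.addHaar : Measure L)))⁻¹ • (Measure.addHaar : Measure L)

open Classical in
/-- The canonical Lebesgue measure on the affine space generated by `p`: the translate of the
canonical measure of `lin p` by any point of `p`. -/
def affineMeasure (Λ : Submodule ℤ E) (p : Set E) : Measure E :=
  if h : p.Nonempty then (latticeMeasure Λ (lin p)).map (fun y : lin p => h.some + (y : E)) else 0

open Classical in
/-- The meromorphic function `I(p)`: it is `0` if `p` contains a straight line, and otherwise it is
the meromorphic function equal to the integral of `e^{⟨ξ, x⟩}` over `p` wherever that integral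
converges. -/
def I (Λ : Submodule ℤ E) (p : Set E) : Mer E :=
  if h : ¬ ContainsLine p ∧ ∃ φ : Mer E, AgreesOn φ
      {ξ | IntegrableOn (fun x => Real.exp (ξ x)) p (affineMeasure Λ p)}
      (fun ξ => ∫ x in p, Real.exp (ξ x) ∂(affineMeasure Λ p))
  then h.2.choose else 0

/-! ### The functions `μ(a)` -/

open Classical in
/-- The function `μ(a)` of an affine cone `a` in the rational space with lattice `Λ`.  It is `0` if
`a` contains a straight line.  For a pointed cone with vertex `s`, it is determined recursively by
the relation `S(a) = ∑ μ(t(a, f)) I(f)`, with the sum over all faces `f` of `a`, in which the term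
of the face `{s}` is `e^{⟨ξ, s⟩} μ(a)`. -/
def mu (Λ : Submodule ℤ E) (a : Set E) : Mer E :=
  if ContainsLine a then 0 else
    expMer (-vertex a) * (S Λ a -
      ∑ᶠ f : {f : Set E // f ∈ faces a ∧ 0 < Module.finrank ℝ (lin f)},
        mu (quotLattice Λ (lin f.1)) (transverseCone a f.1) * I Λ f.1)
termination_by Module.finrank ℝ (lin a)
decreasing_by exact finrank_lin_transverseCone_lt f.2.1 f.2.2

end Rational

end

end LocalEM

/-!
The functions `S(p)` and `I(p)` are both instances of one linear construction, the exponential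
transform `HasTransform` of the indicator function of `p` with respect to a measure invariant
under lattice translations: the counting measure of the lattice, or the normalized Lebesgue
measure of the affine span of `p`.  A difference operator `1 - τ_v` along a period `v` of the
measure multiplies the transform by `1 - e^v`, and finitely many of them turn the indicator
function of a rational polyhedron into a function of bounded support (`annihilable_chi_hpoly`),
whose exponential integral is analytic. Dividing by the factors `1 - e^v` defines the transform
for all rational polyhedra.  It is `0` for polyhedra that contain a line, because their indicator
functions are periodic, and it is the sum or integral where this converges (`S_hasTransform`,
`I_hasTransform`).  Hence `S` and `I` respect linear relations between indicator functions that
hold almost everywhere, even relations with meromorphic coefficients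
(`sum_mul_transform_eq_zero`).

A polyhedron is given by integral linear inequalities indexed by a finite set, and its faces
correspond to the sets of inequalities that are active at its points (`faces_poly`).  The
transverse cone of a face is given by the inequalities active on it (`transverseCone_face`).  In
these terms the local formula is a finite sum over sets of inequalities (`finsum_faces_poly`), and
for affine cones it is the definition of `μ` (`S_cone`): the term of the vertex `s` is `μ(a) e^s`.

The valuation property (`coneRelations`) is proved by induction on the dimension.  Given a
relation between indicator functions of polyhedra, consider the faces that generate a fixed affine
subspace `M` of positive dimension.  The sum of their terms `μ(t(p, f)) I(f)` is the transform, on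
`M`, of the sum of the `μ(t(p, f)) χ(f)`.  At a point `x` of `M` that lies on no bounding
hyperplane except those containing `M`, the value of the latter is the given combination of the
`μ` of the tangent cones at `x` modulo the directions of `M`; these cones satisfy the same
relation, so this is `0` by induction (`sum_faces_generating`).  Thus only the terms of the
vertices remain.

The local formula for polyhedra follows.  The argument just given shows that both of its sides are
valuations (`sum_S`, `sum_local_formula`), they agree on affine cones, and the indicator function
of every rational polyhedron is a linear combination of indicator functions of affine cones
(`chi_flat_inter_mem_coneSpan`).  The last fact is obtained by adding the inequalities one at a
time: a half-space that does not meet the vertex `s` of a cone cuts it in the union of the rays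
that start in a section by a hyperplane and point away from `s`.  The section is a combination of
cones by induction, and extending these radially gives cones, by Fourier–Motzkin elimination
(`exists_hpoly_add_ray`).

Equivariance (`comp_mu`, which covers lattice translations too) and multiplicativity (`mu_add`)
are inherited from `S` and `I`, by induction on the dimension: in the formulas `S_cone` for the
cones to be compared the terms of all faces of positive dimension match, so the vertex terms match
as well (`eq_zero_of_sum_faces`).  Finitely generated cones are brought into the form used above
by Weyl's theorem (`exists_hpoly_of_isCone`), which is again Fourier–Motzkin elimination.
-/

namespace LocalEM

/-! ### The field of meromorphic germs -/

section MeromorphicGerms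

section Identity

variable {F : Type*} [NormedAddCommGroup F] [NormedSpace ℝ F]

/-- The identity principle for a set `U` whose interior accumulates at `0`. -/
theorem eventually_eq_zero_of_eqOn {f : F → ℝ} {U : Set F} (hf : AnalyticAt ℝ f 0)
    (hU : (0 : F) ∈ closure (interior U)) (h : ∀ᶠ ξ in 𝓝 0, ξ ∈ U → f ξ = 0) :
    ∀ᶠ ξ in 𝓝 0, f ξ = 0 := by
  obtain ⟨r, hr, hball⟩ := Metric.eventually_nhds_iff_ball.1 (hf.eventually_analyticAt.and h)
  obtain ⟨z, hz, hzU⟩ := mem_closure_iff_nhds.1 hU _ (Metric.ball_mem_nhds (0 : F) hr)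
  have hz0 : f =ᶠ[𝓝 z] 0 := by
    filter_upwards [isOpen_interior.mem_nhds hzU, Metric.isOpen_ball.mem_nhds hz] with w hw hwb
    exact (hball w hwb).2 (interior_subset hw)
  have := AnalyticOnNhd.eqOn_zero_of_preconnected_of_eventuallyEq_zero
    (fun w hw => (hball w hw).1) (convex_ball (0 : F) r).isPreconnected hz hz0
  filter_upwards [Metric.ball_mem_nhds (0 : F) hr] with w hw using this hw

theorem zero_mem_closure_interior_ne_zero {g : F → ℝ} (hg : AnalyticAt ℝ g 0)
    (h : ¬ ∀ᶠ ξ in 𝓝 0, g ξ = 0) : (0 : F) ∈ closure (interior {ξ | g ξ ≠ 0}) := by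
  rw [mem_closure_iff_frequently]
  refine (Filter.not_eventually.1 h).mp ?_
  filter_upwards [hg.eventually_analyticAt] with ξ hξ hne
  exact mem_interior_iff_mem_nhds.2 (hξ.continuousAt.eventually_ne hne)

/-- A product of analytic germs vanishes only if a factor does, as analytic functions vanish on a
neighborhood of `0` if they do so on an open set accumulating at `0`. -/
theorem eventually_eq_zero_or_of_mul {f g : F → ℝ} (hf : AnalyticAt ℝ f 0)
    (hg : AnalyticAt ℝ g 0) (h : ∀ᶠ ξ in 𝓝 0, f ξ * g ξ = 0) :
    (∀ᶠ ξ in 𝓝 0, f ξ = 0) ∨ ∀ᶠ ξ in 𝓝 0, g ξ = 0 := by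
  refine or_iff_not_imp_right.2 fun hne => ?_
  exact eventually_eq_zero_of_eqOn hf (zero_mem_closure_interior_ne_zero hg hne)
    (h.mono fun ξ hξ h0 => (mul_eq_zero.1 hξ).resolve_right h0)

end Identity

variable {E : Type*} [NormedAddCommGroup E] [NormedSpace ℝ E]

instance : IsDomain (AnGerm E) := by
  have : NoZeroDivisors (AnGerm E) := by
    refine ⟨?_⟩
    rintro ⟨_, f, hf, rfl⟩ ⟨_, g, hg, rfl⟩ h
    have h' : ∀ᶠ ξ in 𝓝 0, f ξ * g ξ = 0 := Filter.Germ.coe_eq.1 (congrArg Subtype.val h)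
    rcases eventually_eq_zero_or_of_mul hf hg h' with h0 | h0
    · exact Or.inl (Subtype.ext (Filter.Germ.coe_eq.2 h0))
    · exact Or.inr (Subtype.ext (Filter.Germ.coe_eq.2 h0))
  have : Nontrivial (AnGerm E) := by
    refine ⟨⟨0, 1, fun h => ?_⟩⟩
    have h' : ∀ᶠ ξ in 𝓝 (0 : StrongDual ℝ E), (0 : ℝ) = 1 :=
      Filter.Germ.coe_eq.1 (congrArg Subtype.val h)
    exact zero_ne_one h'.self_of_nhds
  exact NoZeroDivisors.to_isDomain _

noncomputable instance : Field (Mer E) := FractionRing.field (AnGerm E)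

theorem toMer_congr {f g : StrongDual ℝ E → ℝ} (hf : AnalyticAt ℝ f 0) (hg : AnalyticAt ℝ g 0)
    (h : ∀ᶠ ξ in 𝓝 0, f ξ = g ξ) : toMer f hf = toMer g hg := by
  unfold toMer
  congr 1
  exact Subtype.ext (Filter.Germ.coe_eq.2 h)

theorem toMer_eq_zero_iff {f : StrongDual ℝ E → ℝ} (hf : AnalyticAt ℝ f 0) :
    toMer f hf = 0 ↔ ∀ᶠ ξ in 𝓝 0, f ξ = 0 := by
  unfold toMer
  rw [map_eq_zero_iff _ (IsFractionRing.injective (AnGerm E) (Mer E))]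
  exact ⟨fun h => Filter.Germ.coe_eq.1 (congrArg Subtype.val h),
    fun h => Subtype.ext (Filter.Germ.coe_eq.2 h)⟩

theorem toMer_mul {f g : StrongDual ℝ E → ℝ} (hf : AnalyticAt ℝ f 0) (hg : AnalyticAt ℝ g 0) :
    toMer f hf * toMer g hg = toMer (fun ξ => f ξ * g ξ) (hf.fun_mul hg) := by
  unfold toMer
  rw [← map_mul]
  rfl

theorem toMer_add {f g : StrongDual ℝ E → ℝ} (hf : AnalyticAt ℝ f 0) (hg : AnalyticAt ℝ g 0) :
    toMer f hf + toMer g hg = toMer (fun ξ => f ξ + g ξ) (hf.fun_add hg) := by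
  unfold toMer
  rw [← map_add]
  rfl

theorem toMer_one : toMer (fun _ : StrongDual ℝ E => (1 : ℝ)) analyticAt_const = 1 :=
  map_one (algebraMap (AnGerm E) (Mer E))

theorem toMer_zero : toMer (fun _ : StrongDual ℝ E => (0 : ℝ)) analyticAt_const = 0 :=
  map_zero (algebraMap (AnGerm E) (Mer E))

/-- Constants as a ring homomorphism into meromorphic germs. -/
noncomputable def constHom (E : Type*) [NormedAddCommGroup E] [NormedSpace ℝ E] : ℝ →+* Mer E where
  toFun := constMer
  map_one' := toMer_one
  map_zero' := toMer_zero
  map_mul' r s := (toMer_mul (E := E) (f := fun _ => r) (g := fun _ => s)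
    analyticAt_const analyticAt_const).symm
  map_add' r s := (toMer_add (E := E) (f := fun _ => r) (g := fun _ => s)
    analyticAt_const analyticAt_const).symm

theorem constHom_apply (r : ℝ) : constHom E r = constMer r := rfl

theorem expMer_add (x y : E) : expMer (x + y) = expMer x * expMer y := by
  unfold expMer
  rw [toMer_mul]
  exact toMer_congr _ _ (Filter.Eventually.of_forall fun ξ => by simp [Real.exp_add])

theorem expMer_zero : expMer (0 : E) = 1 := by
  rw [← toMer_one]
  exact toMer_congr _ _ (Filter.Eventually.of_forall fun ξ => by simp)

theorem expMer_neg_mul (x : E) : expMer (-x) * expMer x = 1 := by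
  rw [← expMer_add, neg_add_cancel, expMer_zero]

theorem expMer_ne_zero (x : E) : expMer x ≠ 0 := fun h => by
  simpa [h] using expMer_neg_mul x

/-- Identity principle: a meromorphic germ is determined by its values on a set of linear forms
whose interior accumulates at `0`. -/
theorem AgreesOn.unique {φ φ' : Mer E} {D D' U : Set (StrongDual ℝ E)} {F F' : StrongDual ℝ E → ℝ}
    (h : AgreesOn φ D F) (h' : AgreesOn φ' D' F') (hD : U ⊆ D) (hD' : U ⊆ D')
    (hU : 0 ∈ closure (interior U)) (hF : ∀ ξ ∈ U, F ξ = F' ξ) : φ = φ' := by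
  obtain ⟨f, g, hf, hg, hg0, e, hfg⟩ := h
  obtain ⟨f', g', hf', hg', hg0', e', hfg'⟩ := h'
  have key : toMer f hf * toMer g' hg' = toMer f' hf' * toMer g hg := by
    rw [toMer_mul, toMer_mul]
    have h0 := eventually_eq_zero_of_eqOn ((hf.fun_mul hg').fun_sub (hf'.fun_mul hg)) hU (by
      filter_upwards [hfg, hfg'] with ξ h1 h2 hξ
      rw [← h1 (hD hξ), ← h2 (hD' hξ), hF ξ hξ]
      ring)
    exact toMer_congr _ _ (h0.mono fun ξ hξ => sub_eq_zero.1 hξ)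
  have n1 : toMer g hg ≠ 0 := fun h => hg0 ((toMer_eq_zero_iff hg).1 h)
  have n2 : toMer g' hg' ≠ 0 := fun h => hg0' ((toMer_eq_zero_iff hg').1 h)
  apply mul_right_cancel₀ n1
  apply mul_right_cancel₀ n2
  rw [e, key, ← e']
  ring

theorem AgreesOn.mul {φ φ' : Mer E} {D D' : Set (StrongDual ℝ E)} {F F' : StrongDual ℝ E → ℝ}
    (h : AgreesOn φ D F) (h' : AgreesOn φ' D' F') :
    AgreesOn (φ * φ') (D ∩ D') (fun ξ => F ξ * F' ξ) := by
  obtain ⟨f, g, hf, hg, hg0, e, hfg⟩ := h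
  obtain ⟨f', g', hf', hg', hg0', e', hfg'⟩ := h'
  refine ⟨_, _, hf.fun_mul hf', hg.fun_mul hg', fun h0 => ?_, ?_, ?_⟩
  · exact (eventually_eq_zero_or_of_mul hg hg' h0).elim hg0 hg0'
  · rw [← toMer_mul hg hg', ← toMer_mul hf hf', ← e, ← e']
    ring
  · filter_upwards [hfg, hfg'] with ξ h1 h2 hξ
    rw [← h1 hξ.1, ← h2 hξ.2]
    ring

theorem AgreesOn.mono {φ : Mer E} {D D' : Set (StrongDual ℝ E)} {F F' : StrongDual ℝ E → ℝ}
    (h : AgreesOn φ D F) (hD : D' ⊆ D) (hF : ∀ ξ ∈ D', F' ξ = F ξ) : AgreesOn φ D' F' := by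
  obtain ⟨f, g, hf, hg, hg0, e, hfg⟩ := h
  exact ⟨f, g, hf, hg, hg0, e, hfg.mono fun ξ h hξ => by rw [hF ξ hξ, h (hD hξ)]⟩

theorem agreesOn_toMer {f : StrongDual ℝ E → ℝ} (hf : AnalyticAt ℝ f 0)
    (D : Set (StrongDual ℝ E)) : AgreesOn (toMer f hf) D f :=
  ⟨f, fun _ => 1, hf, analyticAt_const, fun h => one_ne_zero h.self_of_nhds,
    by rw [toMer_one, mul_one], Filter.Eventually.of_forall fun ξ _ => mul_one _⟩

theorem comp_toMer (T : StrongDual ℝ E ≃L[ℝ] StrongDual ℝ E) {f : StrongDual ℝ E → ℝ}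
    (hf : AnalyticAt ℝ f 0) : Mer.comp T (toMer f hf) =
      toMer (f ∘ T) (AnalyticAt.comp (by simpa using hf) (T.analyticAt 0)) := by
  exact IsLocalization.ringEquivOfRingEquiv_eq _ _

theorem AgreesOn.comp {φ : Mer E} {D : Set (StrongDual ℝ E)} {F : StrongDual ℝ E → ℝ}
    (h : AgreesOn φ D F) (T : StrongDual ℝ E ≃L[ℝ] StrongDual ℝ E) :
    AgreesOn (Mer.comp T φ) (T ⁻¹' D) (F ∘ T) := by
  obtain ⟨f, g, hf, hg, hg0, e, hfg⟩ := h
  refine ⟨f ∘ T, g ∘ T, AnalyticAt.comp (by simpa using hf) (T.analyticAt 0),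
    AnalyticAt.comp (by simpa using hg) (T.analyticAt 0), fun h0 => ?_, ?_,
    (tendsto_equiv_zero T).eventually hfg⟩
  · apply hg0
    filter_upwards [(tendsto_equiv_zero T.symm).eventually h0] with ξ hξ
    simpa using hξ
  · rw [← comp_toMer T hg, ← comp_toMer T hf, ← map_mul, e]

end MeromorphicGerms

/-! ### Exponential transforms of functions annihilated by difference operators -/

section Transform

/-- A tensor `∑ m_k ⊗ φ_k` over `ℝ` that is killed by all linear forms on the first factor is `0`,
and so is its image under multiplication. -/
theorem sum_mul_eq_zero_of_forall_dual {R κ : Type*} [CommRing R] [Algebra ℝ R] (K : Finset κ)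
    (m φ : κ → R) (h : ∀ l : R →ₗ[ℝ] ℝ, ∑ k ∈ K, l (m k) • φ k = 0) : ∑ k ∈ K, m k * φ k = 0 := by
  classical
  -- expand the first factors in a basis of `R` over `ℝ`
  let b := Module.Basis.ofVectorSpace ℝ R
  let J := K.biUnion fun k => (b.repr (m k)).support
  have hm : ∀ k ∈ K, m k = ∑ j ∈ J, b.coord j (m k) • b j := by
    intro k hk
    conv_lhs => rw [← b.linearCombination_repr (m k), Finsupp.linearCombination_apply]
    rw [Finsupp.sum_of_support_subset _ (Finset.subset_biUnion_of_mem
      (fun k => (b.repr (m k)).support) hk) _ (by simp)]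
    rfl
  calc ∑ k ∈ K, m k * φ k = ∑ k ∈ K, ∑ j ∈ J, b j * (b.coord j (m k) • φ k) := by
        refine Finset.sum_congr rfl fun k hk => ?_
        conv_lhs => rw [hm k hk, Finset.sum_mul]
        exact Finset.sum_congr rfl fun j _ => by rw [smul_mul_assoc, mul_smul_comm]
    _ = ∑ j ∈ J, b j * ∑ k ∈ K, b.coord j (m k) • φ k := by
        rw [Finset.sum_comm]
        exact Finset.sum_congr rfl fun j _ => (Finset.mul_sum _ _ _).symm
    _ = 0 := Finset.sum_eq_zero fun j _ => by rw [h, mul_zero]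

section DifferenceOperators

variable {E : Type*} [AddCommGroup E]

/-- The difference operator `f ↦ f - f(· - v)`. -/
def diffOp (v : E) : Module.End ℝ (E → ℝ) where
  toFun f x := f x - f (x - v)
  map_add' f g := by ext x; simp only [Pi.add_apply]; ring
  map_smul' r f := by ext x; simp only [Pi.smul_apply, smul_eq_mul, RingHom.id_apply]; ring

theorem diffOp_apply (v : E) (f : E → ℝ) (x : E) : diffOp v f x = f x - f (x - v) := rfl

theorem commute_diffOp (v w : E) : Commute (diffOp v) (diffOp w) := by
  ext f x
  simp only [Module.End.mul_apply, diffOp_apply, sub_right_comm x v w]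
  ring

/-- The composition of the difference operators of a list of vectors. -/
def iterDiff (A : List E) : Module.End ℝ (E → ℝ) := (A.map diffOp).prod

theorem iterDiff_nil (f : E → ℝ) : iterDiff [] f = f := rfl

theorem iterDiff_cons (v : E) (A : List E) (f : E → ℝ) :
    iterDiff (v :: A) f = diffOp v (iterDiff A f) := by
  simp [iterDiff]

theorem iterDiff_append (A B : List E) (f : E → ℝ) :
    iterDiff (A ++ B) f = iterDiff A (iterDiff B f) := by
  simp [iterDiff]

theorem commute_iterDiff (A B : List E) : Commute (iterDiff A) (iterDiff B) := by
  refine Commute.list_prod_left _ _ fun x hx => Commute.list_prod_right _ _ fun y hy => ?_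
  obtain ⟨v, -, rfl⟩ := List.mem_map.1 hx
  obtain ⟨w, -, rfl⟩ := List.mem_map.1 hy
  exact commute_diffOp v w

theorem iterDiff_comm (A B : List E) (f : E → ℝ) :
    iterDiff A (iterDiff B f) = iterDiff B (iterDiff A f) :=
  LinearMap.congr_fun (commute_iterDiff A B).eq f

end DifferenceOperators

/-- Bounded measurable functions. -/
def BddMeas {E : Type*} [MeasurableSpace E] (f : E → ℝ) : Prop :=
  Measurable f ∧ ∃ C : ℝ, ∀ x, |f x| ≤ C

section BddMeas

variable {E : Type*} [MeasurableSpace E]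

theorem BddMeas.add {f g : E → ℝ} (hf : BddMeas f) (hg : BddMeas g) : BddMeas (f + g) := by
  obtain ⟨hf, C, hC⟩ := hf
  obtain ⟨hg, C', hC'⟩ := hg
  exact ⟨hf.add hg, C + C', fun x => (abs_add_le _ _).trans (add_le_add (hC x) (hC' x))⟩

theorem BddMeas.smul {f : E → ℝ} (hf : BddMeas f) (r : ℝ) : BddMeas (r • f) := by
  obtain ⟨hf, C, hC⟩ := hf
  refine ⟨hf.const_smul r, |r| * C, fun x => ?_⟩
  rw [Pi.smul_apply, smul_eq_mul, abs_mul]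
  exact mul_le_mul_of_nonneg_left (hC x) (abs_nonneg r)

theorem bddMeas_indicator {s : Set E} (hs : MeasurableSet s) :
    BddMeas (s.indicator (fun _ => (1 : ℝ))) := by
  refine ⟨measurable_const.indicator hs, 1, fun x => ?_⟩
  by_cases hx : x ∈ s <;> simp [hx]

end BddMeas

variable {E : Type*} [NormedAddCommGroup E]

/-- Functions with bounded support. -/
def BddSupp (f : E → ℝ) : Prop := ∃ R : ℝ, ∀ x, R < ‖x‖ → f x = 0

theorem BddSupp.diffOp {f : E → ℝ} (hf : BddSupp f) (v : E) : BddSupp (diffOp v f) := by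
  obtain ⟨R, hR⟩ := hf
  refine ⟨R + ‖v‖, fun x hx => ?_⟩
  rw [diffOp_apply, hR x (by linarith [norm_nonneg v]), hR (x - v), sub_zero]
  linarith [norm_sub_norm_le x v]

theorem BddSupp.iterDiff {f : E → ℝ} (hf : BddSupp f) (A : List E) : BddSupp (iterDiff A f) := by
  induction A with
  | nil => exact hf
  | cons v A ih => rw [iterDiff_cons]; exact ih.diffOp v

theorem BddSupp.add {f g : E → ℝ} (hf : BddSupp f) (hg : BddSupp g) : BddSupp (f + g) := by
  obtain ⟨R, hR⟩ := hf
  obtain ⟨R', hR'⟩ := hg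
  refine ⟨max R R', fun x hx => ?_⟩
  rw [Pi.add_apply, hR x ((le_max_left _ _).trans_lt hx), hR' x ((le_max_right _ _).trans_lt hx),
    add_zero]

theorem BddSupp.smul {f : E → ℝ} (hf : BddSupp f) (r : ℝ) : BddSupp (r • f) := by
  obtain ⟨R, hR⟩ := hf
  exact ⟨R, fun x hx => by rw [Pi.smul_apply, hR x hx, smul_zero]⟩

section

variable [MeasurableSpace E]

theorem BddMeas.diffOp [BorelSpace E] {f : E → ℝ} (hf : BddMeas f) (v : E) :
    BddMeas (diffOp v f) := by
  obtain ⟨hf, C, hC⟩ := hf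
  refine ⟨hf.sub (hf.comp (by fun_prop)), C + C, fun x => ?_⟩
  exact (abs_sub _ _).trans (add_le_add (hC x) (hC _))

theorem BddMeas.iterDiff [BorelSpace E] {f : E → ℝ} (hf : BddMeas f) (A : List E) :
    BddMeas (iterDiff A f) := by
  induction A with
  | nil => exact hf
  | cons v A ih => rw [iterDiff_cons]; exact ih.diffOp v

end

variable [NormedSpace ℝ E]

/-- The product of the functions `1 - e^{⟨ξ, v⟩}` over a list of vectors: the effect of the
difference operators on exponential integrals. -/
noncomputable def diffFactor (A : List E) (ξ : StrongDual ℝ E) : ℝ :=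
  (A.map fun v => 1 - Real.exp (ξ v)).prod

theorem diffFactor_cons (v : E) (A : List E) (ξ : StrongDual ℝ E) :
    diffFactor (v :: A) ξ = (1 - Real.exp (ξ v)) * diffFactor A ξ := by
  simp [diffFactor]

theorem diffFactor_append (A B : List E) (ξ : StrongDual ℝ E) :
    diffFactor (A ++ B) ξ = diffFactor A ξ * diffFactor B ξ := by
  simp [diffFactor]

theorem analyticAt_diffFactor (A : List E) : AnalyticAt ℝ (diffFactor A) 0 := by
  induction A with
  | nil => exact (analyticAt_const (v := (1 : ℝ))).congr (Filter.Eventually.of_forall fun _ => rfl)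
  | cons v A ih =>
    exact ((analyticAt_const.fun_sub (analyticAt_exp_pairing v)).fun_mul ih).congr
      (Filter.Eventually.of_forall fun ξ => (diffFactor_cons v A ξ).symm)

theorem toMer_diffFactor_append (A B : List E) :
    toMer (diffFactor (A ++ B)) (analyticAt_diffFactor (A ++ B)) =
      toMer (diffFactor A) (analyticAt_diffFactor A) *
        toMer (diffFactor B) (analyticAt_diffFactor B) := by
  rw [toMer_mul]
  exact toMer_congr _ _ (Filter.Eventually.of_forall fun ξ => diffFactor_append A B ξ)

/-- The factor `∏ (1 - e^{⟨ξ, v⟩})` over nonzero vectors `v` is not the zero germ, so that it can be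
divided by. -/
theorem toMer_diffFactor_ne_zero {A : List E} (hA : ∀ v ∈ A, v ≠ 0) :
    toMer (diffFactor A) (analyticAt_diffFactor A) ≠ 0 := by
  rw [Ne, toMer_eq_zero_iff]
  induction A with
  | nil => exact fun h => one_ne_zero (α := ℝ) h.self_of_nhds
  | cons v A ih =>
    intro h
    simp only [diffFactor_cons] at h
    rcases eventually_eq_zero_or_of_mul (analyticAt_const.fun_sub (analyticAt_exp_pairing v))
      (analyticAt_diffFactor A) h with h0 | h0
    · obtain ⟨η, -, hη⟩ := exists_dual_vector ℝ v (norm_ne_zero_iff.2 (hA v List.mem_cons_self))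
      have ht : Filter.Tendsto (fun t : ℝ => t • η) (𝓝[≠] 0) (𝓝 0) := by
        have : Filter.Tendsto (fun t : ℝ => t • η) (𝓝 0) (𝓝 ((0 : ℝ) • η)) :=
          (continuous_id.smul continuous_const).tendsto 0
        rw [zero_smul] at this
        exact this.mono_left nhdsWithin_le_nhds
      obtain ⟨t, ht0, htne⟩ := ((ht.eventually h0).and self_mem_nhdsWithin).exists
      have h1 : t * ‖v‖ = 0 := by
        have : Real.exp (t * ‖v‖) = 1 := by
          have := sub_eq_zero.1 ht0
          simpa [hη] using this.symm
        exact Real.exp_eq_one_iff _ |>.1 this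
      rcases mul_eq_zero.1 h1 with h2 | h2
      · exact htne h2
      · exact hA v List.mem_cons_self (norm_eq_zero.1 h2)
    · exact ih (fun w hw => hA w (List.mem_cons_of_mem _ hw)) h0

variable [MeasurableSpace E]

/-- The function `ξ ↦ ∫ f(x) e^{⟨ξ, x⟩} dν(x)`. -/
noncomputable def expIntegral (ν : Measure E) (f : E → ℝ) (ξ : StrongDual ℝ E) : ℝ :=
  ∫ x, f x * Real.exp (ξ x) ∂ν

variable [BorelSpace E]

/-- The exponential integral turns the difference operator along a period `v` of the measure into
multiplication by `1 - e^{⟨ξ, v⟩}`. -/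
theorem expIntegral_diffOp {ν : Measure E} {v : E} (hv : MeasurePreserving (fun x => x + v) ν ν)
    {f : E → ℝ} {ξ : StrongDual ℝ E} (hf : Integrable (fun x => f x * Real.exp (ξ x)) ν) :
    Integrable (fun x => diffOp v f x * Real.exp (ξ x)) ν ∧
      expIntegral ν (diffOp v f) ξ = (1 - Real.exp (ξ v)) * expIntegral ν f ξ := by
  have hemb := measurableEmbedding_addRight v
  have hcomp : (fun x => f (x - v) * Real.exp (ξ x)) ∘ (fun x => x + v) =
      fun x => Real.exp (ξ v) * (f x * Real.exp (ξ x)) := by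
    funext x
    simp only [Function.comp_apply, add_sub_cancel_right, map_add, Real.exp_add]
    ring
  have hi : Integrable (fun x => f (x - v) * Real.exp (ξ x)) ν := by
    rw [← hv.integrable_comp_emb hemb, hcomp]
    exact hf.const_mul _
  have hint : ∫ x, f (x - v) * Real.exp (ξ x) ∂ν = Real.exp (ξ v) * expIntegral ν f ξ := by
    rw [← hv.integral_comp hemb, expIntegral, ← integral_const_mul]
    exact integral_congr_ae (Filter.Eventually.of_forall fun x => congrFun hcomp x)
  have hsub : (fun x => diffOp v f x * Real.exp (ξ x)) =
      fun x => f x * Real.exp (ξ x) - f (x - v) * Real.exp (ξ x) := by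
    funext x
    rw [diffOp_apply, sub_mul]
  refine ⟨by rw [hsub]; exact hf.sub hi, ?_⟩
  rw [expIntegral, hsub, integral_sub hf hi, hint, expIntegral]
  ring

theorem expIntegral_iterDiff {ν : Measure E} {A : List E}
    (hA : ∀ v ∈ A, MeasurePreserving (fun x => x + v) ν ν)
    {f : E → ℝ} {ξ : StrongDual ℝ E} (hf : Integrable (fun x => f x * Real.exp (ξ x)) ν) :
    Integrable (fun x => iterDiff A f x * Real.exp (ξ x)) ν ∧
      expIntegral ν (iterDiff A f) ξ = diffFactor A ξ * expIntegral ν f ξ := by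
  induction A with
  | nil => exact ⟨hf, by simp [diffFactor, iterDiff_nil]⟩
  | cons v A ih =>
    obtain ⟨h1, h2⟩ := ih fun w hw => hA w (List.mem_cons_of_mem _ hw)
    obtain ⟨h3, h4⟩ := expIntegral_diffOp (hA v List.mem_cons_self) h1
    rw [iterDiff_cons]
    exact ⟨h3, by rw [h4, h2, diffFactor_cons, mul_assoc]⟩

/-- The vectors allowed as translations in the definition of the transform with respect to `ν`:
nonzero vectors whose translations preserve `ν`. -/
def IsPeriod (ν : Measure E) (v : E) : Prop := v ≠ 0 ∧ MeasurePreserving (fun x => x + v) ν ν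

/-- `HasTransform ν f φ`: the meromorphic germ `φ` is the exponential transform of the function `f`
with respect to the measure `ν`.  This means that a product of difference operators `1 - τ_v`, where
`v` runs through nonzero periods of `ν`, maps `f` to a function of bounded support whose exponential
integral is `φ ∏ (1 - e^v)`.  When `∫ f e^ξ dν` converges this is the integral, but also the
functions without convergent integral, as the indicator of a line, have a transform. -/
def HasTransform (ν : Measure E) (f : E → ℝ) (φ : Mer E) : Prop :=
  BddMeas f ∧ ∃ A : List E, (∀ v ∈ A, IsPeriod ν v) ∧ BddSupp (iterDiff A f) ∧
    ∃ ha : AnalyticAt ℝ (expIntegral ν (iterDiff A f)) 0,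
      φ * toMer (diffFactor A) (analyticAt_diffFactor A) = toMer _ ha

/-- The transform is equal to the exponential integral where the latter converges. -/
theorem HasTransform.agreesOn {ν : Measure E} {f : E → ℝ} {φ : Mer E} (hf : HasTransform ν f φ) :
    AgreesOn φ {ξ | Integrable (fun x => f x * Real.exp (ξ x)) ν} (expIntegral ν f) := by
  obtain ⟨hf, A, hA, hs, ha, e⟩ := hf
  refine ⟨_, _, ha, analyticAt_diffFactor A, fun h => ?_, e,
    Filter.Eventually.of_forall fun ξ hξ => ?_⟩
  · exact toMer_diffFactor_ne_zero (fun v hv => (hA v hv).1) ((toMer_eq_zero_iff _).2 h)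
  · rw [(expIntegral_iterDiff (fun v hv => (hA v hv).2) hξ).2, mul_comm]

/-- The transform of a null function is `0`.  By linearity, the transform of a function only depends
on its class modulo null functions. -/
theorem HasTransform.eq_zero_of_ae_eq_zero {ν : Measure E} {f : E → ℝ} {φ : Mer E}
    (hf : HasTransform ν f φ) (h0 : f =ᵐ[ν] 0) : φ = 0 := by
  obtain ⟨hf, A, hA, hs, ha, e⟩ := hf
  have hall : iterDiff A f =ᵐ[ν] 0 := by
    clear hs ha e
    induction A with
    | nil => exact h0
    | cons v A ih =>
      have h1 := ih fun w hw => hA w (List.mem_cons_of_mem _ hw)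
      have h2 : (fun x => iterDiff A f (x - v)) =ᵐ[ν] 0 := by
        have hv := (hA v List.mem_cons_self).2
        rw [Filter.EventuallyEq, ← hv.map_eq, (measurableEmbedding_addRight v).ae_map_iff]
        filter_upwards [h1] with x hx
        simpa using hx
      rw [iterDiff_cons]
      filter_upwards [h1, h2] with x hx hx'
      simp only [Pi.zero_apply] at hx hx'
      rw [diffOp_apply, hx, hx', sub_zero, Pi.zero_apply]
  have : toMer _ ha = 0 := by
    rw [toMer_eq_zero_iff]
    refine Filter.Eventually.of_forall fun ξ => ?_
    rw [expIntegral]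
    refine integral_eq_zero_of_ae ?_
    filter_upwards [hall] with x hx
    simp [hx]
  rw [this] at e
  exact (mul_eq_zero.1 e).resolve_right (toMer_diffFactor_ne_zero fun v hv => (hA v hv).1)

variable [FiniteDimensional ℝ E]

theorem integrable_of_bddSupp {ν : Measure E} [IsFiniteMeasureOnCompacts ν] {f : E → ℝ}
    (hf : BddMeas f) (hs : BddSupp f) {g : E → ℝ} (hg : Continuous g) :
    Integrable (fun x => f x * g x) ν := by
  obtain ⟨hm, C, hC⟩ := hf
  obtain ⟨R, hR⟩ := hs
  have hK : IsCompact (Metric.closedBall (0 : E) R) := isCompact_closedBall 0 R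
  have hsupp : Function.support (fun x => f x * g x) ⊆ Metric.closedBall (0 : E) R := by
    intro x hx
    by_contra h
    apply hx
    simp only
    rw [hR x (by simpa using h), zero_mul]
  rw [← integrableOn_iff_integrable_of_support_subset hsupp]
  have hgi : IntegrableOn g (Metric.closedBall (0 : E) R) ν :=
    hg.continuousOn.integrableOn_compact hK
  exact Integrable.bdd_mul hgi hm.aestronglyMeasurable (Filter.Eventually.of_forall hC)

/-- Integrals of `e^{⟨ξ, x⟩}` against a bounded function of bounded support are analytic in `ξ`:
the exponential is analytic on the Banach algebra of continuous functions on a ball, and the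
integral is a continuous linear functional on it. -/
theorem analyticAt_expIntegral {ν : Measure E} [IsFiniteMeasureOnCompacts ν] {f : E → ℝ}
    (hf : BddMeas f) (hs : BddSupp f) : AnalyticAt ℝ (expIntegral ν f) 0 := by
  obtain ⟨R, hR⟩ := hs
  let K : Set E := Metric.closedBall 0 R
  have hK : IsCompact K := isCompact_closedBall 0 R
  have : CompactSpace K := isCompact_iff_compactSpace.1 hK
  have hKm : MeasurableSet K := hK.isClosed.measurableSet
  let ν' : Measure K := ν.comap (Subtype.val : K → E)
  have hν' : IsFiniteMeasure ν' := by
    refine ⟨?_⟩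
    rw [(MeasurableEmbedding.subtype_coe hKm).comap_apply, Set.image_univ, Subtype.range_coe]
    exact hK.measure_lt_top
  have hfi : ∀ φ : C(K, ℝ), Integrable (fun x : K => f x * φ x) ν' := by
    intro φ
    obtain ⟨hm, C, hC⟩ := hf
    exact Integrable.bdd_mul (φ.continuous.integrable_of_hasCompactSupport
      (HasCompactSupport.of_compactSpace _))
      (hm.comp measurable_subtype_coe).aestronglyMeasurable
      (Filter.Eventually.of_forall fun x => hC x)
  let J : C(K, ℝ) →L[ℝ] ℝ := LinearMap.mkContinuousOfExistsBound
    { toFun := fun φ => ∫ x, f x * φ x ∂ν'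
      map_add' := fun φ ψ => by
        rw [← integral_add (hfi φ) (hfi ψ)]
        exact integral_congr_ae (Filter.Eventually.of_forall fun x => mul_add _ _ _)
      map_smul' := fun r φ => by
        rw [RingHom.id_apply, smul_eq_mul, ← integral_const_mul]
        refine integral_congr_ae (Filter.Eventually.of_forall fun x => ?_)
        simp only [ContinuousMap.coe_smul, Pi.smul_apply, smul_eq_mul]
        ring }
    (by
      obtain ⟨hm, C, hC⟩ := hf
      refine ⟨C * (ν' Set.univ).toReal, fun φ => ?_⟩
      have := norm_integral_le_of_norm_le_const (μ := ν') (f := fun x : K => f x * φ x)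
        (C := C * ‖φ‖) (Filter.Eventually.of_forall fun x => by
          rw [norm_mul]
          exact mul_le_mul (hC x) (φ.norm_coe_le_norm x) (norm_nonneg _)
            ((abs_nonneg _).trans (hC x)))
      calc _ ≤ C * ‖φ‖ * ν'.real Set.univ := this
        _ = _ := by rw [Measure.real]; ring)
  let ev : StrongDual ℝ E →L[ℝ] C(K, ℝ) := LinearMap.mkContinuousOfExistsBound
    { toFun := fun ξ => ⟨fun x => ξ x, by fun_prop⟩
      map_add' := fun ξ η => rfl
      map_smul' := fun r ξ => rfl }
    ⟨max R 0, fun ξ => by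
      refine (ContinuousMap.norm_le _ (by positivity)).2 fun x => ?_
      have hx : ‖(x : E)‖ ≤ R := mem_closedBall_zero_iff.1 x.2
      calc ‖ξ x‖ ≤ ‖ξ‖ * ‖(x : E)‖ := ξ.le_opNorm _
        _ ≤ ‖ξ‖ * max R 0 := by gcongr; exact hx.trans (le_max_left _ _)
        _ = _ := mul_comm _ _⟩
  have hexp : ∀ (ξ : StrongDual ℝ E) (x : K), NormedSpace.exp (ev ξ) x = Real.exp (ξ x) := by
    intro ξ x
    have h := NormedSpace.map_exp (ContinuousMap.evalAlgHom ℝ ℝ x) (by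
      exact continuous_eval_const x) (ev ξ)
    rw [Real.exp_eq_exp_ℝ]
    exact h
  have heq : expIntegral ν f = fun ξ => J (NormedSpace.exp (ev ξ)) := by
    funext ξ
    have h1 : expIntegral ν f ξ = ∫ x in K, f x * Real.exp (ξ x) ∂ν := by
      refine (setIntegral_eq_integral_of_forall_compl_eq_zero fun x hx => ?_).symm
      rw [hR x (by simpa [K] using hx), zero_mul]
    rw [h1, ← integral_subtype_comap hKm]
    refine integral_congr_ae (Filter.Eventually.of_forall fun x => ?_)
    simp only [hexp]
  rw [heq]
  have h1 : AnalyticAt ℝ (NormedSpace.exp : C(K, ℝ) → C(K, ℝ)) (ev 0) :=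
    NormedSpace.exp_analytic _
  exact (J.analyticAt _).comp (AnalyticAt.comp h1 (ev.analyticAt 0))

variable {ν : Measure E} [IsFiniteMeasureOnCompacts ν]

/-- A bounded function has a transform as soon as a product of difference operators along periods
maps it to a function of bounded support. -/
theorem exists_hasTransform {f : E → ℝ} (hf : BddMeas f) {A : List E}
    (hA : ∀ v ∈ A, IsPeriod ν v) (hs : BddSupp (iterDiff A f)) : ∃ φ, HasTransform ν f φ := by
  have ha := analyticAt_expIntegral (ν := ν) (hf.iterDiff A) hs
  refine ⟨toMer _ ha / toMer (diffFactor A) (analyticAt_diffFactor A), hf, A, hA, hs, ha, ?_⟩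
  exact div_mul_cancel₀ _ (toMer_diffFactor_ne_zero fun v hv => (hA v hv).1)

theorem toMer_expIntegral_append {f : E → ℝ} (hf : BddMeas f) {A B : List E}
    (hB : ∀ v ∈ B, IsPeriod ν v) (hs : BddSupp (iterDiff A f))
    (ha : AnalyticAt ℝ (expIntegral ν (iterDiff A f)) 0)
    (hab : AnalyticAt ℝ (expIntegral ν (iterDiff (B ++ A) f)) 0) :
    toMer _ hab = toMer _ ha * toMer (diffFactor B) (analyticAt_diffFactor B) := by
  rw [toMer_mul]
  refine toMer_congr _ _ (Filter.Eventually.of_forall fun ξ => ?_)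
  rw [iterDiff_append, (expIntegral_iterDiff (fun v hv => (hB v hv).2)
    (integrable_of_bddSupp (hf.iterDiff A) hs (by fun_prop))).2, mul_comm]

/-- The list of difference operators in `HasTransform` may be enlarged. -/
theorem HasTransform.append {f : E → ℝ} {φ : Mer E} {A : List E} (hf : BddMeas f)
    (hs : BddSupp (iterDiff A f))
    (ha : AnalyticAt ℝ (expIntegral ν (iterDiff A f)) 0)
    (e : φ * toMer (diffFactor A) (analyticAt_diffFactor A) = toMer _ ha)
    {B : List E} (hB : ∀ v ∈ B, IsPeriod ν v) :
    ∃ hab : AnalyticAt ℝ (expIntegral ν (iterDiff (B ++ A) f)) 0,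
      φ * toMer (diffFactor (B ++ A)) (analyticAt_diffFactor (B ++ A)) = toMer _ hab := by
  have hs' : BddSupp (iterDiff (B ++ A) f) := by rw [iterDiff_append]; exact hs.iterDiff B
  refine ⟨analyticAt_expIntegral (hf.iterDiff _) hs', ?_⟩
  rw [toMer_expIntegral_append hf hB hs ha, toMer_diffFactor_append, ← e]
  ring

/-- Two transforms can be computed with the same difference operators. -/
theorem HasTransform.exists_common {f g : E → ℝ} {φ ψ : Mer E} (hf : HasTransform ν f φ)
    (hg : HasTransform ν g ψ) : ∃ A : List E, (∀ v ∈ A, IsPeriod ν v) ∧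
      BddSupp (iterDiff A f) ∧ BddSupp (iterDiff A g) ∧
      (∃ ha : AnalyticAt ℝ (expIntegral ν (iterDiff A f)) 0,
        φ * toMer (diffFactor A) (analyticAt_diffFactor A) = toMer _ ha) ∧
      ∃ ha : AnalyticAt ℝ (expIntegral ν (iterDiff A g)) 0,
        ψ * toMer (diffFactor A) (analyticAt_diffFactor A) = toMer _ ha := by
  obtain ⟨hf, A, hA, hs, ha, e⟩ := hf
  obtain ⟨hg, B, hB, hs', hb, e'⟩ := hg
  have hfAB : iterDiff (A ++ B) f = iterDiff (B ++ A) f := by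
    rw [iterDiff_append, iterDiff_append, iterDiff_comm]
  refine ⟨A ++ B, fun v hv => (List.mem_append.1 hv).elim (hA v) (hB v), ?_, ?_, ?_, ?_⟩
  · rw [hfAB, iterDiff_append]
    exact hs.iterDiff B
  · rw [iterDiff_append]
    exact hs'.iterDiff A
  · obtain ⟨h1, h2⟩ := HasTransform.append hf hs ha e hB
    refine ⟨hfAB ▸ h1, ?_⟩
    rw [toMer_diffFactor_append, mul_comm (toMer (diffFactor A) _), ← toMer_diffFactor_append, h2]
    exact toMer_congr _ _ (by rw [hfAB]; exact Filter.Eventually.of_forall fun _ => rfl)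
  · exact HasTransform.append hg hs' hb e' hA

theorem HasTransform.add {f g : E → ℝ} {φ ψ : Mer E} (hf : HasTransform ν f φ)
    (hg : HasTransform ν g ψ) : HasTransform ν (f + g) (φ + ψ) := by
  obtain ⟨A, hA, hs, hs', ⟨ha, e⟩, ⟨hb, e'⟩⟩ := hf.exists_common hg
  have hs'' : BddSupp (iterDiff A (f + g)) := by rw [map_add]; exact hs.add hs'
  refine ⟨hf.1.add hg.1, A, hA, hs'',
    analyticAt_expIntegral ((hf.1.add hg.1).iterDiff A) hs'', ?_⟩
  rw [add_mul, e, e', toMer_add]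
  refine toMer_congr _ _ (Filter.Eventually.of_forall fun ξ => ?_)
  have h1 := integrable_of_bddSupp (ν := ν) (hf.1.iterDiff A) hs
    (g := fun x => Real.exp (ξ x)) (by fun_prop)
  have h2 := integrable_of_bddSupp (ν := ν) (hg.1.iterDiff A) hs'
    (g := fun x => Real.exp (ξ x)) (by fun_prop)
  simp only [expIntegral]
  rw [← integral_add h1 h2, map_add]
  exact integral_congr_ae (Filter.Eventually.of_forall fun x => (add_mul _ _ _).symm)

theorem HasTransform.smul {f : E → ℝ} {φ : Mer E} (hf : HasTransform ν f φ) (r : ℝ) :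
    HasTransform ν (r • f) (constMer r * φ) := by
  obtain ⟨hf, A, hA, hs, ha, e⟩ := hf
  have hs' : BddSupp (iterDiff A (r • f)) := by rw [map_smul]; exact hs.smul r
  refine ⟨hf.smul r, A, hA, hs', analyticAt_expIntegral ((hf.smul r).iterDiff A) hs', ?_⟩
  rw [mul_assoc, e, constMer, toMer_mul]
  refine toMer_congr _ _ (Filter.Eventually.of_forall fun ξ => ?_)
  simp only [expIntegral]
  rw [← integral_const_mul, map_smul]
  exact integral_congr_ae (Filter.Eventually.of_forall fun x => (mul_assoc _ _ _).symm)

theorem HasTransform.zero : HasTransform ν (0 : E → ℝ) 0 := by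
  refine ⟨⟨measurable_const, 0, fun x => by simp⟩, [], by simp, ⟨0, fun x _ => rfl⟩, ?_, ?_⟩
  · exact analyticAt_expIntegral ⟨measurable_const, 0, fun x => by simp [iterDiff_nil]⟩
      ⟨0, fun x _ => rfl⟩
  · rw [zero_mul, eq_comm, toMer_eq_zero_iff]
    exact Filter.Eventually.of_forall fun ξ => by simp [expIntegral, iterDiff_nil]

theorem HasTransform.sum {κ : Type*} (K : Finset κ) {f : κ → E → ℝ} {φ : κ → Mer E}
    (r : κ → ℝ) (h : ∀ k ∈ K, HasTransform ν (f k) (φ k)) :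
    HasTransform ν (∑ k ∈ K, r k • f k) (∑ k ∈ K, constMer (r k) * φ k) := by
  classical
  induction K using Finset.induction_on with
  | empty => simpa using HasTransform.zero
  | insert k K hk ih =>
    rw [Finset.sum_insert hk, Finset.sum_insert hk]
    exact ((h k (Finset.mem_insert_self _ _)).smul (r k)).add
      (ih fun j hj => h j (Finset.mem_insert_of_mem hj))

/-- A function annihilated by a difference operator has transform `0`. -/
theorem hasTransform_zero_of_diffOp_eq_zero {f : E → ℝ} (hf : BddMeas f) {v : E}
    (hv : IsPeriod ν v) (h : diffOp v f = 0) : HasTransform ν f 0 := by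
  have h' : iterDiff [v] f = 0 := by rw [iterDiff_cons, iterDiff_nil, h]
  refine ⟨hf, [v], by simpa using hv, by rw [h']; exact ⟨0, fun x _ => rfl⟩, ?_, ?_⟩
  · rw [h']
    exact analyticAt_expIntegral ⟨measurable_const, 0, fun x => by simp⟩ ⟨0, fun x _ => rfl⟩
  · rw [zero_mul, eq_comm, toMer_eq_zero_iff]
    exact Filter.Eventually.of_forall fun ξ => by simp [expIntegral, h']

/-- If a linear combination of bounded functions with coefficients in the field of meromorphic
germs vanishes almost everywhere, then the same combination of their transforms is `0`: this
reduces to real coefficients by applying linear forms to the coefficients. -/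
theorem sum_mul_transform_eq_zero {κ : Type*} (K : Finset κ) {f : κ → E → ℝ} {φ : κ → Mer E}
    (m : κ → Mer E) (h : ∀ k ∈ K, HasTransform ν (f k) (φ k))
    (h0 : ∀ᵐ x ∂ν, ∑ k ∈ K, constMer (f k x) * m k = 0) : ∑ k ∈ K, m k * φ k = 0 := by
  let _ : Algebra ℝ (Mer E) := (constHom E).toAlgebra
  have hsmul : ∀ (r : ℝ) (y : Mer E), r • y = constMer r * y := fun r y => Algebra.smul_def r y
  refine sum_mul_eq_zero_of_forall_dual K m φ fun l => ?_
  simp only [hsmul]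
  refine (HasTransform.sum K (fun k => l (m k)) h).eq_zero_of_ae_eq_zero ?_
  filter_upwards [h0] with x hx
  have h1 := congrArg l hx
  simp only [← hsmul, map_sum, map_smul, smul_eq_mul, map_zero] at h1
  rw [Finset.sum_apply, Pi.zero_apply, ← h1]
  exact Finset.sum_congr rfl fun k _ => by rw [Pi.smul_apply, smul_eq_mul, mul_comm]

end Transform

/-! ### Rational subspaces and systems of integral inequalities -/

section Polyhedra

variable {E : Type*} [NormedAddCommGroup E] [NormedSpace ℝ E] {ι : Type*}

/-- Linear forms taking integral values on `Λ`. -/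
def IntegralOn (Λ : Submodule ℤ E) (η : StrongDual ℝ E) : Prop := ∀ x ∈ Λ, ∃ n : ℤ, η x = n

/-- The solutions in `W = span Λ` of the inequalities `⟨η i, x⟩ ≤ c i`, for `i ∈ H`.  The right-hand
sides are arbitrary real numbers. -/
def poly (Λ : Submodule ℤ E) (η : ι → StrongDual ℝ E) (c : ι → ℝ) (H : Finset ι) : Set E :=
  {x | x ∈ Submodule.span ℝ (Λ : Set E) ∧ ∀ i ∈ H, η i x ≤ c i}

/-- The subspace of `W = span Λ` on which the linear forms `η i` vanish, for `i ∈ A`. -/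
def dirs (Λ : Submodule ℤ E) (η : ι → StrongDual ℝ E) (A : Finset ι) : Submodule ℝ E where
  carrier := {x | x ∈ Submodule.span ℝ (Λ : Set E) ∧ ∀ i ∈ A, η i x = 0}
  add_mem' hx hy := ⟨add_mem hx.1 hy.1, fun i hi => by simp [hx.2 i hi, hy.2 i hi]⟩
  zero_mem' := ⟨zero_mem _, fun i _ => map_zero _⟩
  smul_mem' r x hx := ⟨Submodule.smul_mem _ r hx.1, fun i hi => by simp [hx.2 i hi]⟩

variable {Λ : Submodule ℤ E} {η : ι → StrongDual ℝ E} {c : ι → ℝ} {H A : Finset ι}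

theorem mem_poly {x : E} :
    x ∈ poly Λ η c H ↔ x ∈ Submodule.span ℝ (Λ : Set E) ∧ ∀ i ∈ H, η i x ≤ c i := Iff.rfl

theorem mem_dirs {x : E} :
    x ∈ dirs Λ η A ↔ x ∈ Submodule.span ℝ (Λ : Set E) ∧ ∀ i ∈ A, η i x = 0 := Iff.rfl

theorem mem_span_of_mem {x : E} (hx : x ∈ Λ) : x ∈ Submodule.span ℝ (Λ : Set E) :=
  Submodule.subset_span hx

/-- The solution space of integral linear equations is spanned by lattice points. -/
theorem dirs_le_span (hA : ∀ i ∈ A, IntegralOn Λ (η i)) :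
    dirs Λ η A ≤ Submodule.span ℝ {x | x ∈ Λ ∧ x ∈ dirs Λ η A} := by
  classical
  induction A using Finset.induction_on with
  | empty =>
    intro x hx
    refine Submodule.span_mono (fun y hy => ?_) hx.1
    exact ⟨hy, mem_span_of_mem hy, by simp⟩
  | insert i A hi ih =>
    have ih := ih fun j hj => hA j (Finset.mem_insert_of_mem hj)
    have hmem : ∀ x, x ∈ dirs Λ η (insert i A) ↔ x ∈ dirs Λ η A ∧ η i x = 0 := by
      intro x
      simp only [mem_dirs, Finset.forall_mem_insert]
      tauto
    by_cases h0 : ∀ u, u ∈ Λ → u ∈ dirs Λ η A → η i u = 0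
    · intro x hx
      refine Submodule.span_mono (fun y hy => ?_) (ih ((hmem x).1 hx).1)
      exact ⟨hy.1, (hmem y).2 ⟨hy.2, h0 y hy.1 hy.2⟩⟩
    · push Not at h0
      obtain ⟨u, huΛ, hu, hu0⟩ := h0
      obtain ⟨m, hm⟩ := hA i (Finset.mem_insert_self _ _) u huΛ
      -- the projection along `u` maps lattice points to multiples of lattice points
      have key : ∀ x ∈ Submodule.span ℝ {x | x ∈ Λ ∧ x ∈ dirs Λ η A},
          η i u • x - η i x • u ∈
            Submodule.span ℝ {x | x ∈ Λ ∧ x ∈ dirs Λ η (insert i A)} := by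
        intro x hx
        induction hx using Submodule.span_induction with
        | mem w hw =>
          obtain ⟨k, hk⟩ := hA i (Finset.mem_insert_self _ _) w hw.1
          refine Submodule.subset_span ⟨?_, (hmem _).2 ⟨?_, ?_⟩⟩
          · rw [hm, hk, Int.cast_smul_eq_zsmul, Int.cast_smul_eq_zsmul]
            exact sub_mem (Λ.smul_mem m hw.1) (Λ.smul_mem k huΛ)
          · exact sub_mem (Submodule.smul_mem _ _ hw.2) (Submodule.smul_mem _ _ hu)
          · simp only [map_sub, map_smul, smul_eq_mul]
            ring
        | zero => simp
        | add x y _ _ hx hy =>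
          convert add_mem hx hy using 1
          simp only [map_add, smul_add, add_smul]
          abel
        | smul r x _ hx =>
          convert Submodule.smul_mem _ r hx using 1
          simp only [map_smul, smul_eq_mul, smul_sub, smul_smul, mul_comm]
      intro x hx
      have h1 := key x (ih ((hmem x).1 hx).1)
      rw [((hmem x).1 hx).2, zero_smul, sub_zero] at h1
      exact (Submodule.smul_mem_iff _ hu0).1 h1

end Polyhedra

section RationalPoints

variable {E : Type*} [NormedAddCommGroup E] {Λ : Submodule ℤ E}

theorem IsRationalPoint.of_mem {x : E} (hx : x ∈ Λ) : IsRationalPoint Λ x :=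
  ⟨1, one_ne_zero, by simpa using hx⟩

theorem IsRationalPoint.add {x y : E} (hx : IsRationalPoint Λ x) (hy : IsRationalPoint Λ y) :
    IsRationalPoint Λ (x + y) := by
  obtain ⟨q, hq, hx⟩ := hx
  obtain ⟨r, hr, hy⟩ := hy
  refine ⟨q * r, mul_ne_zero hq hr, ?_⟩
  rw [smul_add]
  refine add_mem ?_ ?_
  · rw [mul_comm, mul_smul]
    exact Λ.smul_mem r hx
  · rw [mul_smul]
    exact Λ.smul_mem q hy

variable [NormedSpace ℝ E] {ι : Type*} {η : ι → StrongDual ℝ E} {H : Finset ι}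

theorem IsRationalPoint.smul {x : E} (hx : IsRationalPoint Λ x) (t : ℚ) :
    IsRationalPoint Λ ((t : ℝ) • x) := by
  obtain ⟨q, hq, hx⟩ := hx
  refine ⟨q * t.den, mul_ne_zero hq (by exact_mod_cast t.den_nz), ?_⟩
  have h : (q * (t.den : ℤ)) • ((t : ℝ) • x) = t.num • (q • x) := by
    rw [← Int.cast_smul_eq_zsmul ℝ, ← Int.cast_smul_eq_zsmul ℝ, ← Int.cast_smul_eq_zsmul ℝ,
      smul_smul, smul_smul]
    congr 1
    have : (t : ℝ) * (t.den : ℝ) = t.num := by exact_mod_cast Rat.mul_den_eq_num t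
    push_cast
    rw [← this]
    ring
  rw [h]
  exact Λ.smul_mem _ hx

theorem IsRationalPoint.exists_pos_nsmul {x : E} (hx : IsRationalPoint Λ x) :
    ∃ n : ℕ, 0 < n ∧ (n : ℝ) • x ∈ Λ := by
  obtain ⟨q, hq, hx⟩ := hx
  refine ⟨q.natAbs, Int.natAbs_pos.2 hq, ?_⟩
  rw [Nat.cast_smul_eq_nsmul, ← natCast_zsmul]
  rcases Int.natAbs_eq q with h | h
  · rwa [← h]
  · rw [h] at hx
    simpa using hx

theorem IsRationalPoint.mem_span {x : E} (hx : IsRationalPoint Λ x) :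
    x ∈ Submodule.span ℝ (Λ : Set E) := by
  obtain ⟨n, hn, hx⟩ := hx.exists_pos_nsmul
  exact (Submodule.smul_mem_iff _ (by positivity)).1 (mem_span_of_mem hx)

/-- Rational points are dense in a subspace spanned by lattice points. -/
theorem mem_closure_rational {L : Submodule ℝ E} (hL : L ≤ Submodule.span ℝ {x | x ∈ Λ ∧ x ∈ L})
    {x : E} (hx : x ∈ L) : x ∈ closure {y | IsRationalPoint Λ y ∧ y ∈ L} := by
  have hx' := hL hx
  clear hx
  induction hx' using Submodule.span_induction with
  | mem w hw => exact subset_closure ⟨.of_mem hw.1, hw.2⟩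
  | zero => exact subset_closure ⟨.of_mem (zero_mem _), zero_mem _⟩
  | add x y _ _ hx hy =>
    exact map_mem_closure₂ continuous_add hx hy fun a ha b hb => ⟨ha.1.add hb.1, add_mem ha.2 hb.2⟩
  | smul r x _ hx =>
    have hr : r ∈ closure (Set.range ((↑) : ℚ → ℝ)) := Rat.denseRange_cast r
    refine map_mem_closure₂ continuous_smul hr hx ?_
    rintro _ ⟨t, rfl⟩ b hb
    exact ⟨hb.1.smul t, L.smul_mem _ hb.2⟩

/-- A nonzero rational cone, given by homogeneous integral inequalities, contains a nonzero lattice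
point; it can be chosen with the same linear forms vanishing on it as on a given point. -/
theorem exists_lattice_mem_recession (hH : ∀ i ∈ H, IntegralOn Λ (η i)) {x : E}
    (hx : x ∈ poly Λ η 0 H) (hx0 : x ≠ 0) :
    ∃ v ∈ Λ, v ≠ 0 ∧ v ∈ poly Λ η 0 H ∧ ∀ i ∈ H, η i x = 0 → η i v = 0 := by
  classical
  let A := H.filter fun i => η i x = 0
  have hxA : x ∈ dirs Λ η A := ⟨hx.1, fun i hi => (Finset.mem_filter.1 hi).2⟩
  have hcl := mem_closure_rational (dirs_le_span (A := A)
    fun i hi => hH i (Finset.mem_filter.1 hi).1) hxA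
  have hnhds : {y : E | y ≠ 0 ∧ ∀ i ∈ H.filter (fun i => η i x ≠ 0), η i y < 0} ∈ 𝓝 x := by
    refine Filter.inter_mem (isOpen_ne.mem_nhds hx0) ?_
    refine (Filter.eventually_all_finset _).2 fun i hi => ?_
    have hi' := Finset.mem_filter.1 hi
    exact (η i).continuous.continuousAt.eventually_lt continuousAt_const
      (lt_of_le_of_ne (hx.2 i hi'.1) hi'.2)
  obtain ⟨y, ⟨hy0, hy⟩, hyr, hyA⟩ := mem_closure_iff_nhds.1 hcl _ hnhds
  obtain ⟨n, hn, hv⟩ := hyr.exists_pos_nsmul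
  have hn' : (0 : ℝ) < n := by exact_mod_cast hn
  have hz : ∀ i ∈ H, η i x = 0 → η i y = 0 := fun i hi h =>
    hyA.2 i (Finset.mem_filter.2 ⟨hi, h⟩)
  refine ⟨(n : ℝ) • y, hv, smul_ne_zero hn'.ne' hy0, ⟨mem_span_of_mem hv, fun i hi => ?_⟩,
    fun i hi h => by simp [hz i hi h]⟩
  rw [map_smul, smul_eq_mul]
  refine mul_nonpos_of_nonneg_of_nonpos hn'.le ?_
  by_cases h : η i x = 0
  · exact (hz i hi h).le
  · exact (hy i (Finset.mem_filter.2 ⟨hi, h⟩)).le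

theorem exists_lattice_mem_dirs (hH : ∀ i ∈ H, IntegralOn Λ (η i)) {x : E}
    (hx : x ∈ dirs Λ η H) (hx0 : x ≠ 0) : ∃ v ∈ Λ, v ≠ 0 ∧ v ∈ dirs Λ η H := by
  obtain ⟨v, hv, hv0, h1, h2⟩ := exists_lattice_mem_recession hH
    ⟨hx.1, fun i hi => (hx.2 i hi).le⟩ hx0
  exact ⟨v, hv, hv0, h1.1, fun i hi => h2 i hi (hx.2 i hi)⟩

end RationalPoints

section Recession

variable {E : Type*} [NormedAddCommGroup E] [NormedSpace ℝ E]
  {Λ : Submodule ℤ E} {ι : Type*} {η : ι → StrongDual ℝ E} {c : ι → ℝ} {H A : Finset ι}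

theorem smul_mem_recession {x : E} (hx : x ∈ poly Λ η 0 H) {t : ℝ} (ht : 0 ≤ t) :
    t • x ∈ poly Λ η 0 H :=
  ⟨Submodule.smul_mem _ t hx.1, fun i hi => by
    simpa using mul_nonpos_of_nonneg_of_nonpos ht (hx.2 i hi)⟩

theorem add_recession_mem {x v : E} (hx : x ∈ poly Λ η c H) (hv : v ∈ poly Λ η 0 H) :
    x + v ∈ poly Λ η c H :=
  ⟨add_mem hx.1 hv.1, fun i hi => by
    rw [map_add]
    have h1 := hx.2 i hi
    have h2 : η i v ≤ 0 := hv.2 i hi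
    linarith⟩

/-- The linear forms that are negative on the nonzero recession directions of a polyhedron: for
those the exponential sums and integrals over the polyhedron converge. -/
def negCone (Λ : Submodule ℤ E) (η : ι → StrongDual ℝ E) (H : Finset ι) : Set (StrongDual ℝ E) :=
  {ξ | ∀ u ∈ poly Λ η 0 H, u ≠ 0 → ξ u < 0}

/-- If no line is contained in the recession cone, the sum of the linear forms defining it is
negative on its nonzero elements. -/
theorem sum_mem_negCone (h : dirs Λ η H = ⊥) : ∑ i ∈ H, η i ∈ negCone Λ η H := by
  intro u hu hu0
  rw [sum_apply]
  refine lt_of_le_of_ne (Finset.sum_nonpos hu.2) fun h0 => hu0 ?_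
  have := (Finset.sum_eq_zero_iff_of_nonpos hu.2).1 h0
  exact (Submodule.mem_bot ℝ).1 (h ▸ (⟨hu.1, this⟩ : u ∈ dirs Λ η H))

variable [FiniteDimensional ℝ E]

theorem isClosed_poly : IsClosed (poly Λ η c H) := by
  have : poly Λ η c H = (Submodule.span ℝ (Λ : Set E) : Set E) ∩ ⋂ i ∈ H, {x | η i x ≤ c i} := by
    ext x
    simp [mem_poly]
  rw [this]
  exact (Submodule.closed_of_finiteDimensional _).inter
    (isClosed_biInter fun i _ => isClosed_le (η i).continuous continuous_const)

/-- A polyhedron without nonzero recession directions is bounded. -/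
theorem exists_norm_le_of_recession_eq_zero (h : ∀ x ∈ poly Λ η 0 H, x = 0) :
    ∃ R : ℝ, ∀ x ∈ poly Λ η c H, ‖x‖ ≤ R := by
  let K : Set E := (Submodule.span ℝ (Λ : Set E) : Set E) ∩ Metric.sphere 0 1
  have hK : IsCompact K :=
    (isCompact_sphere 0 1).inter_left (Submodule.closed_of_finiteDimensional _)
  let g : E → ℝ := fun u => ∑ i ∈ H, max (η i u) 0
  have hg : Continuous g := by fun_prop
  rcases K.eq_empty_or_nonempty with hKe | hKn
  · refine ⟨0, fun x hx => ?_⟩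
    by_contra hx0
    have hx0' : 0 < ‖x‖ := not_le.1 hx0
    have : ‖x‖⁻¹ • x ∈ K := ⟨Submodule.smul_mem _ _ hx.1, by
      simp [norm_smul, inv_mul_cancel₀ hx0'.ne']⟩
    simp [hKe] at this
  · obtain ⟨u, huK, hu⟩ := hK.exists_isMinOn hKn hg.continuousOn
    have hpos : 0 < g u := by
      refine lt_of_le_of_ne (Finset.sum_nonneg fun i _ => le_max_right _ _) fun h0 => ?_
      have h1 := (Finset.sum_eq_zero_iff_of_nonneg fun i _ => le_max_right (η i u) 0).1 h0.symm
      have := h u ⟨huK.1, fun i hi => max_eq_right_iff.1 (h1 i hi)⟩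
      have h2 := huK.2
      simp [this] at h2
    refine ⟨(∑ i ∈ H, max (c i) 0) / g u, fun x hx => ?_⟩
    rw [le_div_iff₀ hpos]
    rcases eq_or_ne x 0 with rfl | hx0
    · simpa using Finset.sum_nonneg fun i _ => le_max_right (c i) 0
    have hx0' : 0 < ‖x‖ := norm_pos_iff.2 hx0
    have h1 : g u ≤ g (‖x‖⁻¹ • x) := hu ⟨Submodule.smul_mem _ _ hx.1, by
      simp [norm_smul, inv_mul_cancel₀ hx0'.ne']⟩
    calc ‖x‖ * g u ≤ ‖x‖ * g (‖x‖⁻¹ • x) := by gcongr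
      _ = ∑ i ∈ H, max (η i x) 0 := by
        rw [Finset.mul_sum]
        refine Finset.sum_congr rfl fun i _ => ?_
        rw [mul_max_of_nonneg _ _ hx0'.le, map_smul, smul_eq_mul, mul_inv_cancel_left₀ hx0'.ne',
          mul_zero]
      _ ≤ ∑ i ∈ H, max (c i) 0 :=
        Finset.sum_le_sum fun i hi => max_le_max_right 0 (hx.2 i hi)

theorem isOpen_negCone : IsOpen (negCone Λ η H) := by
  let K : Set E := poly Λ η 0 H ∩ Metric.sphere 0 1
  have hK : IsCompact K := (isCompact_sphere 0 1).inter_left isClosed_poly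
  have hiff : ∀ ξ, ξ ∈ negCone Λ η H ↔ ∀ u ∈ K, ξ u < 0 := by
    refine fun ξ => ⟨fun h u hu => h u hu.1 fun h0 => ?_, fun h u hu hu0 => ?_⟩
    · have h2 := hu.2
      simp [h0] at h2
    · have hu' : 0 < ‖u‖ := norm_pos_iff.2 hu0
      have := h (‖u‖⁻¹ • u) ⟨smul_mem_recession hu (by positivity), by
        simp [norm_smul, inv_mul_cancel₀ hu'.ne']⟩
      rw [map_smul, smul_eq_mul] at this
      exact neg_of_mul_neg_right this (by positivity)
  have : negCone Λ η H = {ξ | ∀ u ∈ K, ξ u < 0} := Set.ext hiff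
  rw [this, isOpen_iff_mem_nhds]
  intro ξ hξ
  rcases K.eq_empty_or_nonempty with hKe | hKn
  · simp [hKe]
  obtain ⟨u, huK, hu⟩ := hK.exists_isMaxOn hKn ξ.continuous.continuousOn
  refine Filter.mem_of_superset (Metric.ball_mem_nhds ξ (neg_pos.2 (hξ u huK))) fun ζ hζ w hw => ?_
  have h1 : ξ w ≤ ξ u := hu hw
  have h2 : ‖(ζ - ξ) w‖ ≤ ‖ζ - ξ‖ * ‖w‖ := (ζ - ξ).le_opNorm w
  have h3 : ‖w‖ = 1 := by simpa using hw.2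
  have h4 : ‖ζ - ξ‖ < -ξ u := by simpa [dist_eq_norm] using hζ
  rw [h3, mul_one, Real.norm_eq_abs] at h2
  have h5 := le_abs_self ((ζ - ξ) w)
  rw [sub_apply] at h5 h2
  linarith

/-- The linear forms for which the sums and integrals over a pointed polyhedron converge are an open
cone, so they determine meromorphic germs at `0`. -/
theorem zero_mem_closure_interior_negCone (h : dirs Λ η H = ⊥) :
    0 ∈ closure (interior (negCone Λ η H)) := by
  rw [isOpen_negCone.interior_eq]
  have ht : Filter.Tendsto (fun t : ℝ => t • ∑ i ∈ H, η i) (𝓝[>] 0) (𝓝 0) := by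
    have : Filter.Tendsto (fun t : ℝ => t • ∑ i ∈ H, η i) (𝓝 0) (𝓝 ((0 : ℝ) • ∑ i ∈ H, η i)) :=
      (continuous_id.smul continuous_const).tendsto 0
    rw [zero_smul] at this
    exact this.mono_left nhdsWithin_le_nhds
  refine mem_closure_of_tendsto ht ?_
  filter_upwards [self_mem_nhdsWithin] with t ht u hu hu0
  rw [smul_apply, smul_eq_mul]
  exact mul_neg_of_pos_of_neg ht (sum_mem_negCone h u hu hu0)

end Recession

/-! ### Difference operators and convergence on polyhedra -/

section Annihilation

variable {E : Type*} [NormedAddCommGroup E]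

/-- Functions mapped to functions of bounded support by a product of difference operators along
vectors in `V`. -/
def Annihilable (V : Set E) (f : E → ℝ) : Prop :=
  ∃ A : List E, (∀ v ∈ A, v ∈ V) ∧ BddSupp (iterDiff A f)

theorem Annihilable.mono {V V' : Set E} {f : E → ℝ} (h : Annihilable V f) (hV : V ⊆ V') :
    Annihilable V' f := by
  obtain ⟨A, hA, hs⟩ := h
  exact ⟨A, fun v hv => hV (hA v hv), hs⟩

theorem annihilable_zero (V : Set E) : Annihilable V 0 :=
  ⟨[], by simp, 0, fun x _ => rfl⟩

theorem Annihilable.add {V : Set E} {f g : E → ℝ} (hf : Annihilable V f) (hg : Annihilable V g) :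
    Annihilable V (f + g) := by
  obtain ⟨A, hA, hs⟩ := hf
  obtain ⟨B, hB, hs'⟩ := hg
  refine ⟨A ++ B, fun v hv => (List.mem_append.1 hv).elim (hA v) (hB v), ?_⟩
  rw [map_add, iterDiff_append, iterDiff_append, iterDiff_comm A B f]
  exact (hs.iterDiff B).add (hs'.iterDiff A)

theorem Annihilable.sub {V : Set E} {f g : E → ℝ} (hf : Annihilable V f) (hg : Annihilable V g) :
    Annihilable V (f - g) := by
  obtain ⟨B, hB, hs'⟩ := hg
  rw [sub_eq_add_neg, ← neg_one_smul ℝ g]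
  exact hf.add ⟨B, hB, by rw [map_smul]; exact hs'.smul _⟩

theorem Annihilable.of_diffOp {V : Set E} {f : E → ℝ} {v : E} (hv : v ∈ V)
    (h : Annihilable V (diffOp v f)) : Annihilable V f := by
  obtain ⟨A, hA, hs⟩ := h
  refine ⟨A ++ [v], fun w hw => ?_, ?_⟩
  · rcases List.mem_append.1 hw with hw | hw
    · exact hA w hw
    · rwa [List.mem_singleton.1 hw]
  · rw [iterDiff_append, iterDiff_cons, iterDiff_nil]
    exact hs

/-- The indicator function of a set. -/
noncomputable abbrev chi {E : Type*} (s : Set E) : E → ℝ := s.indicator fun _ => 1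

theorem measurePreserving_add_nsmul [MeasurableSpace E] {ν : Measure E} {v : E}
    (hv : MeasurePreserving (fun x => x + v) ν ν) (k : ℕ) :
    MeasurePreserving (fun x => x + k • v) ν ν := by
  induction k with
  | zero => simpa [Function.id_def] using MeasurePreserving.id ν
  | succ k ih =>
    have := hv.comp ih
    convert this using 1
    funext x
    simp only [Function.comp_apply, succ_nsmul, add_assoc]

variable [NormedSpace ℝ E]

/-- The polyhedron given by a finite set of pairs of a linear form and a right-hand side. -/
abbrev hpoly (Λ : Submodule ℤ E) (H : Finset (StrongDual ℝ E × ℝ)) : Set E :=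
  poly Λ Prod.fst Prod.snd H

open scoped Classical in
/-- The inequalities of the translate of a polyhedron by `v`. -/
noncomputable def shiftIneq (v : E) (H : Finset (StrongDual ℝ E × ℝ)) :
    Finset (StrongDual ℝ E × ℝ) :=
  H.image fun h => (h.1, h.2 + h.1 v)

variable {Λ : Submodule ℤ E}

theorem mem_hpoly_shiftIneq {v : E} (hv : v ∈ Submodule.span ℝ (Λ : Set E))
    {H : Finset (StrongDual ℝ E × ℝ)} {x : E} :
    x ∈ hpoly Λ (shiftIneq v H) ↔ x - v ∈ hpoly Λ H := by
  simp only [mem_poly, shiftIneq, Finset.forall_mem_image, map_sub, sub_le_iff_le_add]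
  rw [Submodule.sub_mem_iff_left _ hv]

open scoped Classical in
theorem mem_recession_union_shiftIneq {v x : E} {G H : Finset (StrongDual ℝ E × ℝ)} :
    x ∈ poly Λ Prod.fst 0 (G ∪ shiftIneq v H) ↔ x ∈ poly Λ Prod.fst 0 (G ∪ H) := by
  simp only [mem_poly, shiftIneq, Finset.mem_union, or_imp, forall_and, Finset.forall_mem_image,
    Pi.zero_apply]

open scoped Classical in
/-- Moving one facet of a polyhedron outwards adds a slab and removes a face of it, both of which
have their recession cone in the hyperplane of directions of the facet. -/
theorem chi_insert_sub_chi_insert (G : Finset (StrongDual ℝ E × ℝ)) (η : StrongDual ℝ E)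
    {c c' : ℝ} (h : c' ≤ c) :
    chi (hpoly Λ (insert (η, c) G)) - chi (hpoly Λ (insert (η, c') G)) =
      chi (hpoly Λ (insert (η, c) (insert (-η, -c') G))) -
        chi (hpoly Λ (insert (η, c') (insert (-η, -c') G))) := by
  funext x
  have e : ∀ s : Set E, chi s x = if x ∈ s then 1 else 0 := fun s => Set.indicator_apply _ _ _
  simp only [Pi.sub_apply, e, mem_poly, Finset.forall_mem_insert, neg_apply, neg_le_neg_iff]
  by_cases h1 : η x ≤ c'
  · have h2 := h1.trans h
    by_cases h3 : c' ≤ η x <;> simp [h1, h2, h3]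
  · have h3 : c' ≤ η x := (not_le.1 h1).le
    simp [h1, h3]

open scoped Classical in
/-- The difference of the indicator functions of a polyhedron and a translate along a recession
direction `v` is a combination of indicator functions of polyhedra with smaller recession cones. -/
theorem annihilable_chi_sub_chi_shiftIneq {V R : Set E} {v : E}
    (ih : ∀ H : Finset (StrongDual ℝ E × ℝ), (∀ h ∈ H, IntegralOn Λ h.1) →
      poly Λ Prod.fst 0 H ⊆ R → (∃ η : StrongDual ℝ E, η v ≠ 0 ∧
        ∀ x ∈ poly Λ Prod.fst 0 H, η x = 0) → Annihilable V (chi (hpoly Λ H)))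
    (H : Finset (StrongDual ℝ E × ℝ)) (hv : ∀ h ∈ H, h.1 v ≤ 0) (hH : ∀ h ∈ H, IntegralOn Λ h.1)
    (G : Finset (StrongDual ℝ E × ℝ)) (hG : ∀ h ∈ G, IntegralOn Λ h.1)
    (hR : poly Λ Prod.fst 0 (G ∪ H) ⊆ R) :
    Annihilable V (chi (hpoly Λ (G ∪ H)) - chi (hpoly Λ (G ∪ shiftIneq v H))) := by
  induction H using Finset.induction_on generalizing G with
  | empty => simpa [shiftIneq] using annihilable_zero V
  | insert h t _ iht =>
    obtain ⟨η, c⟩ := h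
    have hvη : η v ≤ 0 := hv _ (Finset.mem_insert_self _ _)
    have hη : IntegralOn Λ η := hH _ (Finset.mem_insert_self _ _)
    have ht : ∀ h ∈ t, IntegralOn Λ h.1 := fun k hk => hH k (Finset.mem_insert_of_mem hk)
    have hts : ∀ h ∈ shiftIneq v t, IntegralOn Λ h.1 := by
      simp only [shiftIneq, Finset.forall_mem_image]
      exact fun {h} hh => ht h hh
    have e1 : G ∪ insert (η, c) t = insert (η, c) G ∪ t := by
      rw [Finset.union_insert, Finset.insert_union]
    have e2 : insert (η, c) G ∪ shiftIneq v t = insert (η, c) (G ∪ shiftIneq v t) :=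
      Finset.insert_union _ _ _
    have e3 : G ∪ shiftIneq v (insert (η, c) t) =
        insert (η, c + η v) (G ∪ shiftIneq v t) := by
      rw [shiftIneq, Finset.image_insert, Finset.union_insert]
      rfl
    have h1 := iht (fun k hk => hv k (Finset.mem_insert_of_mem hk)) ht (insert (η, c) G)
      (by simpa using ⟨hη, fun a b => hG (a, b)⟩) (by rwa [← e1])
    have h2 : Annihilable V (chi (hpoly Λ (insert (η, c) (G ∪ shiftIneq v t))) -
        chi (hpoly Λ (insert (η, c + η v) (G ∪ shiftIneq v t)))) := by
      rcases eq_or_lt_of_le hvη with h0 | hneg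
      · rw [h0, add_zero, sub_self]
        exact annihilable_zero V
      · rw [chi_insert_sub_chi_insert _ _ (by linarith)]
        have hint : ∀ d d' : ℝ, ∀ h ∈ insert (η, d) (insert (-η, d') (G ∪ shiftIneq v t)),
            IntegralOn Λ h.1 := by
          intro d d' h hh
          simp only [Finset.mem_insert, Finset.mem_union] at hh
          rcases hh with rfl | rfl | hh | hh
          · exact hη
          · intro x hx
            obtain ⟨n, hn⟩ := hη x hx
            exact ⟨-n, by simp [hn]⟩
          · exact hG h hh
          · exact hts h hh
        have hrec : ∀ d d' : ℝ, poly Λ Prod.fst 0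
            (insert (η, d) (insert (-η, d') (G ∪ shiftIneq v t))) ⊆ R := by
          intro d d' x hx
          apply hR
          rw [e1, ← mem_recession_union_shiftIneq (v := v), e2]
          simp only [mem_poly, Finset.forall_mem_insert] at hx ⊢
          exact ⟨hx.1, hx.2.1, hx.2.2.2⟩
        have hzero : ∀ d d' : ℝ, ∀ x ∈ poly Λ Prod.fst 0
            (insert (η, d) (insert (-η, d') (G ∪ shiftIneq v t))), η x = 0 := by
          intro d d' x hx
          simp only [mem_poly, Finset.forall_mem_insert, Pi.zero_apply, neg_apply] at hx
          linarith [hx.2.1, hx.2.2.1]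
        exact (ih _ (hint _ _) (hrec _ _) ⟨η, hneg.ne, hzero _ _⟩).sub
          (ih _ (hint _ _) (hrec _ _) ⟨η, hneg.ne, hzero _ _⟩)
    rw [e1, e3]
    rw [e2] at h1
    convert h1.add h2 using 1
    abel

variable [FiniteDimensional ℝ E]

/-- A smaller recession cone lying in a hyperplane that does not contain `v` has smaller dimension:
the induction over polyhedra is on this dimension. -/
theorem finrank_span_recession_lt {H H' : Finset (StrongDual ℝ E × ℝ)} {v : E}
    (hv : v ∈ poly Λ Prod.fst 0 H) (hsub : poly Λ Prod.fst 0 H' ⊆ poly Λ Prod.fst 0 H)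
    {η : StrongDual ℝ E} (hη : η v ≠ 0) (h0 : ∀ x ∈ poly Λ Prod.fst 0 H', η x = 0) :
    Module.finrank ℝ (Submodule.span ℝ (poly Λ Prod.fst 0 H')) <
      Module.finrank ℝ (Submodule.span ℝ (poly Λ Prod.fst 0 H)) := by
  refine Submodule.finrank_lt_finrank_of_lt
    (lt_of_le_of_ne (Submodule.span_mono hsub) fun h => hη ?_)
  have h1 : Submodule.span ℝ (poly Λ Prod.fst 0 H') ≤ LinearMap.ker (η : E →ₗ[ℝ] ℝ) :=
    Submodule.span_le.2 h0
  exact h1 (h ▸ Submodule.subset_span hv)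

/-- The indicator function of a rational polyhedron is mapped to a function of bounded support by
difference operators along lattice vectors of its recession cone. -/
theorem annihilable_chi_hpoly (H : Finset (StrongDual ℝ E × ℝ)) (hH : ∀ h ∈ H, IntegralOn Λ h.1) :
    Annihilable {v | v ∈ Λ ∧ v ≠ 0 ∧ v ∈ poly Λ Prod.fst 0 H} (chi (hpoly Λ H)) := by
  classical
  generalize hn : Module.finrank ℝ (Submodule.span ℝ (poly Λ Prod.fst 0 H)) = n
  induction n using Nat.strong_induction_on generalizing H with
  | _ n ih =>
  by_cases hrec : ∀ x ∈ poly Λ Prod.fst 0 H, x = 0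
  · obtain ⟨R, hR⟩ := exists_norm_le_of_recession_eq_zero (c := Prod.snd) hrec
    refine ⟨[], by simp, R, fun x hx => ?_⟩
    rw [iterDiff_nil]
    exact Set.indicator_of_notMem (fun h => hx.not_ge (hR x h)) _
  · push Not at hrec
    obtain ⟨x, hx, hx0⟩ := hrec
    obtain ⟨v, hvΛ, hv0, hv, -⟩ := exists_lattice_mem_recession (η := Prod.fst) hH hx hx0
    refine Annihilable.of_diffOp (v := v) ⟨hvΛ, hv0, hv⟩ ?_
    have key := annihilable_chi_sub_chi_shiftIneq (Λ := Λ) (v := v)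
      (V := {v | v ∈ Λ ∧ v ≠ 0 ∧ v ∈ poly Λ Prod.fst 0 H}) (R := poly Λ Prod.fst 0 H)
      (fun H' hH' hR' hη => by
        obtain ⟨η, hηv, hη0⟩ := hη
        refine (ih _ (hn ▸ finrank_span_recession_lt hv hR' hηv hη0) H' hH' rfl).mono ?_
        exact fun w hw => ⟨hw.1, hw.2.1, hR' hw.2.2⟩)
      H hv.2 hH ∅ (by simp) (by rw [Finset.empty_union])
    rw [Finset.empty_union, Finset.empty_union] at key
    convert key using 1
    funext y
    rw [diffOp_apply, Pi.sub_apply]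
    congr 1
    by_cases hy : y - v ∈ hpoly Λ H
    · rw [chi, Set.indicator_of_mem hy, chi, Set.indicator_of_mem
        ((mem_hpoly_shiftIneq (mem_span_of_mem hvΛ)).2 hy)]
    · rw [chi, Set.indicator_of_notMem hy, chi, Set.indicator_of_notMem
        (fun h => hy ((mem_hpoly_shiftIneq (mem_span_of_mem hvΛ)).1 h))]

variable [MeasurableSpace E] [BorelSpace E]

open scoped Classical in
/-- Exponential integrals over a polyhedron converge for linear forms that are negative on the
nonzero recession directions: the polyhedron is covered by the translates, along a recession
direction `v`, of slabs with smaller recession cones. -/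
theorem lintegral_exp_hpoly_lt_top {ν : Measure E} [IsFiniteMeasureOnCompacts ν]
    (H : Finset (StrongDual ℝ E × ℝ)) (hH : ∀ h ∈ H, IntegralOn Λ h.1)
    (hν : ∀ v ∈ Λ, v ∈ poly Λ Prod.fst 0 H → MeasurePreserving (fun x => x + v) ν ν)
    {ξ : StrongDual ℝ E} (hξ : ξ ∈ negCone Λ Prod.fst H) :
    ∫⁻ x in hpoly Λ H, ENNReal.ofReal (Real.exp (ξ x)) ∂ν < ⊤ := by
  generalize hn : Module.finrank ℝ (Submodule.span ℝ (poly Λ Prod.fst 0 H)) = n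
  induction n using Nat.strong_induction_on generalizing H with
  | _ n ih =>
  by_cases hrec : ∀ x ∈ poly Λ Prod.fst 0 H, x = 0
  · obtain ⟨R, hR⟩ := exists_norm_le_of_recession_eq_zero (c := Prod.snd) hrec
    have h1 : IntegrableOn (fun x => Real.exp (ξ x)) (Metric.closedBall (0 : E) R) ν :=
      (by fun_prop : Continuous fun x => Real.exp (ξ x)).continuousOn.integrableOn_compact
        (isCompact_closedBall 0 R)
    have h2 : IntegrableOn (fun x => Real.exp (ξ x)) (hpoly Λ H) ν :=
      h1.mono_set fun x hx => by simpa using hR x hx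
    exact h2.lintegral_lt_top
  · push Not at hrec
    obtain ⟨x, hx, hx0⟩ := hrec
    obtain ⟨v, hvΛ, hv0, hv, -⟩ := exists_lattice_mem_recession (η := Prod.fst) hH hx hx0
    have hvν := hν v hvΛ hv
    -- the points of the polyhedron whose translates by `-v` do not satisfy `h` strictly
    let slab : StrongDual ℝ E × ℝ → Finset (StrongDual ℝ E × ℝ) := fun h =>
      insert (-h.1, -(h.2 + h.1 v)) H
    let J := H.filter fun h => h.1 v < 0
    let Q : Set E := ⋃ h ∈ J, hpoly Λ (slab h)
    have hQm : MeasurableSet Q := MeasurableSet.biUnion J.countable_toSet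
      fun h _ => isClosed_poly.measurableSet
    have hQ : ∫⁻ x in Q, ENNReal.ofReal (Real.exp (ξ x)) ∂ν < ⊤ := by
      have hle : ν.restrict Q ≤ ∑ h ∈ J, ν.restrict (hpoly Λ (slab h)) := by
        refine Measure.le_iff.2 fun s hs => ?_
        rw [Measure.restrict_apply hs, Measure.finsetSum_apply, Set.inter_iUnion₂]
        refine (measure_biUnion_finset_le J _).trans (Finset.sum_le_sum fun h _ => ?_)
        rw [Measure.restrict_apply hs]
      refine (lintegral_mono' hle le_rfl).trans_lt ?_
      rw [lintegral_finsetSum_measure]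
      refine ENNReal.sum_lt_top.2 fun h hh => ?_
      obtain ⟨hhH, hhv⟩ := Finset.mem_filter.1 hh
      have hsub : poly Λ Prod.fst 0 (slab h) ⊆ poly Λ Prod.fst 0 H := fun y hy =>
        ⟨hy.1, fun k hk => hy.2 k (Finset.mem_insert_of_mem hk)⟩
      have hzero : ∀ y ∈ poly Λ Prod.fst 0 (slab h), h.1 y = 0 := by
        intro y hy
        have h1 : h.1 y ≤ 0 := hy.2 h (Finset.mem_insert_of_mem hhH)
        have h2 : (-h.1) y ≤ 0 := hy.2 _ (Finset.mem_insert_self _ _)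
        rw [neg_apply] at h2
        linarith
      refine ih _ (hn ▸ finrank_span_recession_lt hv hsub hhv.ne hzero) (slab h) ?_
        (fun w hw hwR => hν w hw (hsub hwR)) (fun u hu => hξ u (hsub hu)) rfl
      intro k hk
      rcases Finset.mem_insert.1 hk with rfl | hk
      · intro y hy
        obtain ⟨m, hm⟩ := hH h hhH y hy
        exact ⟨-m, by simp [hm]⟩
      · exact hH k hk
    have hcover : hpoly Λ H ⊆ ⋃ k : ℕ, (fun y => y + k • v) '' Q := by
      intro y hy
      -- going back along `v` leaves the polyhedron, as `ξ` is not negative on both `v` and `-v`;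
      -- the last point inside lies in a slab
      have hex : ∃ k : ℕ, y - k • v ∉ hpoly Λ H := by
        by_contra hall
        push Not at hall
        have hneg : -v ∈ poly Λ Prod.fst 0 H := by
          refine ⟨neg_mem (mem_span_of_mem hvΛ), fun h hh => ?_⟩
          by_contra hpos
          have hpos : h.1 v < 0 := by simpa using hpos
          obtain ⟨k, hk⟩ := exists_nat_gt ((h.2 - h.1 y) / -h.1 v)
          rw [div_lt_iff₀ (by linarith)] at hk
          have := (hall k).2 h hh
          rw [map_sub, map_nsmul, nsmul_eq_mul] at this
          linarith
        have h1 := hξ v hv hv0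
        have h2 := hξ (-v) hneg (neg_ne_zero.2 hv0)
        rw [map_neg] at h2
        linarith
      obtain ⟨k, hk⟩ : ∃ k, Nat.find hex = k + 1 := by
        refine Nat.exists_eq_succ_of_ne_zero fun h0 => ?_
        have := Nat.find_spec hex
        rw [h0, zero_smul, sub_zero] at this
        exact this hy
      have h1 : y - k • v ∈ hpoly Λ H := by
        by_contra h
        have := Nat.find_min' hex h
        omega
      have h2 := Nat.find_spec hex
      rw [hk, succ_nsmul, ← sub_sub] at h2
      have h3 : ∃ h ∈ H, h.2 < h.1 (y - k • v - v) := by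
        by_contra hcon
        push Not at hcon
        exact h2 ⟨sub_mem h1.1 (mem_span_of_mem hvΛ), hcon⟩
      obtain ⟨h, hh, hlt⟩ := h3
      rw [map_sub] at hlt
      have hle := h1.2 h hh
      refine Set.mem_iUnion.2 ⟨k, y - k • v, Set.mem_biUnion (x := h)
        (Finset.mem_filter.2 ⟨hh, by linarith⟩) ⟨h1.1, ?_⟩, sub_add_cancel _ _⟩
      refine (Finset.forall_mem_insert _ _ _).2 ⟨?_, h1.2⟩
      simp only [neg_apply]
      linarith
    have htrans : ∀ k : ℕ, ∫⁻ x in (fun y => y + k • v) '' Q, ENNReal.ofReal (Real.exp (ξ x)) ∂ν =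
        ENNReal.ofReal (Real.exp (ξ v)) ^ k *
          ∫⁻ x in Q, ENNReal.ofReal (Real.exp (ξ x)) ∂ν := by
      intro k
      rw [← (measurePreserving_add_nsmul hvν k).setLIntegral_comp_emb
        (measurableEmbedding_addRight _), ← lintegral_const_mul' _ _ (by finiteness)]
      refine lintegral_congr fun x => ?_
      rw [← ENNReal.ofReal_pow (Real.exp_nonneg _), ← ENNReal.ofReal_mul (by positivity),
        map_add, Real.exp_add, map_nsmul, ← Real.exp_nat_mul, nsmul_eq_mul, mul_comm]
    calc ∫⁻ x in hpoly Λ H, ENNReal.ofReal (Real.exp (ξ x)) ∂ν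
        ≤ ∫⁻ x in ⋃ k : ℕ, (fun y => y + k • v) '' Q, ENNReal.ofReal (Real.exp (ξ x)) ∂ν :=
          lintegral_mono_set hcover
      _ ≤ ∑' k : ℕ, ∫⁻ x in (fun y => y + k • v) '' Q, ENNReal.ofReal (Real.exp (ξ x)) ∂ν :=
          lintegral_iUnion_le _ _
      _ = (1 - ENNReal.ofReal (Real.exp (ξ v)))⁻¹ *
          ∫⁻ x in Q, ENNReal.ofReal (Real.exp (ξ x)) ∂ν := by
          simp only [htrans]
          rw [ENNReal.tsum_mul_right, ENNReal.tsum_geometric]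
      _ < ⊤ := by
          refine ENNReal.mul_lt_top ?_ hQ
          rw [ENNReal.inv_lt_top, tsub_pos_iff_lt, ENNReal.ofReal_lt_one, Real.exp_lt_one_iff]
          exact hξ v hv hv0

end Annihilation

/-! ### Transforms of polyhedra -/

section PolyhedronTransform

variable {E : Type*} [NormedAddCommGroup E] [InnerProductSpace ℝ E] {Λ : Submodule ℤ E}

/-- Polyhedra in `span Λ` bounded by integral hyperplane directions, with arbitrary real right-hand
sides. -/
def IsIntPoly (Λ : Submodule ℤ E) (p : Set E) : Prop :=
  ∃ H : Finset (StrongDual ℝ E × ℝ), (∀ h ∈ H, IntegralOn Λ h.1) ∧ p = hpoly Λ H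

open scoped Classical in
theorem poly_eq_hpoly {ι : Type*} (η : ι → StrongDual ℝ E) (c : ι → ℝ) (H : Finset ι) :
    poly Λ η c H = hpoly Λ (H.image fun i => (η i, c i)) := by
  ext x
  simp [mem_poly]

theorem isIntPoly_poly {ι : Type*} {η : ι → StrongDual ℝ E} {c : ι → ℝ} {H : Finset ι}
    (hH : ∀ i ∈ H, IntegralOn Λ (η i)) : IsIntPoly Λ (poly Λ η c H) := by
  classical
  exact ⟨_, by simpa using hH, poly_eq_hpoly η c H⟩

theorem IntegralOn.neg {E : Type*} [NormedAddCommGroup E] [NormedSpace ℝ E] {Λ : Submodule ℤ E}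
    {η : StrongDual ℝ E} (h : IntegralOn Λ η) : IntegralOn Λ (-η) := by
  intro x hx
  obtain ⟨n, hn⟩ := h x hx
  exact ⟨-n, by simp [hn]⟩

theorem IsIntPoly.inter {p q : Set E} (hp : IsIntPoly Λ p) (hq : IsIntPoly Λ q) :
    IsIntPoly Λ (p ∩ q) := by
  classical
  obtain ⟨H, hH, rfl⟩ := hp
  obtain ⟨G, hG, rfl⟩ := hq
  refine ⟨H ∪ G, fun h hh => (Finset.mem_union.1 hh).elim (hH h) (hG h), ?_⟩
  ext x
  simp only [Set.mem_inter_iff, mem_poly, Finset.mem_union, or_imp, forall_and]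
  tauto

/-- The recession directions of a set. -/
def recc (p : Set E) : Set E := {v | ∀ x ∈ p, x + v ∈ p}

/-- The linear forms that are negative on the nonzero recession directions. -/
def negForms (p : Set E) : Set (StrongDual ℝ E) := {ξ | ∀ v ∈ recc p, v ≠ 0 → ξ v < 0}

/-- The recession cone of a nonempty polyhedron is given by the homogeneous inequalities. -/
theorem recc_poly {ι : Type*} {η : ι → StrongDual ℝ E} {c : ι → ℝ} {H : Finset ι}
    (hne : (poly Λ η c H).Nonempty) : recc (poly Λ η c H) = poly Λ η 0 H := by
  refine Set.Subset.antisymm (fun v hv => ?_) fun v hv x hx => add_recession_mem hx hv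
  obtain ⟨x, hx⟩ := hne
  refine ⟨by simpa using sub_mem (hv x hx).1 hx.1, fun i hi => ?_⟩
  by_contra hpos
  have hpos : 0 < η i v := not_le.1 hpos
  have hall : ∀ k : ℕ, x + k • v ∈ poly Λ η c H := by
    intro k
    induction k with
    | zero => simpa using hx
    | succ k ih => rw [succ_nsmul, ← add_assoc]; exact hv _ ih
  obtain ⟨k, hk⟩ := exists_nat_gt ((c i - η i x) / η i v)
  rw [div_lt_iff₀ hpos] at hk
  have := (hall k).2 i hi
  rw [map_add, map_nsmul, nsmul_eq_mul] at this
  linarith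

theorem negForms_poly {ι : Type*} {η : ι → StrongDual ℝ E} {c : ι → ℝ} {H : Finset ι}
    (hne : (poly Λ η c H).Nonempty) : negForms (poly Λ η c H) = negCone Λ η H := by
  rw [negForms, recc_poly hne, negCone]

theorem dirs_eq_bot_of_not_containsLine {ι : Type*} {η : ι → StrongDual ℝ E} {c : ι → ℝ}
    {H : Finset ι} (hne : (poly Λ η c H).Nonempty) (h : ¬ ContainsLine (poly Λ η c H)) :
    dirs Λ η H = ⊥ := by
  obtain ⟨x, hx⟩ := hne
  rw [Submodule.eq_bot_iff]
  intro v hv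
  by_contra hv0
  refine h ⟨x, v, hv0, fun t => ⟨add_mem hx.1 (Submodule.smul_mem _ _ hv.1), fun i hi => ?_⟩⟩
  rw [map_add, map_smul, hv.2 i hi, smul_zero, add_zero]
  exact hx.2 i hi

theorem mem_dirs_of_line {ι : Type*} {η : ι → StrongDual ℝ E} {c : ι → ℝ} {H : Finset ι}
    {x v : E} (h : ∀ t : ℝ, x + t • v ∈ poly Λ η c H) : v ∈ dirs Λ η H := by
  refine ⟨?_, fun i hi => ?_⟩
  · have := sub_mem (h 1).1 (h 0).1
    simpa using this
  · by_contra h0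
    have := (h ((c i - η i x + 1) / η i v)).2 i hi
    rw [map_add, map_smul, smul_eq_mul, div_mul_cancel₀ _ h0] at this
    linarith

theorem containsLine_poly_iff {ι : Type*} {η : ι → StrongDual ℝ E} {c : ι → ℝ} {H : Finset ι}
    (hne : (poly Λ η c H).Nonempty) : ContainsLine (poly Λ η c H) ↔ dirs Λ η H ≠ ⊥ := by
  refine ⟨fun ⟨x, v, hv0, h⟩ h0 => hv0 ?_, fun h => ?_⟩
  · exact (Submodule.mem_bot ℝ).1 (h0 ▸ mem_dirs_of_line h)
  · by_contra hl
    exact h (dirs_eq_bot_of_not_containsLine hne hl)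

theorem recc_subset_vectorSpan {p : Set E} (hne : p.Nonempty) {v : E} (hv : v ∈ recc p) :
    v ∈ vectorSpan ℝ p := by
  obtain ⟨x, hx⟩ := hne
  simpa using vsub_mem_vectorSpan ℝ (hv x hx) hx

theorem chi_mul_exp (p : Set E) (ξ : StrongDual ℝ E) :
    (fun x => chi p x * Real.exp (ξ x)) = p.indicator fun x => Real.exp (ξ x) := by
  funext x
  by_cases hx : x ∈ p <;> simp [hx]

/-- For a pointed polyhedron the domain of convergence accumulates at `0`. -/
theorem IsIntPoly.zero_mem_closure_interior [FiniteDimensional ℝ E] {p : Set E}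
    (hp : IsIntPoly Λ p) (hne : p.Nonempty) (hl : ¬ ContainsLine p) :
    0 ∈ closure (interior (negForms p)) := by
  obtain ⟨H, hH, rfl⟩ := hp
  rw [negForms_poly hne]
  exact zero_mem_closure_interior_negCone (dirs_eq_bot_of_not_containsLine hne hl)

variable [MeasurableSpace E]

/-- The measure is preserved by the lattice translations in `L`. -/
def LatticeInvariant (Λ : Submodule ℤ E) (L : Submodule ℝ E) (ν : Measure E) : Prop :=
  ∀ v ∈ Λ, v ∈ L → MeasurePreserving (fun x => x + v) ν ν

theorem integrable_chi_mul_exp_iff {ν : Measure E} {p : Set E} (hp : MeasurableSet p)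
    {ξ : StrongDual ℝ E} :
    Integrable (fun x => chi p x * Real.exp (ξ x)) ν ↔
      IntegrableOn (fun x => Real.exp (ξ x)) p ν := by
  rw [chi_mul_exp, integrable_indicator_iff hp]

theorem expIntegral_chi {ν : Measure E} {p : Set E} (hp : MeasurableSet p) (ξ : StrongDual ℝ E) :
    expIntegral ν (chi p) ξ = ∫ x in p, Real.exp (ξ x) ∂ν := by
  rw [expIntegral, chi_mul_exp, integral_indicator hp]

variable [BorelSpace E] [FiniteDimensional ℝ E]

theorem IsIntPoly.measurableSet {p : Set E} (hp : IsIntPoly Λ p) : MeasurableSet p := by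
  obtain ⟨H, -, rfl⟩ := hp
  exact isClosed_poly.measurableSet

variable {ν : Measure E} [IsFiniteMeasureOnCompacts ν]

theorem HasTransform.chi_empty : HasTransform ν (chi (∅ : Set E)) 0 := by
  rw [chi, Set.indicator_empty]
  exact HasTransform.zero

/-- Indicator functions of polyhedra have transforms with respect to lattice-invariant measures. -/
theorem IsIntPoly.exists_hasTransform {p : Set E} (hp : IsIntPoly Λ p)
    (hν : LatticeInvariant Λ (vectorSpan ℝ p) ν) : ∃ φ, HasTransform ν (chi p) φ := by
  rcases p.eq_empty_or_nonempty with rfl | hne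
  · exact ⟨0, .chi_empty⟩
  have hm := bddMeas_indicator hp.measurableSet
  obtain ⟨H, hH, rfl⟩ := hp
  obtain ⟨A, hA, hs⟩ := annihilable_chi_hpoly H hH
  refine LocalEM.exists_hasTransform hm (fun v hv => ⟨(hA v hv).2.1, hν v (hA v hv).1 ?_⟩) hs
  exact recc_subset_vectorSpan hne (recc_poly hne ▸ (hA v hv).2.2)

/-- Polyhedra that contain a line have transform `0`: their indicator functions are periodic. -/
theorem IsIntPoly.hasTransform_zero {p : Set E} (hp : IsIntPoly Λ p)
    (hν : LatticeInvariant Λ (vectorSpan ℝ p) ν) (hl : ContainsLine p) :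
    HasTransform ν (chi p) 0 := by
  have hne : p.Nonempty := by
    obtain ⟨x, v, -, h⟩ := hl
    exact ⟨_, h 0⟩
  have hm := bddMeas_indicator hp.measurableSet
  obtain ⟨H, hH, rfl⟩ := hp
  obtain ⟨x, w, hw0, h⟩ := hl
  obtain ⟨v, hv, hv0, hvd⟩ := exists_lattice_mem_dirs hH (mem_dirs_of_line h) hw0
  have h1 : v ∈ recc (hpoly Λ H) := by
    rw [recc_poly hne]
    exact ⟨hvd.1, fun i hi => (hvd.2 i hi).le⟩
  have h2 : -v ∈ recc (hpoly Λ H) := by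
    rw [recc_poly hne]
    have hvd' := neg_mem hvd
    exact ⟨hvd'.1, fun i hi => (hvd'.2 i hi).le⟩
  refine hasTransform_zero_of_diffOp_eq_zero hm (v := v)
    ⟨hv0, hν v hv (recc_subset_vectorSpan hne h1)⟩ ?_
  funext y
  have hiff : y - v ∈ hpoly Λ H ↔ y ∈ hpoly Λ H :=
    ⟨fun hy => by simpa using h1 _ hy, fun hy => by simpa [sub_eq_add_neg] using h2 _ hy⟩
  rw [diffOp_apply, Pi.zero_apply, sub_eq_zero]
  by_cases hy : y ∈ hpoly Λ H
  · rw [chi, Set.indicator_of_mem hy, Set.indicator_of_mem (hiff.2 hy)]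
  · rw [chi, Set.indicator_of_notMem hy, Set.indicator_of_notMem (mt hiff.1 hy)]

theorem IsIntPoly.integrableOn_exp {p : Set E} (hp : IsIntPoly Λ p)
    (hν : LatticeInvariant Λ (vectorSpan ℝ p) ν) {ξ : StrongDual ℝ E} (hξ : ξ ∈ negForms p) :
    IntegrableOn (fun x => Real.exp (ξ x)) p ν := by
  rcases p.eq_empty_or_nonempty with rfl | hne
  · exact integrableOn_empty
  obtain ⟨H, hH, rfl⟩ := hp
  refine ⟨(by fun_prop : Continuous fun x => Real.exp (ξ x)).aestronglyMeasurable, ?_⟩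
  rw [hasFiniteIntegral_iff_ofReal (Filter.Eventually.of_forall fun x => (Real.exp_pos _).le)]
  refine lintegral_exp_hpoly_lt_top H hH (fun v hv hvr => hν v hv ?_) (negForms_poly hne ▸ hξ)
  exact recc_subset_vectorSpan hne (recc_poly hne ▸ hvr)

/-- For polyhedra without lines, a meromorphic germ is determined by its agreement with the
exponential integral where the latter converges. -/
theorem IsIntPoly.agreesOn_unique {p : Set E} (hp : IsIntPoly Λ p)
    (hν : LatticeInvariant Λ (vectorSpan ℝ p) ν) (hl : ¬ ContainsLine p) {φ ψ : Mer E}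
    {F : StrongDual ℝ E → ℝ}
    (hφ : AgreesOn φ {ξ | Integrable (fun x => chi p x * Real.exp (ξ x)) ν} F)
    (hψ : AgreesOn ψ {ξ | Integrable (fun x => chi p x * Real.exp (ξ x)) ν} F) : φ = ψ := by
  rcases p.eq_empty_or_nonempty with rfl | hne
  · exact hφ.unique hψ (U := Set.univ) (by intro; simp) (by intro; simp)
      (subset_closure (by simp)) fun _ _ => rfl
  · refine hφ.unique hψ (U := negForms p) ?_ ?_ (hp.zero_mem_closure_interior hne hl)
      fun _ _ => rfl
    all_goals exact fun ξ hξ =>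
      (integrable_chi_mul_exp_iff hp.measurableSet).2 (hp.integrableOn_exp hν hξ)

end PolyhedronTransform

/-! ### Lattice sums and lattice-normalized integrals as transforms -/

section LatticeSums

variable {E : Type*} [NormedAddCommGroup E] [MeasurableSpace E]

/-- The counting measure of the points of the lattice `Λ`, as a measure on the ambient space. -/
noncomputable def latticeCount (Λ : Submodule ℤ E) : Measure E :=
  (Measure.count : Measure Λ).map Subtype.val

theorem isClosed_lattice {E : Type*} [NormedAddCommGroup E] {Λ : Submodule ℤ E}
    [DiscreteTopology Λ] : IsClosed (Λ : Set E) :=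
  have : DiscreteTopology Λ.toAddSubgroup := inferInstanceAs (DiscreteTopology Λ)
  AddSubgroup.isClosed_of_discrete (H := Λ.toAddSubgroup)

variable [InnerProductSpace ℝ E] [FiniteDimensional ℝ E] [BorelSpace E]
  {Λ : Submodule ℤ E} [DiscreteTopology Λ]

theorem measurableEmbedding_lattice : MeasurableEmbedding (Subtype.val : Λ → E) := by
  refine MeasurableEmbedding.subtype_coe (Set.Countable.measurableSet ?_)
  exact Set.countable_coe_iff.1 (countable_of_Lindelof_of_discrete (X := Λ))

instance : IsFiniteMeasureOnCompacts (latticeCount Λ) := by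
  refine ⟨fun K hK => ?_⟩
  have hfin : (K ∩ (Λ : Set E)).Finite := by
    have hc : IsCompact (K ∩ (Λ : Set E)) := hK.inter_right isClosed_lattice
    refine hc.finite ?_
    have : DiscreteTopology (Λ : Set E) := inferInstanceAs (DiscreteTopology Λ)
    exact (isDiscrete_iff_discreteTopology.2 this).mono Set.inter_subset_right
  rw [latticeCount, measurableEmbedding_lattice.map_apply,
    Measure.count_apply_lt_top' (measurableEmbedding_lattice.measurable hK.measurableSet)]
  refine Set.Finite.of_finite_image (hfin.subset ?_) Subtype.val_injective.injOn
  rintro _ ⟨x, hx, rfl⟩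
  exact ⟨hx, x.2⟩

omit [FiniteDimensional ℝ E] [DiscreteTopology Λ] in
theorem latticeInvariant_latticeCount (L : Submodule ℝ E) :
    LatticeInvariant Λ L (latticeCount Λ) := by
  intro v hv _
  refine ⟨by fun_prop, ?_⟩
  have h1 : (fun x => x + v) ∘ (Subtype.val : Λ → E) = Subtype.val ∘ Equiv.addRight ⟨v, hv⟩ := by
    funext x
    rfl
  have hm : Measurable (Equiv.addRight (⟨v, hv⟩ : Λ)) :=
    (by fun_prop : Continuous fun x : Λ => x + ⟨v, hv⟩).measurable
  have h2 : (Measure.count : Measure Λ).map (Equiv.addRight ⟨v, hv⟩) = Measure.count := by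
    ext s hs
    rw [Measure.map_apply hm hs, Measure.count_apply hs, Measure.count_apply (hm hs),
      Set.encard_preimage_of_bijective (Equiv.bijective _)]
  rw [latticeCount, Measure.map_map (by fun_prop) measurable_subtype_coe, h1,
    ← Measure.map_map measurable_subtype_coe hm, h2]

theorem integrable_latticeCount_iff {f : E → ℝ} :
    Integrable f (latticeCount Λ) ↔ Summable fun x : Λ => f x := by
  rw [latticeCount, measurableEmbedding_lattice.integrable_map_iff, integrable_count_iff]
  exact summable_norm_iff (f := fun x : Λ => f x)

theorem integral_latticeCount {f : E → ℝ} (hf : Integrable f (latticeCount Λ)) :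
    ∫ x, f x ∂latticeCount Λ = ∑' x : Λ, f x := by
  rw [latticeCount, measurableEmbedding_lattice.integrable_map_iff] at hf
  have : Countable Λ := countable_of_Lindelof_of_discrete
  rw [latticeCount, measurableEmbedding_lattice.integral_map]
  refine (integral_countable hf).trans ?_
  refine tsum_congr fun x => ?_
  rw [measureReal_def, Measure.count_singleton]
  simp

end LatticeSums

theorem summable_inter_iff {E : Type*} [NormedAddCommGroup E] {Λ : Submodule ℤ E} (p : Set E)
    (f : E → ℝ) :
    (Summable fun x : ↥(p ∩ (Λ : Set E)) => f x) ↔ Summable fun x : Λ => p.indicator f x := by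
  rw [show (fun x : ↥(p ∩ (Λ : Set E)) => f x) = f ∘ Subtype.val from rfl,
    summable_subtype_iff_indicator, Set.inter_comm, ← Set.indicator_indicator,
    ← summable_subtype_iff_indicator]
  rfl

theorem tsum_inter {E : Type*} [NormedAddCommGroup E] {Λ : Submodule ℤ E} (p : Set E)
    (f : E → ℝ) :
    ∑' x : ↥(p ∩ (Λ : Set E)), f x = ∑' x : Λ, p.indicator f x := by
  rw [tsum_subtype (p ∩ (Λ : Set E)) f, Set.inter_comm, ← Set.indicator_indicator,
    ← tsum_subtype]
  rfl

theorem S_eq_zero_of_containsLine {E : Type*} [NormedAddCommGroup E] [InnerProductSpace ℝ E]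
    {Λ : Submodule ℤ E} {p : Set E} (hl : ContainsLine p) : S Λ p = 0 := by
  rw [S, dif_neg (fun h => h.1 hl)]

section LatticeSumTransform

variable {E : Type*} [NormedAddCommGroup E] [InnerProductSpace ℝ E] [FiniteDimensional ℝ E]
  [MeasurableSpace E] [BorelSpace E] {Λ : Submodule ℤ E} [DiscreteTopology Λ]

theorem latticeCount_domain (p : Set E) :
    {ξ : StrongDual ℝ E | Integrable (fun x => chi p x * Real.exp (ξ x)) (latticeCount Λ)} =
      {ξ | Summable fun x : ↥(p ∩ (Λ : Set E)) => Real.exp (ξ x)} := by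
  ext ξ
  rw [Set.mem_ofPred_eq, chi_mul_exp, integrable_latticeCount_iff, Set.mem_ofPred_eq,
    summable_inter_iff p fun x => Real.exp (ξ x)]

/-- Where the sum converges, the exponential integral for the counting measure of the lattice is the
sum over the lattice points. -/
theorem AgreesOn.latticeCount {p : Set E} {φ : Mer E} (h : AgreesOn φ
      {ξ | Integrable (fun x => chi p x * Real.exp (ξ x)) (latticeCount Λ)}
      (expIntegral (latticeCount Λ) (chi p))) :
    AgreesOn φ {ξ | Summable fun x : ↥(p ∩ (Λ : Set E)) => Real.exp (ξ x)}
      (fun ξ => ∑' x : ↥(p ∩ (Λ : Set E)), Real.exp (ξ x)) := by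
  refine h.mono (latticeCount_domain p).ge fun ξ hξ => ?_
  rw [← latticeCount_domain, Set.mem_ofPred_eq] at hξ
  rw [expIntegral, integral_latticeCount hξ, tsum_inter p fun x => Real.exp (ξ x)]
  exact tsum_congr fun x => (congrFun (chi_mul_exp p ξ) x).symm

/-- For polyhedra, the function `S` is the transform with respect to the counting measure. -/
theorem S_hasTransform {p : Set E} (hp : IsIntPoly Λ p) :
    HasTransform (latticeCount Λ) (chi p) (S Λ p) := by
  have hν := latticeInvariant_latticeCount (Λ := Λ) (vectorSpan ℝ p)
  by_cases hl : ContainsLine p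
  · rw [S, dif_neg (fun h => h.1 hl)]
    exact hp.hasTransform_zero hν hl
  · obtain ⟨φ, hφ⟩ := hp.exists_hasTransform hν
    have hag := hφ.agreesOn.latticeCount
    rw [S, dif_pos ⟨hl, φ, hag⟩]
    have hch := Exists.choose_spec (⟨φ, hag⟩ : ∃ φ : Mer E, AgreesOn φ
      {ξ | Summable fun x : ↥(p ∩ (Λ : Set E)) => Real.exp (ξ x)}
      (fun ξ => ∑' x : ↥(p ∩ (Λ : Set E)), Real.exp (ξ x)))
    have h := latticeCount_domain (Λ := Λ) p
    rwa [hp.agreesOn_unique hν hl (hch.mono h.le fun _ _ => rfl) (hag.mono h.le fun _ _ => rfl)]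

theorem agreesOn_S {p : Set E} (hp : IsIntPoly Λ p) :
    AgreesOn (S Λ p) {ξ | Summable fun x : ↥(p ∩ (Λ : Set E)) => Real.exp (ξ x)}
      (fun ξ => ∑' x : ↥(p ∩ (Λ : Set E)), Real.exp (ξ x)) :=
  (S_hasTransform hp).agreesOn.latticeCount

theorem summable_exp_of_mem_negForms {p : Set E} (hp : IsIntPoly Λ p) {ξ : StrongDual ℝ E}
    (hξ : ξ ∈ negForms p) : Summable fun x : ↥(p ∩ (Λ : Set E)) => Real.exp (ξ x) := by
  have h := latticeCount_domain (Λ := Λ) p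
  refine h.le ((integrable_chi_mul_exp_iff hp.measurableSet).2 (hp.integrableOn_exp ?_ hξ))
  exact latticeInvariant_latticeCount _

end LatticeSumTransform

section LatticeMeasure

variable {E : Type*} [NormedAddCommGroup E] [InnerProductSpace ℝ E] [FiniteDimensional ℝ E]
  [MeasurableSpace E] [BorelSpace E]

theorem inv_covolume_smul_addHaar {V ι : Type*} [NormedAddCommGroup V] [NormedSpace ℝ V]
    [FiniteDimensional ℝ V] [MeasurableSpace V] [BorelSpace V] [Fintype ι]
    (b : Module.Basis ι ℝ V) {Γ : Submodule ℤ V} (hΓ : Submodule.span ℤ (Set.range b) = Γ) :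
    (ENNReal.ofReal (ZLattice.covolume Γ (Measure.addHaar : Measure V)))⁻¹ •
      (Measure.addHaar : Measure V) = b.addHaar := by
  subst hΓ
  have hcov := ZLattice.covolume_eq_measure_fundamentalDomain (Submodule.span ℤ (Set.range b))
    (Measure.addHaar : Measure V) (ZSpan.isAddFundamentalDomain b _)
  rw [measureReal_congr (ZSpan.fundamentalDomain_ae_parallelepiped b _)] at hcov
  have hpos := ZLattice.covolume_pos (Submodule.span ℤ (Set.range b)) (Measure.addHaar : Measure V)
  have hpar : (Measure.addHaar : Measure V) (parallelepiped b) ≠ ⊤ := by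
    rw [← b.coe_parallelepiped]
    exact b.parallelepiped.isCompact.measure_lt_top.ne
  have := Measure.IsAddHaarMeasure.smul (Measure.addHaar : Measure V)
    (c := (ENNReal.ofReal (ZLattice.covolume (Submodule.span ℤ (Set.range b))
      (Measure.addHaar : Measure V)))⁻¹) (by simp) (by simpa using hpos)
  refine ((b.addHaar_eq_iff _).2 ?_).symm
  rw [Measure.smul_apply, smul_eq_mul, b.coe_parallelepiped, hcov, measureReal_def,
    ENNReal.ofReal_toReal hpar]
  refine ENNReal.inv_mul_cancel (fun h0 => ?_) hpar
  rw [hcov, measureReal_def, h0] at hpos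
  simp at hpos

/-- The normalized measure on `L` is the Haar measure of any basis of the lattice `Λ ∩ L`. -/
theorem latticeMeasure_eq_addHaar {Λ : Submodule ℤ E} {L : Submodule ℝ E} {ι : Type*} [Fintype ι]
    (b : Module.Basis ι ℝ L)
    (hb : Submodule.span ℤ (Set.range b) = ZLattice.comap ℝ Λ L.subtype) :
    latticeMeasure Λ L = b.addHaar :=
  inv_covolume_smul_addHaar b hb

/-- Subspaces spanned by lattice points. -/
def IsRatSubspace (Λ : Submodule ℤ E) (L : Submodule ℝ E) : Prop :=
  L ≤ Submodule.span ℝ {x | x ∈ Λ ∧ x ∈ L}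

omit [FiniteDimensional ℝ E] [MeasurableSpace E] [BorelSpace E] in
theorem span_comap_subtype_eq_top {Λ : Submodule ℤ E} {L : Submodule ℝ E}
    (hL : IsRatSubspace Λ L) :
    Submodule.span ℝ (ZLattice.comap ℝ Λ L.subtype : Set L) = ⊤ := by
  have h : ∀ x ∈ Submodule.span ℝ {x | x ∈ Λ ∧ x ∈ L}, ∃ hx : x ∈ L, (⟨x, hx⟩ : L) ∈
      Submodule.span ℝ (ZLattice.comap ℝ Λ L.subtype : Set L) := by
    intro x hx
    induction hx using Submodule.span_induction with
    | mem w hw => exact ⟨hw.2, Submodule.subset_span hw.1⟩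
    | zero => exact ⟨zero_mem _, zero_mem _⟩
    | add x y _ _ hx hy => exact ⟨add_mem hx.1 hy.1, add_mem hx.2 hy.2⟩
    | smul r x _ hx => exact ⟨L.smul_mem r hx.1, Submodule.smul_mem _ r hx.2⟩
  exact eq_top_iff.2 fun x _ => (h x (hL x.2)).2

omit [MeasurableSpace E] [BorelSpace E] in
theorem exists_latticeBasis (Λ : Submodule ℤ E) [DiscreteTopology Λ] {L : Submodule ℝ E}
    (hL : IsRatSubspace Λ L) : ∃ b : Module.Basis (Fin (Module.finrank ℝ L)) ℝ L,
      Submodule.span ℤ (Set.range b) = ZLattice.comap ℝ Λ L.subtype := by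
  have : DiscreteTopology (ZLattice.comap ℝ Λ L.subtype) :=
    ZLattice.comap_discreteTopology ℝ Λ L.subtypeL.continuous Subtype.val_injective
  have : IsZLattice ℝ (ZLattice.comap ℝ Λ L.subtype) := ⟨span_comap_subtype_eq_top hL⟩
  let b₀ := Module.Free.chooseBasis ℤ (ZLattice.comap ℝ Λ L.subtype)
  let b := b₀.ofZLatticeBasis ℝ (ZLattice.comap ℝ Λ L.subtype)
  have hb := b₀.ofZLatticeBasis_span ℝ (ZLattice.comap ℝ Λ L.subtype)
  let e := b.indexEquiv (Module.finBasis ℝ L)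
  refine ⟨b.reindex e, ?_⟩
  rw [Module.Basis.range_reindex]
  exact hb

end LatticeMeasure

section AffineMeasure

variable {E : Type*} [NormedAddCommGroup E] [InnerProductSpace ℝ E] [FiniteDimensional ℝ E]
  [MeasurableSpace E] [BorelSpace E]

/-- The normalized measure of a subspace `L`, translated to the affine subspace `x + L`. -/
noncomputable def translateMeasure (Λ : Submodule ℤ E) (L : Submodule ℝ E) (x : E) : Measure E :=
  (latticeMeasure Λ L).map (fun y : L => x + (y : E))

variable {Λ : Submodule ℤ E} {L : Submodule ℝ E} {x : E}

theorem measurableEmbedding_add_subtype (L : Submodule ℝ E) (x : E) :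
    MeasurableEmbedding (fun y : L => x + (y : E)) :=
  (measurableEmbedding_addLeft x).comp
    (MeasurableEmbedding.subtype_coe (Submodule.closed_of_finiteDimensional L).measurableSet)

/-- The affine subspace `x + L` carries its normalized measure. -/
theorem ae_translateMeasure : ∀ᵐ y ∂translateMeasure Λ L x, y - x ∈ L := by
  rw [translateMeasure, (measurableEmbedding_add_subtype L x).ae_map_iff]
  exact Filter.Eventually.of_forall fun y => by simp

variable [DiscreteTopology Λ]

theorem isAddHaarMeasure_latticeMeasure (hL : IsRatSubspace Λ L) :
    (latticeMeasure Λ L).IsAddHaarMeasure := by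
  obtain ⟨b, hb⟩ := exists_latticeBasis Λ hL
  rw [latticeMeasure_eq_addHaar b hb]
  infer_instance

theorem isFiniteMeasureOnCompacts_translateMeasure (hL : IsRatSubspace Λ L) :
    IsFiniteMeasureOnCompacts (translateMeasure Λ L x) := by
  have := isAddHaarMeasure_latticeMeasure hL
  refine ⟨fun K hK => ?_⟩
  rw [translateMeasure, (measurableEmbedding_add_subtype L x).map_apply]
  refine IsCompact.measure_lt_top ?_
  have hemb : Topology.IsClosedEmbedding (fun y : L => x + (y : E)) :=
    (Homeomorph.addLeft x).isClosedEmbedding.comp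
      (Submodule.closed_of_finiteDimensional L).isClosedEmbedding_subtypeVal
  exact hemb.isCompact_preimage hK

theorem measurePreserving_translateMeasure (hL : IsRatSubspace Λ L) {v : E} (hv : v ∈ L) :
    MeasurePreserving (fun y => y + v) (translateMeasure Λ L x) (translateMeasure Λ L x) := by
  have := isAddHaarMeasure_latticeMeasure hL
  refine ⟨by fun_prop, ?_⟩
  have h1 : (fun y => y + v) ∘ (fun y : L => x + (y : E)) =
      (fun y : L => x + (y : E)) ∘ fun y => y + ⟨v, hv⟩ := by
    funext y
    simp [add_assoc]
  rw [translateMeasure, Measure.map_map (by fun_prop) (by fun_prop), h1,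
    ← Measure.map_map (by fun_prop) (by fun_prop), map_add_right_eq_self]

/-- The normalized measure of an affine subspace does not depend on the base point. -/
theorem translateMeasure_add (hL : IsRatSubspace Λ L) {v : E} (hv : v ∈ L) :
    translateMeasure Λ L (x + v) = translateMeasure Λ L x := by
  have := isAddHaarMeasure_latticeMeasure hL
  have h1 : (fun y : L => x + v + (y : E)) = (fun y : L => x + (y : E)) ∘ fun y => ⟨v, hv⟩ + y := by
    funext y
    simp [add_assoc]
  rw [translateMeasure, h1, ← Measure.map_map (by fun_prop) (by fun_prop),
    map_add_left_eq_self, translateMeasure]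

/-- A hyperplane not parallel to `L` meets `x + L` in a null set. -/
theorem translateMeasure_hyperplane (hL : IsRatSubspace Λ L) {η : StrongDual ℝ E} (c : ℝ) {u : E}
    (hu : u ∈ L) (hη : η u ≠ 0) : translateMeasure Λ L x {y | η y = c} = 0 := by
  have := isAddHaarMeasure_latticeMeasure hL
  rw [translateMeasure, (measurableEmbedding_add_subtype L x).map_apply]
  let f : L →ᵃ[ℝ] ℝ := (((η : E →ₗ[ℝ] ℝ) ∘ₗ L.subtype).toAffineMap) +
    AffineMap.const ℝ L (η x - c)
  have hf : ∀ y : L, f y = η (x + (y : E)) - c := by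
    intro y
    simp only [f, AffineMap.coe_add, Pi.add_apply, LinearMap.coe_toAffineMap, LinearMap.comp_apply,
      ContinuousLinearMap.coe_coe, Submodule.subtype_apply, AffineMap.const_apply, map_add]
    ring
  let s : AffineSubspace ℝ L := (AffineSubspace.mk' (0 : ℝ) ⊥).comap f
  have hs : ∀ y : L, y ∈ s ↔ η (x + (y : E)) = c := by
    intro y
    simp only [s, AffineSubspace.mem_comap, AffineSubspace.mem_mk', hf, vsub_eq_sub, sub_zero,
      Submodule.mem_bot, sub_eq_zero]
  have hset : (fun y : L => x + (y : E)) ⁻¹' {y | η y = c} = s := by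
    ext y
    exact (hs y).symm
  rw [hset]
  refine Measure.addHaar_affineSubspace _ s fun htop => hη ?_
  have h0 : η (x + ((0 : L) : E)) = c := (hs 0).1 (htop ▸ AffineSubspace.mem_top ℝ L 0)
  have h1 : η (x + ((⟨u, hu⟩ : L) : E)) = c := (hs _).1 (htop ▸ AffineSubspace.mem_top ℝ L _)
  rw [map_add] at h0 h1
  simp only [ZeroMemClass.coe_zero, map_zero] at h0
  linarith

theorem affineMeasure_eq {p : Set E} (hL : IsRatSubspace Λ (lin p)) (hx : x ∈ p) :
    affineMeasure Λ p = translateMeasure Λ (lin p) x := by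
  have hne : p.Nonempty := ⟨x, hx⟩
  rw [affineMeasure, dif_pos hne]
  have h := translateMeasure_add (x := x) hL (vsub_mem_vectorSpan ℝ hne.some_mem hx)
  rw [← h]
  simp [translateMeasure]

variable {p : Set E}

theorem isFiniteMeasureOnCompacts_affineMeasure (hL : IsRatSubspace Λ (lin p)) (hne : p.Nonempty) :
    IsFiniteMeasureOnCompacts (affineMeasure Λ p) := by
  rw [affineMeasure_eq hL hne.some_mem]
  exact isFiniteMeasureOnCompacts_translateMeasure hL

theorem latticeInvariant_affineMeasure (hL : IsRatSubspace Λ (lin p)) (hne : p.Nonempty) :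
    LatticeInvariant Λ (lin p) (affineMeasure Λ p) := by
  rw [affineMeasure_eq hL hne.some_mem]
  exact fun v _ hv => measurePreserving_translateMeasure hL hv

omit [DiscreteTopology Λ] in
theorem affineMeasure_domain (hp : IsIntPoly Λ p) :
    {ξ : StrongDual ℝ E | Integrable (fun x => chi p x * Real.exp (ξ x)) (affineMeasure Λ p)} =
      {ξ | IntegrableOn (fun x => Real.exp (ξ x)) p (affineMeasure Λ p)} := by
  ext ξ
  exact integrable_chi_mul_exp_iff hp.measurableSet

/-- For polyhedra, the function `I` is the transform with respect to the normalized measure. -/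
theorem I_hasTransform (hp : IsIntPoly Λ p) (hL : IsRatSubspace Λ (lin p)) (hne : p.Nonempty) :
    HasTransform (affineMeasure Λ p) (chi p) (I Λ p) := by
  have := isFiniteMeasureOnCompacts_affineMeasure hL hne
  have hν := latticeInvariant_affineMeasure hL hne
  by_cases hl : ContainsLine p
  · rw [I, dif_neg (fun h => h.1 hl)]
    exact hp.hasTransform_zero hν hl
  · obtain ⟨φ, hφ⟩ := hp.exists_hasTransform hν
    have h := affineMeasure_domain hp
    have hag := hφ.agreesOn.mono h.ge fun ξ _ => (expIntegral_chi hp.measurableSet ξ).symm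
    rw [I, dif_pos ⟨hl, φ, hag⟩]
    have hch := Exists.choose_spec (⟨φ, hag⟩ : ∃ φ : Mer E, AgreesOn φ
      {ξ | IntegrableOn (fun x => Real.exp (ξ x)) p (affineMeasure Λ p)}
      (fun ξ => ∫ x in p, Real.exp (ξ x) ∂(affineMeasure Λ p)))
    rwa [hp.agreesOn_unique hν hl (hch.mono h.le fun _ _ => rfl) (hag.mono h.le fun _ _ => rfl)]

theorem agreesOn_I (hp : IsIntPoly Λ p) (hL : IsRatSubspace Λ (lin p)) (hne : p.Nonempty) :
    AgreesOn (I Λ p) {ξ | IntegrableOn (fun x => Real.exp (ξ x)) p (affineMeasure Λ p)}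
      (fun ξ => ∫ x in p, Real.exp (ξ x) ∂(affineMeasure Λ p)) :=
  (I_hasTransform hp hL hne).agreesOn.mono (affineMeasure_domain hp).ge
    fun ξ _ => (expIntegral_chi hp.measurableSet ξ).symm

theorem integrableOn_exp_of_mem_negForms (hp : IsIntPoly Λ p) (hL : IsRatSubspace Λ (lin p))
    (hne : p.Nonempty) {ξ : StrongDual ℝ E} (hξ : ξ ∈ negForms p) :
    IntegrableOn (fun x => Real.exp (ξ x)) p (affineMeasure Λ p) :=
  have := isFiniteMeasureOnCompacts_affineMeasure hL hne
  hp.integrableOn_exp (latticeInvariant_affineMeasure hL hne) hξ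

end AffineMeasure

section

variable {E : Type*} [NormedAddCommGroup E] [InnerProductSpace ℝ E] [FiniteDimensional ℝ E]
  [MeasurableSpace E] [BorelSpace E] {Λ : Submodule ℤ E}

theorem I_eq_zero_of_containsLine {p : Set E} (hl : ContainsLine p) : I Λ p = 0 := by
  rw [I, dif_neg (fun h => h.1 hl)]

/-- The integral over a point. -/
theorem I_singleton [DiscreteTopology Λ] (x : E) : I Λ {x} = expMer x := by
  have hl : lin ({x} : Set E) = ⊥ := vectorSpan_singleton ℝ x
  have hrat : IsRatSubspace Λ (lin ({x} : Set E)) := by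
    rw [hl]
    exact bot_le
  have hm : affineMeasure Λ {x} = Measure.dirac x := by
    rw [affineMeasure_eq hrat rfl]
    obtain ⟨b, hb⟩ := exists_latticeBasis Λ hrat
    have hsub : Subsingleton (lin ({x} : Set E)) := by
      rw [hl]
      infer_instance
    have hpar : parallelepiped b = {0} := by
      ext y
      rw [Subsingleton.elim y 0]
      simp [mem_parallelepiped_iff]
      exact ⟨0, by simp, Subsingleton.elim _ _⟩
    have h1 : latticeMeasure Λ (lin ({x} : Set E)) = Measure.dirac 0 := by
      have h0 := b.addHaar_self
      rw [hpar, ← latticeMeasure_eq_addHaar b hb] at h0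
      ext s hs
      rw [Measure.dirac_apply' _ hs]
      rcases s.eq_empty_or_nonempty with rfl | ⟨y, hy⟩
      · simp
      · have : s = {0} := by
          ext z
          rw [Subsingleton.elim z y]
          exact ⟨fun _ => Subsingleton.elim y 0, fun _ => hy⟩
        rw [this, h0]
        simp
    rw [translateMeasure, h1, Measure.map_dirac' (measurableEmbedding_add_subtype _ x).measurable]
    simp
  have hfin : IsFiniteMeasureOnCompacts (affineMeasure Λ {x}) := by
    rw [hm]
    infer_instance
  have hag : AgreesOn (expMer x)
      {ξ | IntegrableOn (fun y => Real.exp (ξ y)) {x} (affineMeasure Λ {x})}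
      (fun ξ => ∫ y in {x}, Real.exp (ξ y) ∂(affineMeasure Λ {x})) := by
    refine (agreesOn_toMer (analyticAt_exp_pairing x) _).mono (Set.subset_univ _) fun ξ _ => ?_
    rw [hm]
    simp
  have hnl : ¬ ContainsLine ({x} : Set E) := by
    rintro ⟨y, v, hv, h⟩
    have h0 : y + (0 : ℝ) • v = x := h 0
    have h1 : y + (1 : ℝ) • v = x := h 1
    rw [zero_smul, add_zero] at h0
    rw [one_smul, h0, add_eq_left] at h1
    exact hv h1
  rw [I, dif_pos ⟨hnl, _, hag⟩]
  have hch := Exists.choose_spec (⟨_, hag⟩ : ∃ φ : Mer E, AgreesOn φ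
    {ξ | IntegrableOn (fun y => Real.exp (ξ y)) {x} (affineMeasure Λ {x})}
    (fun ξ => ∫ y in {x}, Real.exp (ξ y) ∂(affineMeasure Λ {x})))
  refine hch.unique hag (U := Set.univ) ?_ ?_ (subset_closure (by simp)) fun _ _ => rfl
  all_goals
    intro ξ _
    rw [hm]
    exact integrableOn_singleton

end

/-! ### Quotient lattices -/

section Quotient

variable {E : Type*} [NormedAddCommGroup E] [InnerProductSpace ℝ E] [FiniteDimensional ℝ E]
  {Λ : Submodule ℤ E} {L : Submodule ℝ E}

theorem sub_quotProj_mem (L : Submodule ℝ E) (x : E) : x - quotProj L x ∈ L := by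
  have := Lᗮ.sub_starProjection_mem_orthogonal x
  rwa [Submodule.orthogonal_orthogonal] at this

theorem quotProj_mem (L : Submodule ℝ E) (x : E) : quotProj L x ∈ Lᗮ :=
  Submodule.starProjection_apply_mem Lᗮ x

theorem quotProj_eq_self {x : E} (hx : x ∈ Lᗮ) : quotProj L x = x :=
  Submodule.starProjection_eq_self_iff.2 hx

theorem quotProj_eq_zero {x : E} (hx : x ∈ L) : quotProj L x = 0 := by
  rw [Submodule.starProjection_apply_eq_zero_iff]
  simpa using hx

/-- Characterization of the orthogonal projection modulo `L`. -/
theorem quotProj_eq_of_sub_mem {x y : E} (hy : y ∈ Lᗮ) (h : x - y ∈ L) : quotProj L x = y := by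
  have := quotProj_eq_zero h
  rw [map_sub, quotProj_eq_self hy, sub_eq_zero] at this
  exact this

theorem apply_quotProj {η : StrongDual ℝ E} (h : ∀ v ∈ L, η v = 0) (x : E) :
    η (quotProj L x) = η x := by
  have := h _ (sub_quotProj_mem L x)
  rw [map_sub] at this
  linarith

theorem mem_quotLattice {x : E} : x ∈ quotLattice Λ L ↔ ∃ y ∈ Λ, quotProj L y = x := Iff.rfl

theorem span_quotLattice (hL : L ≤ Submodule.span ℝ (Λ : Set E)) :
    Submodule.span ℝ (quotLattice Λ L : Set E) = Submodule.span ℝ (Λ : Set E) ⊓ Lᗮ := by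
  have h1 : Submodule.span ℝ (quotLattice Λ L : Set E) =
      (Submodule.span ℝ (Λ : Set E)).map (quotProj L : E →ₗ[ℝ] E) := by
    rw [Submodule.map_span]
    rfl
  rw [h1]
  ext x
  refine ⟨?_, fun hx => ⟨x, hx.1, quotProj_eq_self hx.2⟩⟩
  rintro ⟨y, hy, rfl⟩
  refine ⟨?_, quotProj_mem L y⟩
  have := sub_mem hy (hL (sub_quotProj_mem L y))
  rwa [sub_sub_cancel] at this

theorem quotProj_bot (x : E) : quotProj (⊥ : Submodule ℝ E) x = x :=
  quotProj_eq_self (by simp)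

theorem quotLattice_bot : quotLattice Λ ⊥ = Λ := by
  ext x
  rw [mem_quotLattice]
  simp only [quotProj_bot, exists_eq_right]

theorem IntegralOn.quotLattice {η : StrongDual ℝ E} (h : IntegralOn Λ η) (hL : ∀ v ∈ L, η v = 0) :
    IntegralOn (quotLattice Λ L) η := by
  rintro _ ⟨y, hy, rfl⟩
  obtain ⟨n, hn⟩ := h y hy
  exact ⟨n, (apply_quotProj hL y).trans hn⟩

end Quotient

section Discreteness

variable {E : Type*} [NormedAddCommGroup E] [NormedSpace ℝ E] {ι : Type*}
  {η : ι → StrongDual ℝ E} {A : Finset ι}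

/-- A group is discrete if finitely many linear forms that are integral on it separate the points
of its span. -/
theorem discreteTopology_of_dirs_eq_bot {Γ : Submodule ℤ E} (hA : ∀ i ∈ A, IntegralOn Γ (η i))
    (h : dirs Γ η A = ⊥) : DiscreteTopology Γ := by
  refine discreteTopology_of_isOpen_singleton_zero ?_
  have h1 : ({0} : Set Γ) = ⋂ i ∈ A, {x : Γ | |η i x| < 1} := by
    ext x
    simp only [Set.mem_singleton_iff, Set.mem_iInter, Set.mem_ofPred_eq]
    refine ⟨fun hx i _ => by simp [hx], fun hx => ?_⟩
    have : (x : E) ∈ dirs Γ η A := by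
      refine ⟨mem_span_of_mem x.2, fun i hi => ?_⟩
      obtain ⟨n, hn⟩ := hA i hi x x.2
      have h2 := hx i hi
      rw [hn] at h2 ⊢
      have h3 : |n| < 1 := by exact_mod_cast h2
      rw [Int.abs_lt_one_iff.1 h3, Int.cast_zero]
    rw [h, Submodule.mem_bot] at this
    exact Subtype.ext this
  rw [h1]
  exact isOpen_biInter_finset fun i _ => isOpen_lt (by fun_prop) continuous_const

end Discreteness

/-! ### Faces and transverse cones of polyhedra -/

section Faces

variable {E : Type*} [NormedAddCommGroup E] [NormedSpace ℝ E] {ι : Type*}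

open scoped Classical in
/-- The inequalities that are equalities at `x`. -/
noncomputable def actIneq (η : ι → StrongDual ℝ E) (c : ι → ℝ) (H : Finset ι) (x : E) : Finset ι :=
  H.filter fun i => η i x = c i

/-- The points of the polyhedron at which all inequalities in `A` are equalities. -/
def face (Λ : Submodule ℤ E) (η : ι → StrongDual ℝ E) (c : ι → ℝ) (H A : Finset ι) : Set E :=
  {x | x ∈ poly Λ η c H ∧ ∀ i ∈ A, η i x = c i}

open scoped Classical in
/-- The sets of active inequalities of the points of a polyhedron.  They correspond to its faces. -/
noncomputable def actSets (Λ : Submodule ℤ E) (η : ι → StrongDual ℝ E) (c : ι → ℝ)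
    (H : Finset ι) : Finset (Finset ι) :=
  H.powerset.filter fun A => ∃ x ∈ poly Λ η c H, actIneq η c H x = A

variable {Λ : Submodule ℤ E} {η : ι → StrongDual ℝ E} {c : ι → ℝ} {H A B : Finset ι} {x v : E}

theorem mem_actIneq {i : ι} : i ∈ actIneq η c H x ↔ i ∈ H ∧ η i x = c i := by
  simp [actIneq]

theorem actIneq_subset : actIneq η c H x ⊆ H := fun _ hi => (mem_actIneq.1 hi).1

theorem mem_actSets : A ∈ actSets Λ η c H ↔ ∃ x ∈ poly Λ η c H, actIneq η c H x = A := by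
  simp only [actSets, Finset.mem_filter, Finset.mem_powerset, and_iff_right_iff_imp]
  rintro ⟨x, -, rfl⟩
  exact actIneq_subset

theorem subset_of_mem_actSets (hA : A ∈ actSets Λ η c H) : A ⊆ H := by
  obtain ⟨x, -, rfl⟩ := mem_actSets.1 hA
  exact actIneq_subset

theorem mem_face : x ∈ face Λ η c H A ↔ x ∈ poly Λ η c H ∧ ∀ i ∈ A, η i x = c i := Iff.rfl

theorem mem_face_iff_subset (hA : A ⊆ H) (hx : x ∈ poly Λ η c H) :
    x ∈ face Λ η c H A ↔ A ⊆ actIneq η c H x :=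
  ⟨fun h i hi => mem_actIneq.2 ⟨hA hi, h.2 i hi⟩,
    fun h => ⟨hx, fun _ hi => (mem_actIneq.1 (h hi)).2⟩⟩

theorem mem_face_actIneq (hx : x ∈ poly Λ η c H) : x ∈ face Λ η c H (actIneq η c H x) :=
  ⟨hx, fun _ hi => (mem_actIneq.1 hi).2⟩

theorem face_nonempty (hA : A ∈ actSets Λ η c H) : (face Λ η c H A).Nonempty := by
  obtain ⟨x, hx, rfl⟩ := mem_actSets.1 hA
  exact ⟨x, mem_face_actIneq hx⟩

theorem face_injOn : Set.InjOn (face Λ η c H) (actSets Λ η c H : Set (Finset ι)) := by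
  have key : ∀ A ∈ actSets Λ η c H, ∀ B ∈ actSets Λ η c H, face Λ η c H A = face Λ η c H B →
      B ⊆ A := by
    intro A hA B hB h
    obtain ⟨x, hx, rfl⟩ := mem_actSets.1 hA
    exact (mem_face_iff_subset (subset_of_mem_actSets hB) hx).1 (h ▸ mem_face_actIneq hx)
  exact fun A hA B hB h => (key B hB A hA h.symm).antisymm (key A hA B hB h)

theorem convex_poly : Convex ℝ (poly Λ η c H) := by
  intro x hx y hy a b ha hb hab
  refine ⟨add_mem (Submodule.smul_mem _ _ hx.1) (Submodule.smul_mem _ _ hy.1), fun i hi => ?_⟩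
  rw [map_add, map_smul, map_smul, smul_eq_mul, smul_eq_mul]
  calc a * η i x + b * η i y ≤ a * c i + b * c i :=
        add_le_add (mul_le_mul_of_nonneg_left (hx.2 i hi) ha)
          (mul_le_mul_of_nonneg_left (hy.2 i hi) hb)
    _ = c i := by rw [← add_mul, hab, one_mul]

theorem convex_face : Convex ℝ (face Λ η c H A) := by
  intro x hx y hy a b ha hb hab
  refine ⟨convex_poly hx.1 hy.1 ha hb hab, fun i hi => ?_⟩
  rw [map_add, map_smul, map_smul, hx.2 i hi, hy.2 i hi, ← add_smul, hab, one_smul]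

/-- The feasible directions at a point of a polyhedron are given by the active inequalities. -/
theorem eventually_add_smul_mem (hx : x ∈ poly Λ η c H)
    (hv : v ∈ poly Λ η 0 (actIneq η c H x)) : ∀ᶠ ε : ℝ in 𝓝[>] 0, x + ε • v ∈ poly Λ η c H := by
  have h : ∀ᶠ ε : ℝ in 𝓝[>] 0, ∀ i ∈ H, η i (x + ε • v) ≤ c i := by
    refine (Filter.eventually_all_finset H).2 fun i hi => ?_
    by_cases hi' : i ∈ actIneq η c H x
    · filter_upwards [self_mem_nhdsWithin] with ε hε
      have h1 : η i v ≤ 0 := hv.2 i hi'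
      rw [map_add, map_smul, (mem_actIneq.1 hi').2, smul_eq_mul]
      linarith [mul_nonpos_of_nonneg_of_nonpos (le_of_lt hε) h1]
    · have hlt : η i x < c i := lt_of_le_of_ne (hx.2 i hi) fun h => hi' (mem_actIneq.2 ⟨hi, h⟩)
      have hc : ContinuousAt (fun ε : ℝ => η i (x + ε • v)) 0 := by fun_prop
      refine nhdsWithin_le_nhds ((hc.eventually_lt continuousAt_const ?_).mono fun _ h => h.le)
      simpa using hlt
  filter_upwards [h] with ε hε
  exact ⟨add_mem hx.1 (Submodule.smul_mem _ _ hv.1), hε⟩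

theorem mem_poly_of_frequently (hx : x ∈ Submodule.span ℝ (Λ : Set E))
    (hA : ∀ i ∈ A, η i x = c i) (hAH : A ⊆ H)
    (h : ∃ᶠ ε : ℝ in 𝓝[>] 0, x + ε • v ∈ poly Λ η c H) : v ∈ poly Λ η 0 A := by
  obtain ⟨ε, hmem, hε⟩ := (h.and_eventually self_mem_nhdsWithin).exists
  have hε : 0 < ε := hε
  refine ⟨?_, fun i hi => ?_⟩
  · have := sub_mem hmem.1 hx
    rw [add_sub_cancel_left] at this
    exact (Submodule.smul_mem_iff _ hε.ne').1 this
  · have := hmem.2 i (hAH hi)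
    rw [map_add, map_smul, hA i hi, smul_eq_mul] at this
    exact nonpos_of_mul_nonpos_right (by linarith) hε

theorem eventually_add_smul_mem_face (hx : x ∈ poly Λ η c H)
    (hv : v ∈ dirs Λ η (actIneq η c H x)) :
    ∀ᶠ ε : ℝ in 𝓝[>] 0, x + ε • v ∈ face Λ η c H (actIneq η c H x) := by
  filter_upwards [eventually_add_smul_mem hx ⟨hv.1, fun i hi => (hv.2 i hi).le⟩] with ε hε
  refine ⟨hε, fun i hi => ?_⟩
  rw [map_add, map_smul, hv.2 i hi, smul_zero, add_zero, (mem_actIneq.1 hi).2]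

/-- The directions of the face with active inequalities `A` are the solutions of the homogeneous
equations in `A`. -/
theorem lin_face (hA : A ∈ actSets Λ η c H) : vectorSpan ℝ (face Λ η c H A) = dirs Λ η A := by
  obtain ⟨x, hx, rfl⟩ := mem_actSets.1 hA
  refine le_antisymm (Submodule.span_le.2 ?_) fun v hv => ?_
  · rintro _ ⟨y, hy, z, hz, rfl⟩
    refine ⟨sub_mem hy.1.1 hz.1.1, fun i hi => ?_⟩
    change η i (y - z) = 0
    rw [map_sub, hy.2 i hi, hz.2 i hi, sub_self]
  · obtain ⟨ε, hmem, hε⟩ :=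
      ((eventually_add_smul_mem_face hx hv).and self_mem_nhdsWithin).exists
    have := vsub_mem_vectorSpan ℝ hmem (mem_face_actIneq hx)
    rw [vsub_eq_sub, add_sub_cancel_left] at this
    exact (Submodule.smul_mem_iff _ (ne_of_gt hε)).1 this

theorem isExposed_face (hA : A ∈ actSets Λ η c H) :
    IsExposed ℝ (poly Λ η c H) (face Λ η c H A) := by
  have hAH := subset_of_mem_actSets hA
  intro hne
  obtain ⟨x, hx⟩ := hne
  refine ⟨∑ i ∈ A, η i, ?_⟩
  have hle : ∀ y ∈ poly Λ η c H, ∀ i ∈ A, η i y ≤ c i := fun y hy i hi => hy.2 i (hAH hi)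
  ext z
  simp only [Set.mem_ofPred_eq, sum_apply]
  refine ⟨fun hz => ⟨hz.1, fun y hy => ?_⟩, fun hz => ⟨hz.1, ?_⟩⟩
  · rw [Finset.sum_congr rfl hz.2]
    exact Finset.sum_le_sum (hle y hy)
  · have h1 := hz.2 x hx.1
    rw [Finset.sum_congr rfl hx.2] at h1
    exact (Finset.sum_eq_sum_iff_of_le (hle z hz.1)).1
      (le_antisymm (Finset.sum_le_sum (hle z hz.1)) h1)

/-- An exposed face is determined by the inequalities active at one of its points with the smallest
number of active inequalities. -/
theorem exists_actSets_of_isExposed {f : Set E} (hne : f.Nonempty)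
    (hf : IsExposed ℝ (poly Λ η c H) f) : ∃ A ∈ actSets Λ η c H, face Λ η c H A = f := by
  classical
  obtain ⟨l, hl⟩ := hf hne
  -- minimality of `x`, applied to the midpoint of `x` and `y`, shows that the inequalities active
  -- at `x` are active at `y`
  obtain ⟨x, hx, hmin⟩ : ∃ x ∈ f, ∀ y ∈ f, (actIneq η c H x).card ≤ (actIneq η c H y).card := by
    have hex : ∃ n, ∃ x ∈ f, (actIneq η c H x).card = n := ⟨_, hne.some, hne.some_mem, rfl⟩
    obtain ⟨x, hx, hn⟩ := Nat.find_spec hex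
    exact ⟨x, hx, fun y hy => hn ▸ Nat.find_min' hex ⟨y, hy, rfl⟩⟩
  have hfx : ∀ y ∈ f, y ∈ poly Λ η c H ∧ ∀ z ∈ poly Λ η c H, l z ≤ l y := fun y hy => by
    rw [hl] at hy
    exact hy
  have hsub : ∀ y ∈ f, actIneq η c H x ⊆ actIneq η c H y := by
    intro y hy
    have hz : (1 / 2 : ℝ) • x + (1 / 2 : ℝ) • y ∈ poly Λ η c H :=
      convex_poly (hfx x hx).1 (hfx y hy).1 (by norm_num) (by norm_num) (by norm_num)
    have hzf : (1 / 2 : ℝ) • x + (1 / 2 : ℝ) • y ∈ f := by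
      rw [hl]
      refine ⟨hz, fun w hw => ?_⟩
      rw [map_add, map_smul, map_smul, smul_eq_mul, smul_eq_mul]
      linarith [(hfx x hx).2 w hw, (hfx y hy).2 w hw]
    have hact : actIneq η c H ((1 / 2 : ℝ) • x + (1 / 2 : ℝ) • y) ⊆
        actIneq η c H x ∩ actIneq η c H y := by
      intro i hi
      obtain ⟨hiH, hi⟩ := mem_actIneq.1 hi
      rw [map_add, map_smul, map_smul, smul_eq_mul, smul_eq_mul] at hi
      have h1 := (hfx x hx).1.2 i hiH
      have h2 := (hfx y hy).1.2 i hiH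
      exact Finset.mem_inter.2 ⟨mem_actIneq.2 ⟨hiH, by linarith⟩, mem_actIneq.2 ⟨hiH, by linarith⟩⟩
    have h1 := (hmin _ hzf).trans (Finset.card_le_card hact)
    have h2 := Finset.eq_of_subset_of_card_le Finset.inter_subset_left h1
    exact Finset.inter_eq_left.1 h2
  refine ⟨_, mem_actSets.2 ⟨x, (hfx x hx).1, rfl⟩, ?_⟩
  ext y
  refine ⟨fun hy => ?_, fun hy => ⟨(hfx y hy).1, fun i hi => (mem_actIneq.1 (hsub y hy hi)).2⟩⟩
  have hdir : x - y ∈ poly Λ η 0 (actIneq η c H x) := by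
    refine ⟨sub_mem (hfx x hx).1.1 hy.1.1, fun i hi => ?_⟩
    rw [map_sub, hy.2 i hi, (mem_actIneq.1 hi).2, sub_self, Pi.zero_apply]
  -- moving from `x` away from `y` stays in the polyhedron, so `l` is not larger at `x` than at `y`
  obtain ⟨ε, hmem, hε⟩ := ((eventually_add_smul_mem (hfx x hx).1 hdir).and
    self_mem_nhdsWithin).exists
  have hε : 0 < ε := hε
  have h1 := (hfx x hx).2 _ hmem
  rw [map_add, map_smul, map_sub, smul_eq_mul] at h1
  have h2 : l x ≤ l y := by
    by_contra h
    have := mul_pos hε (sub_pos.2 (not_le.1 h))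
    linarith
  rw [hl]
  exact ⟨hy.1, fun z hz => ((hfx x hx).2 z hz).trans h2⟩

end Faces

section FacesInner

variable {E : Type*} [NormedAddCommGroup E] [InnerProductSpace ℝ E] [FiniteDimensional ℝ E]
  {ι : Type*} {Λ : Submodule ℤ E} {η : ι → StrongDual ℝ E} {c : ι → ℝ} {H A : Finset ι}

omit [FiniteDimensional ℝ E] in
/-- The faces of a polyhedron correspond to the sets of active inequalities of its points. -/
theorem faces_poly : faces (poly Λ η c H) = face Λ η c H '' (actSets Λ η c H : Set (Finset ι)) := by
  ext f
  constructor
  · rintro ⟨hne, hf⟩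
    exact exists_actSets_of_isExposed hne hf
  · rintro ⟨A, hA, rfl⟩
    exact ⟨face_nonempty hA, isExposed_face hA⟩

/-- The feasible directions at a relative interior point of a face are those that satisfy the
homogeneous inequalities active on the whole face. -/
theorem feasibleCone_face (hA : A ∈ actSets Λ η c H) :
    feasibleCone (poly Λ η c H) (face Λ η c H A) = poly Λ η 0 A := by
  ext v
  constructor
  · rintro ⟨y, hy, hv⟩
    have hyf := intrinsicInterior_subset hy
    exact mem_poly_of_frequently hyf.1.1 hyf.2 (subset_of_mem_actSets hA) hv.frequently
  · intro hv
    obtain ⟨y, hy⟩ := (face_nonempty hA).intrinsicInterior convex_face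
    refine ⟨y, hy, ?_⟩
    have hyf := intrinsicInterior_subset hy
    obtain ⟨x, hx, rfl⟩ := mem_actSets.1 hA
    have hxf := mem_face_actIneq hx
    -- moving from `x` slightly beyond `y` does not leave the face
    have hbeyond : ∀ᶠ ε : ℝ in 𝓝 0, AffineMap.lineMap y x ε ∈
        face Λ η c H (actIneq η c H x) := by
      obtain ⟨z, hz, rfl⟩ := mem_intrinsicInterior.1 hy
      have hmem : ∀ ε : ℝ, AffineMap.lineMap (z : E) x ε ∈
          affineSpan ℝ (face Λ η c H (actIneq η c H x)) := fun ε =>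
        AffineMap.lineMap_mem ε z.2 (subset_affineSpan ℝ _ hxf)
      let γ : ℝ → affineSpan ℝ (face Λ η c H (actIneq η c H x)) := fun ε => ⟨_, hmem ε⟩
      have hγ : Continuous γ := (AffineMap.lineMap_continuous).subtype_mk hmem
      have h0 : γ 0 = z := Subtype.ext (AffineMap.lineMap_apply_zero _ _)
      have : γ ⁻¹' interior ((↑) ⁻¹' face Λ η c H (actIneq η c H x)) ∈ 𝓝 0 :=
        hγ.continuousAt.preimage_mem_nhds (by rw [h0]; exact isOpen_interior.mem_nhds hz)
      filter_upwards [this] with ε hε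
      have hmem : γ ε ∈ (Subtype.val ⁻¹' face Λ η c H (actIneq η c H x) :
          Set (affineSpan ℝ (face Λ η c H (actIneq η c H x)))) := interior_subset hε
      exact hmem
    have hneg : Filter.Tendsto (fun ε : ℝ => -ε) (𝓝[>] 0) (𝓝 0) := by
      have : Filter.Tendsto (fun ε : ℝ => -ε) (𝓝 0) (𝓝 (-0)) := (continuous_neg).tendsto 0
      rw [neg_zero] at this
      exact this.mono_left nhdsWithin_le_nhds
    obtain ⟨ε, hmem, hε⟩ := ((hneg.eventually hbeyond).and self_mem_nhdsWithin).exists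
    have hε : 0 < ε := hε
    have hact : actIneq η c H y ⊆ actIneq η c H x := by
      intro i hi
      obtain ⟨hiH, hi⟩ := mem_actIneq.1 hi
      refine mem_actIneq.2 ⟨hiH, le_antisymm (hx.2 i hiH) ?_⟩
      have h1 := hmem.1.2 i hiH
      rw [AffineMap.lineMap_apply, vsub_eq_sub, vadd_eq_add, map_add, map_smul, map_sub, hi,
        smul_eq_mul] at h1
      by_contra hlt
      have := mul_pos hε (sub_pos.2 (not_le.1 hlt))
      linarith
    exact eventually_add_smul_mem hyf.1 ⟨hv.1, fun i hi => hv.2 i (hact hi)⟩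

omit [FiniteDimensional ℝ E] in
theorem dirs_le_span_lattice : dirs Λ η A ≤ Submodule.span ℝ (Λ : Set E) := fun _ hx => hx.1

/-- The transverse cone along a face is given by the inequalities active on that face. -/
theorem transverseCone_face (hA : A ∈ actSets Λ η c H) :
    transverseCone (poly Λ η c H) (face Λ η c H A) =
      poly (quotLattice Λ (dirs Λ η A)) η c A := by
  have hlin : lin (face Λ η c H A) = dirs Λ η A := lin_face hA
  have hη : ∀ i ∈ A, ∀ v ∈ dirs Λ η A, η i v = 0 := fun i hi v hv => hv.2 i hi
  obtain ⟨x, hx⟩ := face_nonempty hA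
  rw [transverseCone, feasibleCone_face hA, hlin]
  ext z
  constructor
  · rintro ⟨_, ⟨y, hy, v, hv, rfl⟩, rfl⟩
    have hyx : y - x ∈ dirs Λ η A := by
      have := AffineSubspace.vsub_mem_direction hy (subset_affineSpan ℝ _ hx)
      rwa [direction_affineSpan, lin_face hA] at this
    have hmem : y + v ∈ Submodule.span ℝ (Λ : Set E) := by
      refine add_mem ?_ hv.1
      have := add_mem hyx.1 hx.1.1
      rwa [sub_add_cancel] at this
    refine ⟨?_, fun i hi => ?_⟩
    · rw [span_quotLattice dirs_le_span_lattice]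
      refine ⟨?_, quotProj_mem _ _⟩
      have := sub_mem hmem (dirs_le_span_lattice (sub_quotProj_mem (dirs Λ η A) (y + v)))
      rwa [sub_sub_cancel] at this
    · simp only
      rw [apply_quotProj (hη i hi), map_add]
      have h1 : η i (y - x) = 0 := hyx.2 i hi
      have h2 : η i v ≤ 0 := hv.2 i hi
      rw [map_sub, hx.2 i hi] at h1
      linarith
  · rintro ⟨hz, hzA⟩
    rw [span_quotLattice dirs_le_span_lattice] at hz
    refine ⟨x + (z - x), ⟨x, subset_affineSpan ℝ _ hx, z - x, ⟨sub_mem hz.1 hx.1.1, ?_⟩, rfl⟩, ?_⟩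
    · intro i hi
      rw [map_sub, hx.2 i hi, Pi.zero_apply, sub_nonpos]
      exact hzA i hi
    · rw [add_sub_cancel]
      exact quotProj_eq_self hz.2

theorem dirs_quotLattice : dirs (quotLattice Λ (dirs Λ η A)) η A = ⊥ := by
  rw [Submodule.eq_bot_iff]
  intro x hx
  have h1 := hx.1
  rw [span_quotLattice dirs_le_span_lattice] at h1
  have h2 : x ∈ dirs Λ η A := ⟨h1.1, hx.2⟩
  exact inner_self_eq_zero.1 (h1.2 x h2)

theorem integralOn_quotLattice_dirs (hA : ∀ i ∈ A, IntegralOn Λ (η i)) :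
    ∀ i ∈ A, IntegralOn (quotLattice Λ (dirs Λ η A)) (η i) :=
  fun i hi => (hA i hi).quotLattice fun _ hv => hv.2 i hi

/-- The projection of a lattice along a face is a lattice. -/
theorem discreteTopology_quotLattice (hA : ∀ i ∈ A, IntegralOn Λ (η i)) :
    DiscreteTopology (quotLattice Λ (dirs Λ η A)) :=
  discreteTopology_of_dirs_eq_bot (integralOn_quotLattice_dirs hA) dirs_quotLattice

omit [FiniteDimensional ℝ E] in
theorem isRatSubspace_lin_face (hH : ∀ i ∈ H, IntegralOn Λ (η i)) (hA : A ∈ actSets Λ η c H) :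
    IsRatSubspace Λ (lin (face Λ η c H A)) := by
  rw [lin, lin_face hA]
  exact dirs_le_span fun i hi => hH i (subset_of_mem_actSets hA hi)

omit [FiniteDimensional ℝ E] in
theorem isIntPoly_face (hH : ∀ i ∈ H, IntegralOn Λ (η i)) (hA : A ⊆ H) :
    IsIntPoly Λ (face Λ η c H A) := by
  have h1 : face Λ η c H A =
      poly Λ η c H ∩ poly Λ (fun i => -η i) (fun i => -c i) A := by
    ext x
    simp only [mem_face, Set.mem_inter_iff, mem_poly, neg_apply, neg_le_neg_iff]
    exact ⟨fun h => ⟨h.1, h.1.1, fun i hi => (h.2 i hi).ge⟩,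
      fun h => ⟨h.1, fun i hi => le_antisymm (h.1.2 i (hA hi)) (h.2.2 i hi)⟩⟩
  rw [h1]
  exact (isIntPoly_poly hH).inter (isIntPoly_poly fun i hi => (hH i (hA hi)).neg)

end FacesInner

/-! ### The local formula for cones with a common vertex -/

section Tangent

variable {E : Type*} [NormedAddCommGroup E] [InnerProductSpace ℝ E] [FiniteDimensional ℝ E]
  {ι κ : Type*} {Λ : Submodule ℤ E} {η : ι → StrongDual ℝ E} {c : ι → ℝ} {H A : Finset ι}
  {L : Submodule ℝ E}

open scoped Classical in
/-- A linear relation between indicator functions of polyhedra passes to their tangent cones at a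
point. -/
theorem sum_chi_tangent {K : Finset κ} {H : κ → Finset ι} {r : κ → ℝ}
    (h0 : ∀ x, ∑ k ∈ K, r k * chi (poly Λ η c (H k)) x = 0) {x : E}
    (hx : x ∈ Submodule.span ℝ (Λ : Set E)) (z : E) :
    ∑ k ∈ K with x ∈ poly Λ η c (H k), r k * chi (poly Λ η c (actIneq η c (H k) x)) z = 0 := by
  by_cases hz : z ∈ Submodule.span ℝ (Λ : Set E)
  swap
  · refine Finset.sum_eq_zero fun k _ => ?_
    rw [chi, Set.indicator_of_notMem (fun h => hz h.1), mul_zero]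
  have h1 : ∀ᶠ ε : ℝ in 𝓝[>] 0, ∀ k ∈ K, r k * chi (poly Λ η c (H k)) (x + ε • (z - x)) =
      if x ∈ poly Λ η c (H k) then r k * chi (poly Λ η c (actIneq η c (H k) x)) z else 0 := by
    refine (Filter.eventually_all_finset K).2 fun k _ => ?_
    by_cases hk : x ∈ poly Λ η c (H k)
    · have hiff : z - x ∈ poly Λ η 0 (actIneq η c (H k) x) ↔
          z ∈ poly Λ η c (actIneq η c (H k) x) := by
        simp only [mem_poly, Submodule.sub_mem_iff_left _ hx, map_sub, Pi.zero_apply, sub_nonpos]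
        refine and_congr_right fun _ => forall₂_congr fun i hi => ?_
        rw [(mem_actIneq.1 hi).2]
      by_cases hz' : z ∈ poly Λ η c (actIneq η c (H k) x)
      · filter_upwards [eventually_add_smul_mem hk (hiff.2 hz')] with ε hε
        rw [if_pos hk, chi, chi, Set.indicator_of_mem hε, Set.indicator_of_mem hz']
      · have h2 : ∀ᶠ ε : ℝ in 𝓝[>] 0, x + ε • (z - x) ∉ poly Λ η c (H k) := by
          by_contra h
          exact hz' (hiff.1 (mem_poly_of_frequently hx (fun i hi => (mem_actIneq.1 hi).2)
            actIneq_subset h))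
        filter_upwards [h2] with ε hε
        rw [if_pos hk, chi, chi, Set.indicator_of_notMem hε, Set.indicator_of_notMem hz']
    · have hcont : ContinuousAt (fun ε : ℝ => x + ε • (z - x)) 0 := by fun_prop
      have hopen : (poly Λ η c (H k))ᶜ ∈ 𝓝 (x + (0 : ℝ) • (z - x)) := by
        rw [zero_smul, add_zero]
        exact isClosed_poly.isOpen_compl.mem_nhds hk
      filter_upwards [nhdsWithin_le_nhds (hcont.preimage_mem_nhds hopen)] with ε hε
      rw [if_neg hk, chi, Set.indicator_of_notMem hε, mul_zero]
  obtain ⟨ε, hε⟩ := h1.exists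
  rw [Finset.sum_filter, ← Finset.sum_congr rfl hε]
  exact h0 _

/-- If some direction outside `L` is tangent to the face of the inequalities in `A`, then the
polyhedron given by these inequalities in the quotient by `L` contains a line. -/
theorem containsLine_quotLattice (hL : L ≤ dirs Λ η A) (hne : dirs Λ η A ≠ L) {x : E}
    (hx : x ∈ poly Λ η c A) : ContainsLine (poly (quotLattice Λ L) η c A) := by
  have hLs : L ≤ Submodule.span ℝ (Λ : Set E) := hL.trans dirs_le_span_lattice
  have hη : ∀ i ∈ A, ∀ v ∈ L, η i v = 0 := fun i hi v hv => (hL hv).2 i hi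
  have hspan : ∀ y ∈ Submodule.span ℝ (Λ : Set E),
      quotProj L y ∈ Submodule.span ℝ (quotLattice Λ L : Set E) := by
    intro y hy
    rw [span_quotLattice hLs]
    refine ⟨?_, quotProj_mem L y⟩
    have := sub_mem hy (hLs (sub_quotProj_mem L y))
    rwa [sub_sub_cancel] at this
  have hne' : (poly (quotLattice Λ L) η c A).Nonempty :=
    ⟨quotProj L x, hspan x hx.1, fun i hi => by rw [apply_quotProj (hη i hi)]; exact hx.2 i hi⟩
  rw [containsLine_poly_iff hne']
  intro hbot
  refine hne (le_antisymm (fun v hv => ?_) hL)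
  have h1 : quotProj L v ∈ dirs (quotLattice Λ L) η A :=
    ⟨hspan v hv.1, fun i hi => by rw [apply_quotProj (hη i hi)]; exact hv.2 i hi⟩
  rw [hbot, Submodule.mem_bot] at h1
  have := sub_quotProj_mem L v
  rwa [h1, sub_zero] at this

end Tangent

section LocalFormula

variable {E : Type*} [NormedAddCommGroup E] [InnerProductSpace ℝ E] [FiniteDimensional ℝ E]
  [MeasurableSpace E] [BorelSpace E]
  {ι κ : Type*} {Λ : Submodule ℤ E} {η : ι → StrongDual ℝ E} {c : ι → ℝ} {H A : Finset ι}
  {L : Submodule ℝ E}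

theorem mu_eq_zero_of_containsLine {a : Set E} (h : ContainsLine a) : mu Λ a = 0 := by
  rw [mu, if_pos h]

/-- The function `μ` of the transverse cone of a polyhedron along its face with set of active
inequalities `A`. -/
noncomputable def muFace (Λ : Submodule ℤ E) (η : ι → StrongDual ℝ E) (c : ι → ℝ) (A : Finset ι) :
    Mer E :=
  mu (quotLattice Λ (dirs Λ η A)) (poly (quotLattice Λ (dirs Λ η A)) η c A)

/-- The sum over the faces in the local formula. -/
theorem finsum_faces_poly :
    ∑ᶠ f ∈ faces (poly Λ η c H), mu (quotLattice Λ (lin f)) (transverseCone (poly Λ η c H) f) *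
      I Λ f = ∑ A ∈ actSets Λ η c H, muFace Λ η c A * I Λ (face Λ η c H A) := by
  rw [faces_poly, finsum_mem_image face_injOn, finsum_mem_coe_finset]
  refine Finset.sum_congr rfl fun A hA => ?_
  rw [transverseCone_face hA, lin, lin_face hA, muFace]

theorem muFace_of_dirs_eq_bot (h : dirs Λ η A = ⊥) : muFace Λ η c A = mu Λ (poly Λ η c A) := by
  rw [muFace, h, quotLattice_bot]

section Vertex

variable {s : E} (hs : s ∈ Submodule.span ℝ (Λ : Set E)) (hsH : ∀ i ∈ H, η i s = c i)
include hs hsH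

omit [FiniteDimensional ℝ E] [MeasurableSpace E] [BorelSpace E] in
theorem mem_poly_of_forall_eq : s ∈ poly Λ η c H := ⟨hs, fun i hi => (hsH i hi).le⟩

omit [FiniteDimensional ℝ E] [MeasurableSpace E] [BorelSpace E] hs in
theorem actIneq_of_forall_eq : actIneq η c H s = H :=
  actIneq_subset.antisymm fun i hi => mem_actIneq.2 ⟨hi, hsH i hi⟩

omit [FiniteDimensional ℝ E] [MeasurableSpace E] [BorelSpace E] in
theorem self_mem_actSets : H ∈ actSets Λ η c H :=
  mem_actSets.2 ⟨s, mem_poly_of_forall_eq hs hsH, actIneq_of_forall_eq hsH⟩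

omit [FiniteDimensional ℝ E] [MeasurableSpace E] [BorelSpace E] in
/-- The only face of dimension `0` of a cone is its vertex. -/
theorem eq_of_dirs_eq_bot (hA : A ∈ actSets Λ η c H) (h : dirs Λ η A = ⊥) : A = H := by
  obtain ⟨x, hx, rfl⟩ := mem_actSets.1 hA
  have : x - s ∈ dirs Λ η (actIneq η c H x) := by
    refine ⟨sub_mem hx.1 hs, fun i hi => ?_⟩
    obtain ⟨hiH, hi⟩ := mem_actIneq.1 hi
    rw [map_sub, hi, hsH i hiH, sub_self]
  rw [h, Submodule.mem_bot, sub_eq_zero] at this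
  rw [this]
  exact actIneq_of_forall_eq hsH

omit [FiniteDimensional ℝ E] [MeasurableSpace E] [BorelSpace E] in
theorem face_self (h : dirs Λ η H = ⊥) : face Λ η c H H = {s} := by
  ext x
  rw [Set.mem_singleton_iff]
  constructor
  · intro hx
    have : x - s ∈ dirs Λ η H :=
      ⟨sub_mem hx.1.1 hs, fun i hi => by rw [map_sub, hx.2 i hi, hsH i hi, sub_self]⟩
    rwa [h, Submodule.mem_bot, sub_eq_zero] at this
  · rintro rfl
    exact ⟨mem_poly_of_forall_eq hs hsH, hsH⟩

omit [FiniteDimensional ℝ E] [MeasurableSpace E] [BorelSpace E] in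
/-- The only extreme point of a pointed cone is its vertex. -/
theorem vertex_poly (h : dirs Λ η H = ⊥) : vertex (poly Λ η c H) = s := by
  have hext : (poly Λ η c H).extremePoints ℝ = {s} := by
    ext x
    rw [Set.mem_singleton_iff, mem_extremePoints]
    constructor
    · rintro ⟨hx, hext⟩
      by_contra hne
      -- `x` is the midpoint of the vertex `s` and of `s + 2 (x - s)`
      have hy : s + (2 : ℝ) • (x - s) ∈ poly Λ η c H := by
        refine ⟨add_mem hs (Submodule.smul_mem _ _ (sub_mem hx.1 hs)), fun i hi => ?_⟩
        rw [map_add, map_smul, map_sub, hsH i hi, smul_eq_mul]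
        linarith [hx.2 i hi]
      refine hne (hext s (mem_poly_of_forall_eq hs hsH) _ hy ?_).1.symm
      refine ⟨1 / 2, 1 / 2, by norm_num, by norm_num, by norm_num, ?_⟩
      module
    · rintro rfl
      refine ⟨mem_poly_of_forall_eq hs hsH, fun y hy z hz hyz => ?_⟩
      obtain ⟨a, b, ha, hb, hab, hsum⟩ := hyz
      have hmem : ∀ w ∈ poly Λ η c H, ∀ i ∈ H, η i w ≤ c i := fun w hw => hw.2
      have key : ∀ i ∈ H, η i y = c i ∧ η i z = c i := by
        intro i hi
        have h1 := congrArg (η i) hsum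
        rw [map_add, map_smul, map_smul, smul_eq_mul, smul_eq_mul, hsH i hi] at h1
        have h2 := hmem y hy i hi
        have h3 := hmem z hz i hi
        have h4 : a * (c i - η i y) + b * (c i - η i z) = 0 := by
          linear_combination (c i) * hab - h1
        have h5 := mul_nonneg ha.le (sub_nonneg.2 h2)
        have h6 := mul_nonneg hb.le (sub_nonneg.2 h3)
        have h7 : a * (c i - η i y) = 0 := by linarith
        have h8 : b * (c i - η i z) = 0 := by linarith
        constructor
        · linarith [(mul_eq_zero.1 h7).resolve_left ha.ne']
        · linarith [(mul_eq_zero.1 h8).resolve_left hb.ne']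
      have hface := face_self hs hsH h
      exact ⟨hface.le (⟨hy, fun i hi => (key i hi).1⟩ : y ∈ face Λ η c H H),
        hface.le (⟨hz, fun i hi => (key i hi).2⟩ : z ∈ face Λ η c H H)⟩
  have hne : ((poly Λ η c H).extremePoints ℝ).Nonempty := hext ▸ Set.singleton_nonempty s
  rw [vertex, dif_pos hne]
  exact hext.le hne.some_mem

/-- The local formula for cones, which is the definition of `μ`. -/
theorem S_cone [DiscreteTopology Λ] :
    S Λ (poly Λ η c H) = ∑ A ∈ actSets Λ η c H, muFace Λ η c A * I Λ (face Λ η c H A) := by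
  classical
  have hne : (poly Λ η c H).Nonempty := ⟨s, mem_poly_of_forall_eq hs hsH⟩
  by_cases hbot : dirs Λ η H = ⊥
  swap
  · obtain ⟨v, hv, hv0⟩ := Submodule.exists_mem_ne_zero_of_ne_bot hbot
    rw [S_eq_zero_of_containsLine ((containsLine_poly_iff hne).2 hbot)]
    refine (Finset.sum_eq_zero fun A hA => ?_).symm
    obtain ⟨x, hx⟩ := face_nonempty hA
    rw [I_eq_zero_of_containsLine, mul_zero]
    have hAH := subset_of_mem_actSets hA
    have hadd : ∀ (t : ℝ), ∀ i ∈ H, η i (x + t • v) = η i x := fun t i hi => by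
      rw [map_add, map_smul, hv.2 i hi, smul_zero, add_zero]
    refine ⟨x, v, hv0, fun t => ⟨⟨add_mem hx.1.1 (Submodule.smul_mem _ _ hv.1), fun i hi => ?_⟩,
      fun i hi => ?_⟩⟩
    · rw [hadd t i hi]
      exact hx.1.2 i hi
    · rw [hadd t i (hAH hi)]
      exact hx.2 i hi
  have hset : {f | f ∈ faces (poly Λ η c H) ∧ 0 < Module.finrank ℝ (lin f)} =
      face Λ η c H '' ((actSets Λ η c H).erase H : Set (Finset ι)) := by
    have hiff : ∀ A ∈ actSets Λ η c H,
        0 < Module.finrank ℝ (lin (face Λ η c H A)) ↔ A ≠ H := by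
      intro A hA
      rw [lin, lin_face hA, Nat.pos_iff_ne_zero, Ne, Submodule.finrank_eq_zero]
      refine not_congr ⟨eq_of_dirs_eq_bot hs hsH hA, ?_⟩
      rintro rfl
      exact hbot
    rw [faces_poly]
    ext f
    constructor
    · rintro ⟨⟨A, hA, rfl⟩, hpos⟩
      exact ⟨A, Finset.mem_erase.2 ⟨(hiff A hA).1 hpos, hA⟩, rfl⟩
    · rintro ⟨A, hA, rfl⟩
      obtain ⟨hAH, hA⟩ := Finset.mem_erase.1 hA
      exact ⟨⟨A, hA, rfl⟩, (hiff A hA).2 hAH⟩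
  have hsum : ∑ᶠ f : {f : Set E // f ∈ faces (poly Λ η c H) ∧ 0 < Module.finrank ℝ (lin f)},
        mu (quotLattice Λ (lin f.1)) (transverseCone (poly Λ η c H) f.1) * I Λ f.1 =
      ∑ A ∈ (actSets Λ η c H).erase H, muFace Λ η c A * I Λ (face Λ η c H A) := by
    have h1 := finsum_set_coe_eq_finsum_mem
      (f := fun f => mu (quotLattice Λ (lin f)) (transverseCone (poly Λ η c H) f) * I Λ f)
      {f | f ∈ faces (poly Λ η c H) ∧ 0 < Module.finrank ℝ (lin f)}
    refine h1.trans ?_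
    rw [hset, finsum_mem_image (face_injOn.mono fun A hA => Finset.mem_of_mem_erase hA),
      finsum_mem_coe_finset]
    refine Finset.sum_congr rfl fun A hA => ?_
    have hA := Finset.mem_of_mem_erase hA
    rw [transverseCone_face hA, lin, lin_face hA, muFace]
  have hmu : mu Λ (poly Λ η c H) = expMer (-s) * (S Λ (poly Λ η c H) -
      ∑ A ∈ (actSets Λ η c H).erase H, muFace Λ η c A * I Λ (face Λ η c H A)) := by
    rw [mu, if_neg (fun h => (containsLine_poly_iff hne).1 h hbot), vertex_poly hs hsH hbot, hsum]
  rw [← Finset.add_sum_erase _ _ (self_mem_actSets hs hsH), muFace_of_dirs_eq_bot hbot, hmu,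
    face_self hs hsH hbot, I_singleton, mul_right_comm, expMer_neg_mul, one_mul, sub_add_cancel]

end Vertex

/-! ### The valuation property -/

/-- The function `μ` respects the linear relations between indicator functions of cones with a
common vertex. -/
def ConeRelations (ι κ : Type*) (Λ : Submodule ℤ E) : Prop :=
  ∀ (K : Finset κ) (η : ι → StrongDual ℝ E) (c : ι → ℝ) (H : κ → Finset ι) (r : κ → ℝ) (s : E),
    s ∈ Submodule.span ℝ (Λ : Set E) → (∀ k ∈ K, ∀ i ∈ H k, IntegralOn Λ (η i)) →
    (∀ k ∈ K, ∀ i ∈ H k, η i s = c i) → (∀ x, ∑ k ∈ K, r k * chi (poly Λ η c (H k)) x = 0) →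
    ∑ k ∈ K, constMer (r k) * mu Λ (poly Λ η c (H k)) = 0

omit [FiniteDimensional ℝ E] [MeasurableSpace E] [BorelSpace E] in
theorem constMer_mul (r t : ℝ) : (constMer (r * t) : Mer E) = constMer r * constMer t :=
  map_mul (constHom E) r t

omit [FiniteDimensional ℝ E] [MeasurableSpace E] [BorelSpace E] in
theorem constMer_zero : (constMer 0 : Mer E) = 0 := map_zero (constHom E)

omit [FiniteDimensional ℝ E] [MeasurableSpace E] [BorelSpace E] in
theorem constMer_one : (constMer 1 : Mer E) = 1 := map_one (constHom E)

open scoped Classical in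
/-- At a point `x` of the affine subspace `M` that lies on no bounding hyperplane except those
containing `M`, the only face of the polyhedron that generates `M` and contains `x` is the smallest
face containing `x`. -/
theorem sum_muFace_fiber {M : AffineSubspace ℝ E} {x : E} (hxM : x ∈ M)
    (hM : M.direction ≤ Submodule.span ℝ (Λ : Set E))
    (hgen : ∀ i ∈ H, η i x = c i → ∀ u ∈ M.direction, η i u = 0) :
    ∑ A ∈ actSets Λ η c H with affineSpan ℝ (face Λ η c H A) = M,
        constMer (chi (face Λ η c H A) x) * muFace Λ η c A =
      if x ∈ poly Λ η c H then mu (quotLattice Λ M.direction)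
        (poly (quotLattice Λ M.direction) η c (actIneq η c H x)) else 0 := by
  by_cases hx : x ∈ poly Λ η c H
  swap
  · rw [if_neg hx]
    refine Finset.sum_eq_zero fun A _ => ?_
    rw [chi, Set.indicator_of_notMem (fun h => hx h.1), constMer_zero, zero_mul]
  rw [if_pos hx]
  have hdir : ∀ A ∈ actSets Λ η c H, affineSpan ℝ (face Λ η c H A) = M →
      dirs Λ η A = M.direction := by
    rintro A hA rfl
    rw [direction_affineSpan, lin_face hA]
  have huniq : ∀ A ∈ actSets Λ η c H, affineSpan ℝ (face Λ η c H A) = M →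
      x ∈ face Λ η c H A → A = actIneq η c H x := by
    intro A hA hAM hxA
    refine ((mem_face_iff_subset (subset_of_mem_actSets hA) hx).1 hxA).antisymm fun i hi => ?_
    obtain ⟨hiH, hi⟩ := mem_actIneq.1 hi
    have hd := hdir A hA hAM
    obtain ⟨y, hy, rfl⟩ := mem_actSets.1 hA
    refine mem_actIneq.2 ⟨hiH, ?_⟩
    have hyx : y - x ∈ M.direction := by
      rw [← hd, ← lin_face hA]
      exact vsub_mem_vectorSpan ℝ (mem_face_actIneq hy) hxA
    have := hgen i hiH hi _ hyx
    rw [map_sub, hi, sub_eq_zero] at this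
    exact this
  have hle : M.direction ≤ dirs Λ η (actIneq η c H x) := fun u hu =>
    ⟨hM hu, fun i hi => hgen i (mem_actIneq.1 hi).1 (mem_actIneq.1 hi).2 u hu⟩
  have hA₀ : actIneq η c H x ∈ actSets Λ η c H := mem_actSets.2 ⟨x, hx, rfl⟩
  by_cases hd : dirs Λ η (actIneq η c H x) = M.direction
  · rw [Finset.sum_eq_single (actIneq η c H x)]
    · rw [chi, Set.indicator_of_mem (mem_face_actIneq hx), constMer_one, one_mul, muFace, hd]
    · intro A hA hne
      obtain ⟨hA, hAM⟩ := Finset.mem_filter.1 hA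
      rw [chi, Set.indicator_of_notMem (fun h => hne (huniq A hA hAM h)), constMer_zero, zero_mul]
    · refine fun h => (h (Finset.mem_filter.2 ⟨hA₀, ?_⟩)).elim
      refine AffineSubspace.ext_of_direction_eq ?_
        ⟨x, subset_affineSpan ℝ _ (mem_face_actIneq hx), hxM⟩
      rw [direction_affineSpan, lin_face hA₀, hd]
  · rw [mu_eq_zero_of_containsLine (containsLine_quotLattice hle hd
      ⟨hx.1, fun i hi => hx.2 i (mem_actIneq.1 hi).1⟩)]
    refine Finset.sum_eq_zero fun A hA => ?_
    obtain ⟨hA, hAM⟩ := Finset.mem_filter.1 hA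
    have hxA : x ∉ face Λ η c H A := fun h => hd (huniq A hA hAM h ▸ hdir A hA hAM)
    rw [chi, Set.indicator_of_notMem hxA, constMer_zero, zero_mul]

variable [DiscreteTopology Λ]

open scoped Classical in
/-- In a linear relation between indicator functions of polyhedra, the contributions to the local
formula of the faces that generate a given affine subspace `M` cancel. -/
theorem sum_faces_generating {K : Finset κ} {H : κ → Finset ι} {r : κ → ℝ}
    (hH : ∀ k ∈ K, ∀ i ∈ H k, IntegralOn Λ (η i))
    (h0 : ∀ x, ∑ k ∈ K, r k * chi (poly Λ η c (H k)) x = 0) (M : AffineSubspace ℝ E)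
    (hrel : DiscreteTopology (quotLattice Λ M.direction) →
      ConeRelations ι κ (quotLattice Λ M.direction)) :
    ∑ k ∈ K, constMer (r k) *
      ∑ A ∈ actSets Λ η c (H k) with affineSpan ℝ (face Λ η c (H k) A) = M,
        muFace Λ η c A * I Λ (face Λ η c (H k) A) = 0 := by
  let T : Finset (Σ _ : κ, Finset ι) := K.sigma fun k =>
    (actSets Λ η c (H k)).filter fun A => affineSpan ℝ (face Λ η c (H k) A) = M
  have hT : ∀ q ∈ T, q.1 ∈ K ∧ q.2 ∈ actSets Λ η c (H q.1) ∧
      affineSpan ℝ (face Λ η c (H q.1) q.2) = M := by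
    intro q hq
    obtain ⟨h1, h2⟩ := Finset.mem_sigma.1 hq
    exact ⟨h1, Finset.mem_filter.1 h2⟩
  suffices h : ∑ q ∈ T, muFace Λ η c q.2 *
      (constMer (r q.1) * I Λ (face Λ η c (H q.1) q.2)) = 0 by
    rw [Finset.sum_sigma] at h
    rw [← h]
    refine Finset.sum_congr rfl fun k _ => ?_
    rw [Finset.mul_sum]
    exact Finset.sum_congr rfl fun A _ => mul_left_comm _ _ _
  rcases T.eq_empty_or_nonempty with hT0 | ⟨⟨k₀, A₀⟩, hq₀⟩
  · rw [hT0, Finset.sum_empty]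
  obtain ⟨hk₀, hA₀, hM₀⟩ := hT _ hq₀
  obtain ⟨x₀, hx₀⟩ := face_nonempty hA₀
  have hx₀M : x₀ ∈ M := hM₀ ▸ subset_affineSpan ℝ _ hx₀
  have hdir : ∀ q ∈ T, lin (face Λ η c (H q.1) q.2) = M.direction := by
    intro q hq
    rw [← (hT q hq).2.2, direction_affineSpan]
  have hrat : IsRatSubspace Λ M.direction := by
    rw [← hdir _ hq₀]
    exact isRatSubspace_lin_face (hH k₀ hk₀) hA₀
  have hdirs₀ : dirs Λ η A₀ = M.direction := by
    rw [← hdir _ hq₀]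
    exact (lin_face hA₀).symm
  have hMs : M.direction ≤ Submodule.span ℝ (Λ : Set E) := hdirs₀ ▸ dirs_le_span_lattice
  have hdisc : DiscreteTopology (quotLattice Λ M.direction) := hdirs₀ ▸
    discreteTopology_quotLattice fun i hi => hH k₀ hk₀ i (subset_of_mem_actSets hA₀ hi)
  have hfin := isFiniteMeasureOnCompacts_translateMeasure (x := x₀) hrat
  refine sum_mul_transform_eq_zero (ν := translateMeasure Λ M.direction x₀) T
    (f := fun q => r q.1 • chi (face Λ η c (H q.1) q.2)) (fun q => muFace Λ η c q.2)
    (fun q hq => ?_) ?_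
  · obtain ⟨hk, hA, hqM⟩ := hT q hq
    obtain ⟨x, hx⟩ := face_nonempty hA
    have hI := I_hasTransform (isIntPoly_face (hH _ hk) (subset_of_mem_actSets hA))
      (isRatSubspace_lin_face (hH _ hk) hA) ⟨x, hx⟩
    have hxx₀ : x - x₀ ∈ M.direction :=
      AffineSubspace.vsub_mem_direction (hqM ▸ subset_affineSpan ℝ _ hx) hx₀M
    have hν : affineMeasure Λ (face Λ η c (H q.1) q.2) = translateMeasure Λ M.direction x₀ := by
      rw [affineMeasure_eq (isRatSubspace_lin_face (hH _ hk) hA) hx, hdir q hq,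
        ← translateMeasure_add (x := x₀) hrat hxx₀, add_sub_cancel]
    rw [hν] at hI
    exact hI.smul _
  -- almost every point of `M` lies on no bounding hyperplane except those containing `M`
  have hgen : ∀ᵐ x ∂translateMeasure Λ M.direction x₀, ∀ k ∈ K, ∀ i ∈ H k, η i x = c i →
      ∀ u ∈ M.direction, η i u = 0 := by
    refine (ae_ball_iff K.countable_toSet).2 fun k _ =>
      (ae_ball_iff (H k).countable_toSet).2 fun i _ => ?_
    by_cases h : ∀ u ∈ M.direction, η i u = 0
    · exact Filter.Eventually.of_forall fun _ _ => h
    · push Not at h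
      obtain ⟨u, hu, hu0⟩ := h
      have := translateMeasure_hyperplane (x := x₀) hrat (c i) hu hu0
      filter_upwards [compl_mem_ae_iff.2 this] with x hx hxc
      exact (hx hxc).elim
  filter_upwards [hgen, ae_translateMeasure] with x hx hxx₀
  have hxM : x ∈ M := by
    have := AffineSubspace.vadd_mem_of_mem_direction hxx₀ hx₀M
    rwa [vadd_eq_add, sub_add_cancel] at this
  have hxs : x ∈ Submodule.span ℝ (Λ : Set E) := by
    have := add_mem (hMs hxx₀) hx₀.1.1
    rwa [sub_add_cancel] at this
  rw [Finset.sum_sigma]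
  have hk : ∀ k ∈ K, ∑ A ∈ actSets Λ η c (H k) with affineSpan ℝ (face Λ η c (H k) A) = M,
      constMer ((r k • chi (face Λ η c (H k) A)) x) * muFace Λ η c A =
      if x ∈ poly Λ η c (H k) then constMer (r k) * mu (quotLattice Λ M.direction)
        (poly (quotLattice Λ M.direction) η c (actIneq η c (H k) x)) else 0 := by
    intro k hk
    rw [← mul_ite_zero, ← sum_muFace_fiber hxM hMs (hx k hk), Finset.mul_sum]
    refine Finset.sum_congr rfl fun A _ => ?_
    rw [Pi.smul_apply, smul_eq_mul, constMer_mul, mul_assoc]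
  rw [Finset.sum_congr rfl hk, ← Finset.sum_filter]
  have hact : ∀ k ∈ K, ∀ i ∈ actIneq η c (H k) x, ∀ u ∈ M.direction, η i u = 0 :=
    fun k hk i hi => hx k hk i (mem_actIneq.1 hi).1 (mem_actIneq.1 hi).2
  have hspan := span_quotLattice hMs
  have hproj : quotProj M.direction x ∈ Submodule.span ℝ (quotLattice Λ M.direction : Set E) := by
    rw [hspan]
    refine ⟨?_, quotProj_mem _ x⟩
    have := sub_mem hxs (hMs (sub_quotProj_mem M.direction x))
    rwa [sub_sub_cancel] at this
  -- the tangent cones at `x`, taken modulo the directions of `M`, have a common vertex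
  refine hrel hdisc _ η c _ r (quotProj M.direction x) hproj ?_ ?_ fun z => ?_
  · intro k hk i hi
    have hk := (Finset.mem_filter.1 hk).1
    exact (hH k hk i (mem_actIneq.1 hi).1).quotLattice (hact k hk i hi)
  · intro k hk i hi
    have hk := (Finset.mem_filter.1 hk).1
    rw [apply_quotProj (hact k hk i hi)]
    exact (mem_actIneq.1 hi).2
  · by_cases hz : z ∈ Submodule.span ℝ (quotLattice Λ M.direction : Set E)
    · rw [← sum_chi_tangent h0 hxs z]
      refine Finset.sum_congr rfl fun k _ => ?_
      have hiff : z ∈ poly (quotLattice Λ M.direction) η c (actIneq η c (H k) x) ↔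
          z ∈ poly Λ η c (actIneq η c (H k) x) :=
        ⟨fun h => ⟨(hspan.le hz).1, h.2⟩, fun h => ⟨hz, h.2⟩⟩
      by_cases h : z ∈ poly Λ η c (actIneq η c (H k) x)
      · rw [chi, chi, Set.indicator_of_mem h, Set.indicator_of_mem (hiff.2 h)]
      · rw [chi, chi, Set.indicator_of_notMem h, Set.indicator_of_notMem (mt hiff.1 h)]
    · refine Finset.sum_eq_zero fun k _ => ?_
      rw [chi, Set.indicator_of_notMem (fun h => hz h.1), mul_zero]

open scoped Classical in
/-- In a linear relation between indicator functions of polyhedra, the contributions to the local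
formula of the faces with directions in a given class cancel. -/
theorem sum_faces_directions {K : Finset κ} {H : κ → Finset ι} {r : κ → ℝ}
    (hH : ∀ k ∈ K, ∀ i ∈ H k, IntegralOn Λ (η i))
    (h0 : ∀ x, ∑ k ∈ K, r k * chi (poly Λ η c (H k)) x = 0) (P : Submodule ℝ E → Prop)
    [DecidablePred P]
    (hrel : ∀ L : Submodule ℝ E, L ≤ Submodule.span ℝ (Λ : Set E) → P L →
      DiscreteTopology (quotLattice Λ L) → ConeRelations ι κ (quotLattice Λ L)) :
    ∑ k ∈ K, constMer (r k) * ∑ A ∈ actSets Λ η c (H k) with P (dirs Λ η A),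
      muFace Λ η c A * I Λ (face Λ η c (H k) A) = 0 := by
  let B : κ → Finset (Finset ι) := fun k => (actSets Λ η c (H k)).filter fun A => P (dirs Λ η A)
  let key : κ → Finset ι → AffineSubspace ℝ E := fun k A => affineSpan ℝ (face Λ η c (H k) A)
  let Ms : Finset (AffineSubspace ℝ E) := K.biUnion fun k => (B k).image (key k)
  have hkey : ∀ k, ∀ A ∈ actSets Λ η c (H k), (key k A).direction = dirs Λ η A := by
    intro k A hA
    rw [direction_affineSpan, lin_face hA]
  have h1 : ∀ k ∈ K, ∑ A ∈ B k, muFace Λ η c A * I Λ (face Λ η c (H k) A) =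
      ∑ M ∈ Ms, ∑ A ∈ actSets Λ η c (H k) with key k A = M,
        muFace Λ η c A * I Λ (face Λ η c (H k) A) := by
    intro k hk
    rw [← Finset.sum_fiberwise_of_maps_to (t := Ms) (g := key k) fun A hA =>
      Finset.mem_biUnion.2 ⟨k, hk, Finset.mem_image_of_mem _ hA⟩]
    refine Finset.sum_congr rfl fun M hM => Finset.sum_congr ?_ fun _ _ => rfl
    obtain ⟨k', -, hM⟩ := Finset.mem_biUnion.1 hM
    obtain ⟨A', hA', rfl⟩ := Finset.mem_image.1 hM
    obtain ⟨hA', hP⟩ := Finset.mem_filter.1 hA'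
    ext A
    simp only [B, Finset.mem_filter]
    refine ⟨fun h => ⟨h.1.1, h.2⟩, fun h => ⟨⟨h.1, ?_⟩, h.2⟩⟩
    rwa [← hkey k A h.1, h.2, hkey k' A' hA']
  rw [Finset.sum_congr rfl fun k hk => congrArg (constMer (r k) * ·) (h1 k hk)]
  simp only [Finset.mul_sum]
  rw [Finset.sum_comm]
  refine Finset.sum_eq_zero fun M hM => ?_
  obtain ⟨k', -, hM⟩ := Finset.mem_biUnion.1 hM
  obtain ⟨A', hA', rfl⟩ := Finset.mem_image.1 hM
  obtain ⟨hA', hP⟩ := Finset.mem_filter.1 hA'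
  have h2 := sum_faces_generating hH h0 (key k' A') ?_
  · simpa only [Finset.mul_sum] using h2
  · rw [hkey k' A' hA']
    exact hrel _ dirs_le_span_lattice hP

/-- The sums over lattice points satisfy the linear relations between indicator functions. -/
theorem sum_S {K : Finset κ} {p : κ → Set E} {r : κ → ℝ} (hp : ∀ k ∈ K, IsIntPoly Λ (p k))
    (h0 : ∀ x, ∑ k ∈ K, r k * chi (p k) x = 0) : ∑ k ∈ K, constMer (r k) * S Λ (p k) = 0 := by
  refine (HasTransform.sum K r fun k hk => S_hasTransform (hp k hk)).eq_zero_of_ae_eq_zero ?_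
  refine Filter.Eventually.of_forall fun x => ?_
  rw [Finset.sum_apply, Pi.zero_apply, ← h0 x]
  rfl

omit [MeasurableSpace E] [BorelSpace E] [DiscreteTopology Λ] in
theorem finrank_span_quotLattice_lt {L : Submodule ℝ E}
    (hL : L ≤ Submodule.span ℝ (Λ : Set E)) (h0 : L ≠ ⊥) :
    Module.finrank ℝ (Submodule.span ℝ (quotLattice Λ L : Set E)) <
      Module.finrank ℝ (Submodule.span ℝ (Λ : Set E)) := by
  rw [span_quotLattice hL]
  refine Submodule.finrank_lt_finrank_of_lt (lt_of_le_of_ne inf_le_left fun h => h0 ?_)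
  rw [Submodule.eq_bot_iff]
  intro v hv
  have h1 : v ∈ Submodule.span ℝ (Λ : Set E) ⊓ Lᗮ := h.ge (hL hv)
  exact inner_self_eq_zero.1 (h1.2 v hv)

omit [DiscreteTopology Λ] in
/-- The valuation property of `μ`, by induction on the dimension: in a relation between cones with
vertex `s`, the sums over lattice points cancel, and so do the terms of the faces of positive
dimension.  What remains is the relation between the `μ` of the cones, times `e^{⟨ξ, s⟩}`. -/
theorem coneRelations (ι κ : Type*) (Λ : Submodule ℤ E) [DiscreteTopology Λ] :
    ConeRelations ι κ Λ := by
  classical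
  rename_i hdisc
  generalize hn : Module.finrank ℝ (Submodule.span ℝ (Λ : Set E)) = n
  induction n using Nat.strong_induction_on generalizing Λ with
  | _ n ih =>
  intro K η c H r s hs hH hsH h0
  have h1 := sum_faces_directions hH h0 (· ≠ ⊥) fun L hL hL0 _ =>
    ih _ (hn ▸ finrank_span_quotLattice_lt hL hL0) _ rfl
  have h2 := sum_S (fun k hk => isIntPoly_poly (c := c) (hH k hk)) h0
  have h3 : ∀ k ∈ K, constMer (r k) * S Λ (poly Λ η c (H k)) =
      constMer (r k) * mu Λ (poly Λ η c (H k)) * expMer s +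
      constMer (r k) * ∑ A ∈ actSets Λ η c (H k) with dirs Λ η A ≠ ⊥,
        muFace Λ η c A * I Λ (face Λ η c (H k) A) := by
    intro k hk
    rw [S_cone hs (hsH k hk), ← Finset.sum_filter_add_sum_filter_not _ (fun A => dirs Λ η A = ⊥),
      mul_add, mul_assoc]
    congr 2
    by_cases hbot : dirs Λ η (H k) = ⊥
    · rw [Finset.sum_eq_single (H k)]
      · rw [muFace_of_dirs_eq_bot hbot, face_self hs (hsH k hk) hbot, I_singleton]
      · intro A hA hne
        obtain ⟨hA, hA0⟩ := Finset.mem_filter.1 hA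
        exact (hne (eq_of_dirs_eq_bot hs (hsH k hk) hA hA0)).elim
      · exact fun h => (h (Finset.mem_filter.2 ⟨self_mem_actSets hs (hsH k hk), hbot⟩)).elim
    · rw [mu_eq_zero_of_containsLine ((containsLine_poly_iff
        ⟨s, mem_poly_of_forall_eq hs (hsH k hk)⟩).2 hbot), zero_mul]
      refine Finset.sum_eq_zero fun A hA => (hbot ?_).elim
      obtain ⟨hA, hA0⟩ := Finset.mem_filter.1 hA
      exact eq_of_dirs_eq_bot hs (hsH k hk) hA hA0 ▸ hA0
  rw [Finset.sum_congr rfl h3, Finset.sum_add_distrib, h1, add_zero, ← Finset.sum_mul] at h2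
  exact (mul_eq_zero.1 h2).resolve_right (expMer_ne_zero s)

/-- Both sides of the local formula satisfy the linear relations between indicator functions of
polyhedra. -/
theorem sum_local_formula {K : Finset κ} {H : κ → Finset ι} {r : κ → ℝ}
    (hH : ∀ k ∈ K, ∀ i ∈ H k, IntegralOn Λ (η i))
    (h0 : ∀ x, ∑ k ∈ K, r k * chi (poly Λ η c (H k)) x = 0) :
    ∑ k ∈ K, constMer (r k) *
      ∑ A ∈ actSets Λ η c (H k), muFace Λ η c A * I Λ (face Λ η c (H k) A) = 0 := by
  have := sum_faces_directions hH h0 (fun _ => True) fun L _ _ _ => coneRelations ι κ _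
  simpa using this

end LocalFormula

/-! ### Elimination of a ray -/

section Elimination

variable {E : Type*} [NormedAddCommGroup E] [NormedSpace ℝ E] {Λ : Submodule ℤ E}

open scoped Classical in
/-- Fourier–Motzkin elimination: the sum of a polyhedron and of the ray generated by a lattice
vector is given by integral inequalities, all of which are equalities at the points where all
inequalities of the polyhedron are. -/
theorem exists_hpoly_add_ray_of_mem {H : Finset (StrongDual ℝ E × ℝ)}
    (hH : ∀ h ∈ H, IntegralOn Λ h.1) {v : E} (hv : v ∈ Λ) :
    ∃ H' : Finset (StrongDual ℝ E × ℝ), (∀ h ∈ H', IntegralOn Λ h.1) ∧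
      (∀ y, (∀ h ∈ H, h.1 y = h.2) → ∀ h ∈ H', h.1 y = h.2) ∧
      ∀ x, x ∈ hpoly Λ H' ↔ ∃ t : ℝ, 0 ≤ t ∧ x - t • v ∈ hpoly Λ H := by
  let comb : (StrongDual ℝ E × ℝ) × (StrongDual ℝ E × ℝ) → StrongDual ℝ E × ℝ := fun q =>
    (-(q.2.1 v) • q.1.1 + q.1.1 v • q.2.1, -(q.2.1 v) * q.1.2 + q.1.1 v * q.2.2)
  let P := H.filter fun h => 0 < h.1 v
  let N := H.filter fun h => h.1 v < 0
  have hvs := mem_span_of_mem hv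
  refine ⟨(H.filter fun h => h.1 v ≤ 0) ∪ (P ×ˢ N).image comb, ?_, ?_, fun x => ?_⟩
  · intro h hh
    rcases Finset.mem_union.1 hh with hh | hh
    · exact hH h (Finset.mem_filter.1 hh).1
    · obtain ⟨⟨p, n⟩, hpn, rfl⟩ := Finset.mem_image.1 hh
      obtain ⟨hp, hn⟩ := Finset.mem_product.1 hpn
      intro x hx
      obtain ⟨a, ha⟩ := hH p (Finset.mem_filter.1 hp).1 x hx
      obtain ⟨b, hb⟩ := hH n (Finset.mem_filter.1 hn).1 x hx
      obtain ⟨a', ha'⟩ := hH p (Finset.mem_filter.1 hp).1 v hv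
      obtain ⟨b', hb'⟩ := hH n (Finset.mem_filter.1 hn).1 v hv
      refine ⟨-b' * a + a' * b, ?_⟩
      simp [comb, ha, hb, ha', hb']
  · intro y hy h hh
    rcases Finset.mem_union.1 hh with hh | hh
    · exact hy h (Finset.mem_filter.1 hh).1
    · obtain ⟨⟨p, n⟩, hpn, rfl⟩ := Finset.mem_image.1 hh
      obtain ⟨hp, hn⟩ := Finset.mem_product.1 hpn
      have h1 := hy p (Finset.mem_filter.1 hp).1
      have h2 := hy n (Finset.mem_filter.1 hn).1
      simp [comb, h1, h2]
  have hspan : ∀ t : ℝ, x - t • v ∈ Submodule.span ℝ (Λ : Set E) ↔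
      x ∈ Submodule.span ℝ (Λ : Set E) := fun t =>
    Submodule.sub_mem_iff_left _ (Submodule.smul_mem _ _ hvs)
  constructor
  · rintro ⟨hx, hineq⟩
    have hle : ∀ h ∈ H, h.1 v ≤ 0 → h.1 x ≤ h.2 := fun h hh hhv =>
      hineq h (Finset.mem_union_left _ (Finset.mem_filter.2 ⟨hh, hhv⟩))
    have hpn : ∀ p ∈ P, ∀ n ∈ N, -(n.1 v) * (p.1 x - p.2) ≤ p.1 v * (n.2 - n.1 x) := by
      intro p hp n hn
      have h1 := hineq (comb (p, n)) (Finset.mem_union_right _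
        (Finset.mem_image_of_mem _ (Finset.mk_mem_product hp hn)))
      simp only [comb, add_apply, smul_apply, smul_eq_mul] at h1
      linarith
    -- the largest of the lower bounds for the parameter on the ray
    obtain ⟨t, ht0, htP, htN⟩ : ∃ t : ℝ, 0 ≤ t ∧ (∀ p ∈ P, p.1 x - p.2 ≤ t * p.1 v) ∧
        ∀ n ∈ N, -(n.1 v) * t ≤ n.2 - n.1 x := by
      have hN0 : ∀ n ∈ N, 0 ≤ n.2 - n.1 x := fun n hn =>
        sub_nonneg.2 (hle n (Finset.mem_filter.1 hn).1 (Finset.mem_filter.1 hn).2.le)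
      by_cases hP : ∀ p ∈ P, p.1 x - p.2 ≤ 0
      · exact ⟨0, le_rfl, by simpa using hP, by simpa using hN0⟩
      push Not at hP
      obtain ⟨p₁, hp₁, hpos⟩ := hP
      obtain ⟨p₀, hp₀, hmax⟩ := Finset.exists_max_image P (fun p => (p.1 x - p.2) / p.1 v) ⟨p₁, hp₁⟩
      have hv₀ : 0 < p₀.1 v := (Finset.mem_filter.1 hp₀).2
      have hv₁ : 0 < p₁.1 v := (Finset.mem_filter.1 hp₁).2
      refine ⟨(p₀.1 x - p₀.2) / p₀.1 v, (div_pos hpos hv₁).le.trans (hmax p₁ hp₁),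
        fun p hp => ?_, fun n hn => ?_⟩
      · exact (div_le_iff₀ (Finset.mem_filter.1 hp).2).1 (hmax p hp)
      · rw [← mul_div_assoc, div_le_iff₀ hv₀, mul_comm (n.2 - n.1 x)]
        exact hpn p₀ hp₀ n hn
    refine ⟨t, ht0, (hspan t).2 hx, fun h hh => ?_⟩
    rw [map_sub, map_smul, smul_eq_mul]
    rcases lt_trichotomy (h.1 v) 0 with h0 | h0 | h0
    · linarith [htN h (Finset.mem_filter.2 ⟨hh, h0⟩), mul_comm t (h.1 v)]
    · rw [h0, mul_zero, sub_zero]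
      exact hle h hh h0.le
    · linarith [htP h (Finset.mem_filter.2 ⟨hh, h0⟩)]
  · rintro ⟨t, ht, hx, hineq⟩
    refine ⟨(hspan t).1 hx, fun h hh => ?_⟩
    have hineq' : ∀ h ∈ H, h.1 x - t * h.1 v ≤ h.2 := fun h hh => by
      have := hineq h hh
      rwa [map_sub, map_smul, smul_eq_mul] at this
    rcases Finset.mem_union.1 hh with hh | hh
    · obtain ⟨hh, h0⟩ := Finset.mem_filter.1 hh
      linarith [hineq' h hh, mul_nonpos_of_nonneg_of_nonpos ht h0]
    · obtain ⟨⟨p, n⟩, hpn, rfl⟩ := Finset.mem_image.1 hh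
      obtain ⟨hp, hn⟩ := Finset.mem_product.1 hpn
      obtain ⟨hp, hp0⟩ := Finset.mem_filter.1 hp
      obtain ⟨hn, hn0⟩ := Finset.mem_filter.1 hn
      have h1 := mul_le_mul_of_nonneg_left (hineq' p hp) (neg_pos.2 hn0).le
      have h2 := mul_le_mul_of_nonneg_left (hineq' n hn) hp0.le
      simp only [comb, add_apply, smul_apply, smul_eq_mul]
      linarith

/-- The version of `exists_hpoly_add_ray_of_mem` for a ray generated by a rational point. -/
theorem exists_hpoly_add_ray {H : Finset (StrongDual ℝ E × ℝ)}
    (hH : ∀ h ∈ H, IntegralOn Λ h.1) {v : E} (hv : IsRationalPoint Λ v) :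
    ∃ H' : Finset (StrongDual ℝ E × ℝ), (∀ h ∈ H', IntegralOn Λ h.1) ∧
      (∀ y, (∀ h ∈ H, h.1 y = h.2) → ∀ h ∈ H', h.1 y = h.2) ∧
      ∀ x, x ∈ hpoly Λ H' ↔ ∃ t : ℝ, 0 ≤ t ∧ x - t • v ∈ hpoly Λ H := by
  obtain ⟨n, hn, hnv⟩ := hv.exists_pos_nsmul
  obtain ⟨H', h1, h2, h3⟩ := exists_hpoly_add_ray_of_mem hH hnv
  refine ⟨H', h1, h2, fun x => (h3 x).trans ⟨?_, ?_⟩⟩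
  · rintro ⟨t, ht, hx⟩
    rw [smul_smul] at hx
    exact ⟨t * n, by positivity, hx⟩
  · rintro ⟨t, ht, hx⟩
    refine ⟨t / n, by positivity, ?_⟩
    rwa [smul_smul, div_mul_cancel₀ _ (by positivity)]

end Elimination

/-! ### Decomposition of polyhedra into cones -/

section Decomposition

variable {E : Type*} [NormedAddCommGroup E] [NormedSpace ℝ E] {Λ : Submodule ℤ E}

/-- Affine cones with a rational vertex, given by integral inequalities. -/
def IsHCone (Λ : Submodule ℤ E) (a : Set E) : Prop :=
  ∃ (H : Finset (StrongDual ℝ E × ℝ)) (s : E), IsRationalPoint Λ s ∧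
    (∀ h ∈ H, IntegralOn Λ h.1) ∧ (∀ h ∈ H, h.1 s = h.2) ∧ a = hpoly Λ H

/-- The solutions in `W = span Λ` of a system of linear equations. -/
def flat (Λ : Submodule ℤ E) (G : Finset (StrongDual ℝ E × ℝ)) : Set E :=
  {x | x ∈ Submodule.span ℝ (Λ : Set E) ∧ ∀ h ∈ G, h.1 x = h.2}

/-- The space of functions generated by the indicator functions of the cones contained in a flat. -/
def coneSpan (Λ : Submodule ℤ E) (G : Finset (StrongDual ℝ E × ℝ)) : Submodule ℝ (E → ℝ) :=
  Submodule.span ℝ {f | ∃ a, IsHCone Λ a ∧ a ⊆ flat Λ G ∧ f = chi a}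

variable {G : Finset (StrongDual ℝ E × ℝ)}

theorem chi_mem_coneSpan {a : Set E} (ha : IsHCone Λ a) (h : a ⊆ flat Λ G) :
    chi a ∈ coneSpan Λ G :=
  Submodule.subset_span ⟨a, ha, h, rfl⟩

theorem chi_empty_mem_coneSpan : chi (∅ : Set E) ∈ coneSpan Λ G := by
  rw [chi, Set.indicator_empty]
  exact zero_mem _

theorem coneSpan_mono {G' : Finset (StrongDual ℝ E × ℝ)} (h : G ⊆ G') :
    coneSpan Λ G' ≤ coneSpan Λ G :=
  Submodule.span_mono fun _ ⟨a, ha, hG, e⟩ =>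
    ⟨a, ha, fun _ hx => ⟨(hG hx).1, fun g hg => (hG hx).2 g (h hg)⟩, e⟩

theorem chi_inter {E : Type*} (s t : Set E) : chi (s ∩ t) = chi s * chi t :=
  Set.inter_indicator_one

theorem chi_eq_of_iff {E : Type*} {s t : Set E} {x y : E} (h : x ∈ s ↔ y ∈ t) :
    chi s x = chi t y := by
  by_cases hy : y ∈ t
  · rw [chi, chi, Set.indicator_of_mem hy, Set.indicator_of_mem (h.2 hy)]
  · rw [chi, chi, Set.indicator_of_notMem hy, Set.indicator_of_notMem (mt h.1 hy)]

open scoped Classical in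
theorem IsHCone.inter_halfspace {H : Finset (StrongDual ℝ E × ℝ)} {s : E}
    (hs : IsRationalPoint Λ s) (hH : ∀ h ∈ H, IntegralOn Λ h.1) (hsH : ∀ h ∈ H, h.1 s = h.2)
    {η : StrongDual ℝ E} (hη : IntegralOn Λ η) :
    IsHCone Λ (hpoly Λ H ∩ {x | η x ≤ η s}) := by
  refine ⟨insert (η, η s) H, s, hs, ?_, ?_, ?_⟩
  · simpa using ⟨hη, fun a b h => hH (a, b) h⟩
  · simpa using fun a b h => hsH (a, b) h
  · ext x
    simp only [Set.mem_inter_iff, mem_poly, Set.mem_ofPred_eq, Finset.forall_mem_insert]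
    tauto

theorem IntegralOn.exists_rat {η : StrongDual ℝ E} (hη : IntegralOn Λ η) {x : E}
    (hx : IsRationalPoint Λ x) : ∃ q : ℚ, η x = q := by
  obtain ⟨n, hn, hx⟩ := hx.exists_pos_nsmul
  obtain ⟨m, hm⟩ := hη _ hx
  refine ⟨m / n, ?_⟩
  rw [map_smul, smul_eq_mul] at hm
  push_cast
  rw [eq_div_iff (by positivity), mul_comm, hm]

open scoped Classical in
/-- A flat that contains a rational point is an affine cone, with any such point as vertex. -/
theorem isHCone_flat (hG : ∀ h ∈ G, IntegralOn Λ h.1) {y : E} (hy : IsRationalPoint Λ y)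
    (hyG : y ∈ flat Λ G) : IsHCone Λ (flat Λ G) := by
  refine ⟨G ∪ G.image fun h => (-h.1, -h.2), y, hy, ?_, ?_, ?_⟩
  · intro h hh
    rcases Finset.mem_union.1 hh with hh | hh
    · exact hG h hh
    · obtain ⟨g, hg, rfl⟩ := Finset.mem_image.1 hh
      exact (hG g hg).neg
  · intro h hh
    rcases Finset.mem_union.1 hh with hh | hh
    · exact hyG.2 h hh
    · obtain ⟨g, hg, rfl⟩ := Finset.mem_image.1 hh
      simp [hyG.2 g hg]
  · ext x
    simp only [flat, mem_poly, Set.mem_ofPred_eq, Finset.mem_union, or_imp, forall_and,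
      Finset.forall_mem_image, neg_apply, neg_le_neg_iff]
    exact and_congr_right fun _ => ⟨fun h => ⟨fun g hg => (h g hg).le, fun g hg => (h g hg).ge⟩,
      fun h g hg => le_antisymm (h.1 g hg) (h.2 hg)⟩

/-- The operator that extends functions on the hyperplane `η = c` radially from `s` to the
half-space `η ≥ c`.  It is meant for `η s < c`, where the denominator is positive on that
half-space. -/
noncomputable def radialExtension (s : E) (η : StrongDual ℝ E) (c : ℝ) :
    (E → ℝ) →ₗ[ℝ] (E → ℝ) where
  toFun f x := chi {x | c ≤ η x} x * f (s + ((c - η s) / (η x - η s)) • (x - s))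
  map_add' f g := by
    funext x
    exact mul_add _ _ _
  map_smul' r f := by
    funext x
    exact mul_left_comm _ _ _

theorem radialExtension_apply (s : E) (η : StrongDual ℝ E) (c : ℝ) (f : E → ℝ) (x : E) :
    radialExtension s η c f x =
      chi {x | c ≤ η x} x * f (s + ((c - η s) / (η x - η s)) • (x - s)) := rfl

/-- The part of a cone beyond a hyperplane that does not contain the vertex is the radial extension
of its intersection with the hyperplane. -/
theorem radialExtension_chi_cone {H : Finset (StrongDual ℝ E × ℝ)} {s : E}
    (hs : s ∈ Submodule.span ℝ (Λ : Set E)) (hsH : ∀ h ∈ H, h.1 s = h.2)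
    {η : StrongDual ℝ E} {c : ℝ} (hc : η s < c) :
    radialExtension s η c (chi (hpoly Λ H ∩ {x | η x = c})) =
      chi (hpoly Λ H ∩ {x | c ≤ η x}) := by
  funext x
  rw [radialExtension_apply, chi_inter, chi_inter, Pi.mul_apply, Pi.mul_apply, mul_comm]
  by_cases hx : c ≤ η x
  swap
  · rw [show chi {x | c ≤ η x} x = 0 from Set.indicator_of_notMem (s := {x | c ≤ η x}) hx _,
      mul_zero, mul_zero]
  congr 1
  have hpos : 0 < η x - η s := by linarith
  have hl : 0 < (c - η s) / (η x - η s) := div_pos (by linarith) hpos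
  have h1 : η (s + ((c - η s) / (η x - η s)) • (x - s)) = c := by
    rw [map_add, map_smul, map_sub, smul_eq_mul, div_mul_cancel₀ _ hpos.ne']
    ring
  have h2 : chi {x | η x = c} (s + ((c - η s) / (η x - η s)) • (x - s)) = 1 := by
    rw [chi, Set.indicator_of_mem (s := {x | η x = c}) h1]
  rw [h2, mul_one]
  refine chi_eq_of_iff ?_
  rw [mem_poly, mem_poly, Submodule.add_mem_iff_right _ hs, Submodule.smul_mem_iff _ hl.ne',
    Submodule.sub_mem_iff_left _ hs]
  refine and_congr_right fun _ => forall₂_congr fun h hh => ?_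
  rw [map_add, map_smul, map_sub, hsH h hh, smul_eq_mul, add_le_iff_nonpos_right]
  rw [mul_nonpos_iff_pos_imp_nonpos.trans ⟨fun h => h.1 hl, fun h => ⟨fun _ => h, fun h0 => hl.le⟩⟩,
    sub_nonpos]

/-- The radial extension of a cone `b` in the hyperplane `η = c` is again a cone with the same
vertex `y`: it is the sum of `b` and of the ray generated by `y - s`. -/
theorem radialExtension_mem_coneSpan {s : E} (hs : IsRationalPoint Λ s) (hsG : s ∈ flat Λ G)
    {η : StrongDual ℝ E} {c : ℝ} (hc : η s < c) {b : Set E} (hb : IsHCone Λ b)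
    (hbG : b ⊆ flat Λ G) (hbc : b ⊆ {x | η x = c}) :
    radialExtension s η c (chi b) ∈ coneSpan Λ G := by
  obtain ⟨H, y, hy, hH, hyH, rfl⟩ := hb
  have hyb : y ∈ hpoly Λ H := ⟨hy.mem_span, fun h hh => (hyH h hh).le⟩
  have hηy : η y = c := hbc hyb
  have hyG := hbG hyb
  have hv : IsRationalPoint Λ (y - s) := by
    have := hs.smul (-1)
    rw [sub_eq_add_neg]
    exact hy.add (by simpa using this)
  obtain ⟨H', hH', hyH', hmem⟩ := exists_hpoly_add_ray hH hv
  have he : radialExtension s η c (chi (hpoly Λ H)) = chi (hpoly Λ H') := by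
    funext x
    rw [radialExtension_apply]
    have hcs : 0 < c - η s := by linarith
    by_cases hx : c ≤ η x
    · rw [chi, chi, Set.indicator_of_mem (s := {x | c ≤ η x}) hx, one_mul]
      have hpos : 0 < η x - η s := by linarith
      have hl : 0 < (c - η s) / (η x - η s) := div_pos hcs hpos
      refine chi_eq_of_iff ?_
      rw [hmem]
      -- the central projection of `x` from `s` lies in `b` exactly if the parallel projection along
      -- `y - s` does: the inequalities are equalities at `y`, and the two points minus `y` are
      -- proportional
      have key : ∀ t : ℝ, 1 + t = (η x - η s) / (c - η s) →
          (s + ((c - η s) / (η x - η s)) • (x - s) ∈ hpoly Λ H ↔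
            x - t • (y - s) ∈ hpoly Λ H) := by
        intro t ht
        rw [mem_poly, mem_poly, Submodule.add_mem_iff_right _ hs.mem_span,
          Submodule.smul_mem_iff _ hl.ne', Submodule.sub_mem_iff_left _ hs.mem_span,
          Submodule.sub_mem_iff_left _ (Submodule.smul_mem _ _ hv.mem_span)]
        refine and_congr_right fun _ => forall₂_congr fun h hh => ?_
        rw [map_add, map_smul, map_sub, map_sub, map_smul, map_sub, hyH h hh, smul_eq_mul,
          smul_eq_mul, ← le_sub_iff_add_le', div_mul_eq_mul_div, div_le_iff₀ hpos]
        have h1 : (1 + t) * (c - η s) = η x - η s := by rw [ht, div_mul_cancel₀ _ hcs.ne']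
        rw [← h1, ← mul_assoc, mul_comm (c - η s), mul_le_mul_iff_left₀ hcs]
        constructor <;> intro h <;> linarith
      constructor
      · intro h
        have hdiv : (1 : ℝ) ≤ (η x - η s) / (c - η s) := by
          rw [one_le_div hcs]
          linarith
        exact ⟨(η x - η s) / (c - η s) - 1, by linarith, (key _ (by ring)).1 h⟩
      · rintro ⟨t, ht, h⟩
        refine (key t ?_).2 h
        have h1 : η (x - t • (y - s)) = c := hbc h
        rw [map_sub, map_smul, map_sub, smul_eq_mul, hηy] at h1
        rw [eq_div_iff hcs.ne']
        linarith
    · rw [chi, Set.indicator_of_notMem (s := {x | c ≤ η x}) hx, zero_mul, chi,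
        Set.indicator_of_notMem]
      intro hmem'
      obtain ⟨t, ht, h⟩ := (hmem x).1 hmem'
      have h1 : η (x - t • (y - s)) = c := hbc h
      rw [map_sub, map_smul, map_sub, smul_eq_mul, hηy] at h1
      nlinarith [mul_nonneg ht hcs.le]
  rw [he]
  refine chi_mem_coneSpan ⟨H', y, hy, hH', hyH' y hyH, rfl⟩ fun x hx => ⟨hx.1, fun g hg => ?_⟩
  obtain ⟨t, -, h⟩ := (hmem x).1 hx
  have h1 := (hbG h).2 g hg
  rw [map_sub, map_smul, map_sub, hyG.2 g hg, hsG.2 g hg, sub_self, smul_zero, sub_zero] at h1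
  exact h1

open scoped Classical in
/-- The induction step for the decomposition of polyhedra into cones: intersection of a cone with a
half-space, assuming the decomposition for polyhedra in flats of smaller dimension. -/
theorem chi_cone_inter_mem_coneSpan (hG : ∀ h ∈ G, IntegralOn Λ h.1)
    (ih : ∀ g : StrongDual ℝ E × ℝ, IntegralOn Λ g.1 →
      dirs Λ Prod.fst (insert g G) < dirs Λ Prod.fst G →
      (∃ y, IsRationalPoint Λ y ∧ y ∈ flat Λ (insert g G)) →
      ∀ H : Finset (StrongDual ℝ E × ℝ), (∀ h ∈ H, IntegralOn Λ h.1) →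
        (∀ h ∈ H, ∃ q : ℚ, h.2 = q) →
        chi (flat Λ (insert g G) ∩ hpoly Λ H) ∈ coneSpan Λ (insert g G))
    {a : Set E} (ha : IsHCone Λ a) (haG : a ⊆ flat Λ G) {η : StrongDual ℝ E}
    (hη : IntegralOn Λ η) (c : ℚ) : chi (a ∩ {x | η x ≤ c}) ∈ coneSpan Λ G := by
  obtain ⟨H, s, hs, hH, hsH, rfl⟩ := ha
  have hsa : s ∈ hpoly Λ H := ⟨hs.mem_span, fun h hh => (hsH h hh).le⟩
  have hsG := haG hsa
  by_cases hconst : ∀ u ∈ dirs Λ Prod.fst G, η u = 0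
  · have hηs : ∀ x ∈ hpoly Λ H, η x = η s := by
      intro x hx
      have := hconst (x - s) ⟨sub_mem hx.1 hs.mem_span, fun g hg => by
        rw [map_sub, (haG hx).2 g hg, hsG.2 g hg, sub_self]⟩
      rwa [map_sub, sub_eq_zero] at this
    by_cases hle : η s ≤ c
    · have hsub : hpoly Λ H ⊆ {x | η x ≤ c} := fun x hx => (hηs x hx).le.trans hle
      rw [Set.inter_eq_left.2 hsub]
      exact chi_mem_coneSpan ⟨H, s, hs, hH, hsH, rfl⟩ haG
    · have : hpoly Λ H ∩ {x | η x ≤ c} = ∅ := by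
        rw [Set.eq_empty_iff_forall_notMem]
        rintro x ⟨hx, hxc⟩
        exact hle ((hηs x hx).ge.trans hxc)
      rw [this]
      exact chi_empty_mem_coneSpan
  push Not at hconst
  -- a rational point of the flat on the hyperplane
  obtain ⟨u, huΛ, hu, hηu⟩ : ∃ u ∈ Λ, u ∈ dirs Λ Prod.fst G ∧ η u ≠ 0 := by
    by_contra! hcon
    obtain ⟨u, hu, hηu⟩ := hconst
    refine hηu ?_
    have hle : Submodule.span ℝ {x | x ∈ Λ ∧ x ∈ dirs Λ Prod.fst G} ≤
        LinearMap.ker (η : E →ₗ[ℝ] ℝ) := Submodule.span_le.2 fun x hx => hcon x hx.1 hx.2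
    exact hle (dirs_le_span hG hu)
  -- the section of the cone by the hyperplane has smaller dimension
  have hB : chi (hpoly Λ H ∩ {x | η x = c}) ∈ coneSpan Λ (insert (η, (c : ℝ)) G) := by
    have hset : hpoly Λ H ∩ {x | η x = c} = flat Λ (insert (η, (c : ℝ)) G) ∩ hpoly Λ H := by
      ext x
      simp only [flat, Set.mem_inter_iff, Set.mem_ofPred_eq, Finset.forall_mem_insert]
      exact ⟨fun h => ⟨⟨h.1.1, h.2, (haG h.1).2⟩, h.1⟩, fun h => ⟨h.2, h.1.2.1⟩⟩
    rw [hset]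
    refine ih (η, (c : ℝ)) hη ?_ ?_ H hH fun h hh => ?_
    · refine lt_of_le_of_ne (fun x hx => ⟨hx.1, fun i hi => hx.2 i (Finset.mem_insert_of_mem hi)⟩)
        fun h => hηu ?_
      exact (h.ge hu).2 (η, (c : ℝ)) (Finset.mem_insert_self _ _)
    · obtain ⟨q, hq⟩ := hη.exists_rat hs
      obtain ⟨m, hm⟩ := hη u huΛ
      have hm0 : (m : ℝ) ≠ 0 := hm ▸ hηu
      refine ⟨s + (((c - q) / m : ℚ) : ℝ) • u, hs.add ((IsRationalPoint.of_mem huΛ).smul _),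
        add_mem hs.mem_span (Submodule.smul_mem _ _ hu.1), ?_⟩
      rw [Finset.forall_mem_insert]
      refine ⟨?_, fun g hg => ?_⟩
      · rw [map_add, map_smul, hq, hm, smul_eq_mul]
        push_cast
        rw [div_mul_cancel₀ _ hm0]
        ring
      · rw [map_add, map_smul, hu.2 g hg, smul_zero, add_zero, hsG.2 g hg]
    · exact hsH h hh ▸ (hH h hh).exists_rat hs
  have hBG := coneSpan_mono (Finset.subset_insert _ _) hB
  -- the part of a cone beyond a hyperplane that does not contain its vertex
  have hlift : ∀ (θ : StrongDual ℝ E) (d : ℝ), θ s < d →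
      {x : E | θ x = d} = {x | η x = c} →
      chi (hpoly Λ H ∩ {x | d ≤ θ x}) ∈ coneSpan Λ G := by
    intro θ d hlt hset
    rw [← radialExtension_chi_cone hs.mem_span hsH hlt, hset]
    have hle : coneSpan Λ (insert (η, (c : ℝ)) G) ≤
        (coneSpan Λ G).comap (radialExtension s θ d) := by
      refine Submodule.span_le.2 ?_
      rintro _ ⟨b, hb, hbG, rfl⟩
      refine radialExtension_mem_coneSpan hs hsG hlt hb (fun x hx => ⟨(hbG hx).1, fun g hg =>
        (hbG hx).2 g (Finset.mem_insert_of_mem hg)⟩) fun x hx => ?_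
      rw [hset]
      exact (hbG hx).2 (η, (c : ℝ)) (Finset.mem_insert_self _ _)
    exact hle hB
  rcases lt_trichotomy (η s) c with hlt | heq | hgt
  · have hsum : chi (hpoly Λ H ∩ {x | η x ≤ c}) = chi (hpoly Λ H) +
        chi (hpoly Λ H ∩ {x | η x = c}) - chi (hpoly Λ H ∩ {x | c ≤ η x}) := by
      simp only [chi_inter]
      have : chi {x | η x ≤ c} = 1 + chi {x | η x = c} - chi {x | c ≤ η x} := by
        funext x
        rcases lt_trichotomy (η x) c with h | h | h
        · simp [chi, h.le, h.ne, h]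
        · simp [chi, h]
        · simp [chi, h, h.ne', h.le]
      rw [this]
      ring
    rw [hsum]
    refine sub_mem (add_mem (chi_mem_coneSpan ⟨H, s, hs, hH, hsH, rfl⟩ haG) hBG) ?_
    exact hlift η c hlt rfl
  · rw [← heq]
    exact chi_mem_coneSpan (IsHCone.inter_halfspace hs hH hsH hη) fun x hx => haG hx.1
  · have := hlift (-η) (-c) (by simpa using hgt) (by ext x; simp)
    simpa using this

variable [FiniteDimensional ℝ E]

open scoped Classical in
/-- Indicator functions of rational polyhedra are linear combinations of indicator functions of
affine cones. -/
theorem chi_flat_inter_mem_coneSpan (hG : ∀ h ∈ G, IntegralOn Λ h.1)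
    (hy : ∃ y, IsRationalPoint Λ y ∧ y ∈ flat Λ G) (H : Finset (StrongDual ℝ E × ℝ))
    (hH : ∀ h ∈ H, IntegralOn Λ h.1) (hHc : ∀ h ∈ H, ∃ q : ℚ, h.2 = q) :
    chi (flat Λ G ∩ hpoly Λ H) ∈ coneSpan Λ G := by
  generalize hn : Module.finrank ℝ (dirs Λ Prod.fst G) = n
  induction n using Nat.strong_induction_on generalizing G H with
  | _ n ih =>
  induction H using Finset.induction_on with
  | empty =>
    have : flat Λ G ∩ hpoly Λ ∅ = flat Λ G :=
      Set.inter_eq_left.2 fun x hx => ⟨hx.1, by simp⟩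
    rw [this]
    obtain ⟨y, hy, hyG⟩ := hy
    exact chi_mem_coneSpan (isHCone_flat hG hy hyG) subset_rfl
  | insert h H hh ihH =>
    obtain ⟨q, hq⟩ := hHc h (Finset.mem_insert_self _ _)
    have h1 := ihH (fun g hg => hH g (Finset.mem_insert_of_mem hg))
      fun g hg => hHc g (Finset.mem_insert_of_mem hg)
    have hset : flat Λ G ∩ hpoly Λ (insert h H) =
        (flat Λ G ∩ hpoly Λ H) ∩ {x | h.1 x ≤ q} := by
      ext x
      simp only [Set.mem_inter_iff, mem_poly, Set.mem_ofPred_eq, Finset.forall_mem_insert, hq]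
      tauto
    have hle : coneSpan Λ G ≤
        (coneSpan Λ G).comap (LinearMap.mulRight ℝ (chi {x : E | h.1 x ≤ q})) := by
      refine Submodule.span_le.2 ?_
      rintro _ ⟨a, ha, haG, rfl⟩
      change chi a * chi {x : E | h.1 x ≤ q} ∈ coneSpan Λ G
      rw [← chi_inter]
      refine chi_cone_inter_mem_coneSpan hG ?_ ha haG (hH h (Finset.mem_insert_self _ _)) q
      intro g hg hlt hy' H' hH' hHc'
      exact ih _ (hn ▸ Submodule.finrank_lt_finrank_of_lt hlt)
        (Finset.forall_mem_insert _ _ _ |>.2 ⟨hg, hG⟩) hy' H' hH' hHc' rfl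
    rw [hset, chi_inter]
    exact hle h1

end Decomposition

/-! ### The local formula for polyhedra -/

section Polyhedra

variable {E : Type*} [NormedAddCommGroup E] [InnerProductSpace ℝ E] [FiniteDimensional ℝ E]
  [MeasurableSpace E] [BorelSpace E] {Λ : Submodule ℤ E} [DiscreteTopology Λ]

/-- The local formula for polyhedra: both sides satisfy the linear relations between indicator
functions, the indicator function is a combination of those of affine cones, and the formula holds
for affine cones. -/
theorem S_hpoly {H : Finset (StrongDual ℝ E × ℝ)}
    (hH : ∀ h ∈ H, IntegralOn Λ h.1) (hHc : ∀ h ∈ H, ∃ q : ℚ, h.2 = q) :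
    S Λ (hpoly Λ H) = ∑ A ∈ actSets Λ Prod.fst Prod.snd H, muFace Λ Prod.fst Prod.snd A *
      I Λ (face Λ Prod.fst Prod.snd H A) := by
  classical
  have h1 := chi_flat_inter_mem_coneSpan (Λ := Λ) (G := ∅) (by simp)
    ⟨0, .of_mem (zero_mem _), zero_mem _, by simp⟩ H hH hHc
  have hsub : hpoly Λ H ⊆ flat Λ ∅ := fun x hx => ⟨hx.1, by simp⟩
  rw [Set.inter_eq_right.2 hsub, coneSpan, Submodule.mem_span_set'] at h1
  obtain ⟨n, t, g, hsum⟩ := h1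
  -- write the relation as one between the polyhedron, with coefficient `-1`, and cones
  choose a ha hag hg using fun k => (g k).2
  choose Hk s hs hHk hsH haH using ha
  let H' : Option (Fin n) → Finset (StrongDual ℝ E × ℝ) := fun k => k.elim H Hk
  let r : Option (Fin n) → ℝ := fun k => k.elim (-1) t
  have hH' : ∀ k ∈ (Finset.univ : Finset (Option (Fin n))), ∀ i ∈ H' k, IntegralOn Λ i.1 := by
    rintro (_ | k) - i hi
    · exact hH i hi
    · exact hHk k i hi
  have h0 : ∀ x, ∑ k, r k * chi (hpoly Λ (H' k)) x = 0 := by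
    intro x
    have h2 := congrFun hsum x
    rw [Finset.sum_apply] at h2
    rw [Fintype.sum_option]
    change -1 * chi (hpoly Λ H) x + ∑ k, t k * chi (hpoly Λ (Hk k)) x = 0
    rw [← h2]
    simp [hg, haH]
  have h2 := sum_S (fun k hk => isIntPoly_poly (c := Prod.snd) (hH' k hk)) h0
  have h3 := sum_local_formula hH' h0
  rw [Fintype.sum_option] at h2 h3
  have h4 : ∀ k : Fin n, S Λ (hpoly Λ (H' (some k))) =
      ∑ A ∈ actSets Λ Prod.fst Prod.snd (H' (some k)), muFace Λ Prod.fst Prod.snd A *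
        I Λ (face Λ Prod.fst Prod.snd (H' (some k)) A) := fun k =>
    S_cone (hs k).mem_span (hsH k)
  simp only [h4] at h2
  have h5 := add_right_cancel (h2.trans h3.symm)
  have h6 : (constMer (r none) : Mer E) ≠ 0 := by
    rw [← constHom_apply]
    exact (map_ne_zero _).2 (by simp [r])
  exact mul_left_cancel₀ h6 h5

open scoped Classical in
theorem exists_hpoly_of_isPolyhedron {E : Type*} [NormedAddCommGroup E] [InnerProductSpace ℝ E]
    [FiniteDimensional ℝ E] {Λ : Submodule ℤ E} {p : Set E} (hp : IsPolyhedron Λ p) :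
    ∃ H : Finset (StrongDual ℝ E × ℝ), (∀ h ∈ H, IntegralOn Λ h.1) ∧
      (∀ h ∈ H, ∃ q : ℚ, h.2 = q) ∧ p = hpoly Λ H := by
  obtain ⟨H, hH, rfl⟩ := hp
  have hint : ∀ h ∈ H, IntegralOn Λ h.1 := hH
  refine ⟨H.image fun h => (h.1, (h.2 : ℝ)), Finset.forall_mem_image.2 hint,
    Finset.forall_mem_image.2 fun h _ => ⟨h.2, rfl⟩, ?_⟩
  ext x
  rw [mem_poly, Finset.forall_mem_image]
  rfl

/-- The local formula for polyhedra. -/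
theorem local_formula {p : Set E} (hp : IsPolyhedron Λ p) : (faces p).Finite ∧
    S Λ p = ∑ᶠ f ∈ faces p, mu (quotLattice Λ (lin f)) (transverseCone p f) * I Λ f := by
  obtain ⟨H, hH, hHc, rfl⟩ := exists_hpoly_of_isPolyhedron hp
  refine ⟨?_, ?_⟩
  · rw [faces_poly]
    exact (Finset.finite_toSet _).image _
  · rw [finsum_faces_poly, S_hpoly hH hHc]

end Polyhedra

/-! ### Isometries and translations -/

section VertexTerm

variable {E : Type*} [NormedAddCommGroup E] [InnerProductSpace ℝ E] [FiniteDimensional ℝ E]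
  {ι : Type*} {Λ : Submodule ℤ E} {η : ι → StrongDual ℝ E} {c : ι → ℝ} {H A : Finset ι}

theorem quotProj_mem_span_quotLattice {L : Submodule ℝ E} {x : E}
    (hx : x ∈ Submodule.span ℝ (Λ : Set E)) :
    quotProj L x ∈ Submodule.span ℝ (quotLattice Λ L : Set E) := by
  have h := Submodule.mem_map_of_mem (f := (quotProj L : E →ₗ[ℝ] E)) hx
  rw [Submodule.map_span] at h
  exact h

/-- Transverse cones are affine cones. -/
theorem exists_vertex_quotLattice (hA : A ∈ actSets Λ η c H) :
    ∃ s ∈ Submodule.span ℝ (quotLattice Λ (dirs Λ η A) : Set E), ∀ i ∈ A, η i s = c i := by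
  obtain ⟨y, hy⟩ := face_nonempty hA
  refine ⟨quotProj (dirs Λ η A) y, quotProj_mem_span_quotLattice hy.1.1, fun i hi => ?_⟩
  have h : ∀ v ∈ dirs Λ η A, η i v = 0 := fun v hv => hv.2 i hi
  rw [apply_quotProj h, hy.2 i hi]

/-- In a sum over the faces of a pointed cone in which the terms of the faces of positive dimension
vanish, the coefficient of the vertex is determined. -/
theorem eq_zero_of_sum_faces [MeasurableSpace E] [BorelSpace E] [DiscreteTopology Λ] {s : E}
    (hs : s ∈ Submodule.span ℝ (Λ : Set E)) (hsH : ∀ i ∈ H, η i s = c i) (h : dirs Λ η H = ⊥)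
    {d : Finset ι → Mer E} (hd : ∀ A ∈ actSets Λ η c H, dirs Λ η A ≠ ⊥ → d A = 0)
    (hsum : ∑ A ∈ actSets Λ η c H, d A * I Λ (face Λ η c H A) = 0) : d H = 0 := by
  rw [Finset.sum_eq_single H, face_self hs hsH h, I_singleton] at hsum
  · exact (mul_eq_zero.1 hsum).resolve_right (expMer_ne_zero s)
  · intro A hA hne
    rw [hd A hA fun h0 => hne (eq_of_dirs_eq_bot hs hsH hA h0), zero_mul]
  · exact fun h => (h (self_mem_actSets hs hsH)).elim

/-- The normalized measure of a subspace in terms of a parametrization of the subspace. -/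
theorem latticeMeasure_eq_map [MeasurableSpace E] [BorelSpace E] {κ V : Type*} [Fintype κ]
    [NormedAddCommGroup V] [NormedSpace ℝ V] [MeasurableSpace V] [BorelSpace V] {L : Submodule ℝ E}
    (b : Module.Basis κ ℝ V) (e : V ≃L[ℝ] L)
    (hb : ∀ v, v ∈ Submodule.span ℤ (Set.range b) ↔ (e v : E) ∈ Λ) :
    latticeMeasure Λ L = b.addHaar.map e := by
  rw [Module.Basis.map_addHaar]
  refine latticeMeasure_eq_addHaar _ ?_
  have h1 : Set.range (b.map e.toLinearEquiv) =
      ((e.toLinearEquiv : V →ₗ[ℝ] L).restrictScalars ℤ) '' Set.range b := by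
    rw [← Set.range_comp]
    rfl
  rw [h1, ← Submodule.map_span]
  ext y
  constructor
  · rintro ⟨v, hv, rfl⟩
    exact (hb v).1 hv
  · intro hy
    refine ⟨e.symm y, (hb _).2 ?_, e.apply_symm_apply y⟩
    rwa [e.apply_symm_apply]

end VertexTerm

section Isometry

variable {E : Type*} [NormedAddCommGroup E] [InnerProductSpace ℝ E]
  {ι : Type*} {Λ : Submodule ℤ E} {η : ι → StrongDual ℝ E} {c : ι → ℝ} {H A : Finset ι}
  {g : E ≃ₗᵢ[ℝ] E} {x : E}

/-- The action `ξ ↦ ξ ∘ g⁻¹` of an isometry on linear forms. -/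
noncomputable abbrev dualMap (g : E ≃ₗᵢ[ℝ] E) : StrongDual ℝ E ≃L[ℝ] StrongDual ℝ E :=
  g.toContinuousLinearEquiv.arrowCongr (ContinuousLinearEquiv.refl ℝ ℝ)

theorem dualMap_apply (ξ : StrongDual ℝ E) (y : E) : dualMap g ξ y = ξ (g.symm y) := rfl

theorem dualMap_apply_self (ξ : StrongDual ℝ E) (y : E) : dualMap g ξ (g y) = ξ y := by
  rw [dualMap_apply, g.symm_apply_apply]

/-- The image of a lattice under an isometry. -/
def mapLattice (g : E ≃ₗᵢ[ℝ] E) (Λ : Submodule ℤ E) : Submodule ℤ E :=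
  Λ.map ((g.toLinearEquiv : E →ₗ[ℝ] E).restrictScalars ℤ)

theorem mem_mapLattice {y : E} : g y ∈ mapLattice g Λ ↔ y ∈ Λ :=
  ⟨fun ⟨_, hz, h⟩ => g.injective h ▸ hz, fun h => ⟨y, h, rfl⟩⟩

theorem mem_span_mapLattice {y : E} : g y ∈ Submodule.span ℝ (mapLattice g Λ : Set E) ↔
    y ∈ Submodule.span ℝ (Λ : Set E) := by
  have h : Submodule.span ℝ (mapLattice g Λ : Set E) =
      (Submodule.span ℝ (Λ : Set E)).map (g.toLinearEquiv : E →ₗ[ℝ] E) := by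
    rw [Submodule.map_span]
    rfl
  rw [h]
  exact ⟨fun ⟨_, hz, h⟩ => g.injective h ▸ hz, fun h => ⟨y, h, rfl⟩⟩

theorem discreteTopology_mapLattice [DiscreteTopology Λ] :
    DiscreteTopology (mapLattice g Λ) := by
  have hmem : ∀ z : mapLattice g Λ, g.symm z ∈ Λ := fun z => by
    rw [← mem_mapLattice (g := g), g.apply_symm_apply]
    exact z.2
  let f : mapLattice g Λ → Λ := fun z => ⟨g.symm z, hmem z⟩
  refine DiscreteTopology.of_continuous_injective (f := f)
    ((g.symm.continuous.comp continuous_subtype_val).subtype_mk hmem) fun z w h => ?_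
  exact Subtype.ext (g.symm.injective (congrArg Subtype.val h))

theorem IntegralOn.dualMap {η : StrongDual ℝ E} (h : IntegralOn Λ η) :
    IntegralOn (mapLattice g Λ) (dualMap g η) := by
  rintro _ ⟨y, hy, rfl⟩
  obtain ⟨n, hn⟩ := h y hy
  exact ⟨n, (dualMap_apply_self η y).trans hn⟩

theorem dirs_mapLattice : dirs (mapLattice g Λ) (fun i => dualMap g (η i)) A =
    (dirs Λ η A).map (g.toLinearEquiv : E →ₗ[ℝ] E) := by
  ext z
  obtain ⟨y, rfl⟩ := g.surjective z
  rw [mem_dirs, mem_span_mapLattice]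
  simp only [dualMap_apply_self]
  exact ⟨fun h => ⟨y, h, rfl⟩, fun ⟨_, hw, h⟩ => g.injective h ▸ hw⟩

section Translate

variable (hx : x ∈ Submodule.span ℝ (mapLattice g Λ : Set E))
include hx

theorem add_map_mem_poly {y : E} :
    x + g y ∈ poly (mapLattice g Λ) (fun i => dualMap g (η i)) (fun i => c i + dualMap g (η i) x)
      H ↔ y ∈ poly Λ η c H := by
  rw [mem_poly, mem_poly, Submodule.add_mem_iff_right _ hx, mem_span_mapLattice]
  refine and_congr_right fun _ => forall₂_congr fun i _ => ?_
  rw [map_add, dualMap_apply_self, add_comm, add_le_add_iff_right]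

omit hx in
theorem actIneq_add_map {y : E} :
    actIneq (fun i => dualMap g (η i)) (fun i => c i + dualMap g (η i) x) H (x + g y) =
      actIneq η c H y := by
  ext i
  rw [mem_actIneq, mem_actIneq, map_add, dualMap_apply_self, add_comm, add_left_inj]

omit hx in
theorem exists_add_map (z : E) : ∃ y, x + g y = z := ⟨g.symm (z - x), by simp⟩

theorem poly_mapLattice :
    poly (mapLattice g Λ) (fun i => dualMap g (η i)) (fun i => c i + dualMap g (η i) x) H =
      (fun y => x + g y) '' poly Λ η c H := by
  ext z
  obtain ⟨y, rfl⟩ := exists_add_map (g := g) (x := x) z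
  rw [add_map_mem_poly hx]
  exact ⟨fun h => ⟨y, h, rfl⟩, fun ⟨_, hw, h⟩ => g.injective (add_left_cancel h) ▸ hw⟩

theorem actSets_mapLattice :
    actSets (mapLattice g Λ) (fun i => dualMap g (η i)) (fun i => c i + dualMap g (η i) x) H =
      actSets Λ η c H := by
  ext A
  rw [mem_actSets, mem_actSets]
  constructor
  · rintro ⟨z, hz, rfl⟩
    obtain ⟨y, rfl⟩ := exists_add_map (g := g) (x := x) z
    exact ⟨y, (add_map_mem_poly hx).1 hz, actIneq_add_map.symm⟩
  · rintro ⟨y, hy, rfl⟩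
    exact ⟨x + g y, (add_map_mem_poly hx).2 hy, actIneq_add_map⟩

theorem face_mapLattice :
    face (mapLattice g Λ) (fun i => dualMap g (η i)) (fun i => c i + dualMap g (η i) x) H A =
      (fun y => x + g y) '' face Λ η c H A := by
  ext z
  obtain ⟨y, rfl⟩ := exists_add_map (g := g) (x := x) z
  have h : x + g y ∈ face (mapLattice g Λ) (fun i => dualMap g (η i))
      (fun i => c i + dualMap g (η i) x) H A ↔ y ∈ face Λ η c H A := by
    rw [mem_face, mem_face, add_map_mem_poly hx]
    refine and_congr_right fun _ => forall₂_congr fun i _ => ?_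
    rw [map_add, dualMap_apply_self, add_comm, add_left_inj]
  rw [h]
  exact ⟨fun h => ⟨y, h, rfl⟩, fun ⟨_, hw, h⟩ => g.injective (add_left_cancel h) ▸ hw⟩

end Translate

theorem containsLine_add_map {p : Set E} :
    ContainsLine ((fun y => x + g y) '' p) ↔ ContainsLine p := by
  constructor
  · rintro ⟨y, v, hv, h⟩
    refine ⟨g.symm (y - x), g.symm v, by simpa using hv, fun t => ?_⟩
    obtain ⟨z, hz, e⟩ := h t
    have : z = g.symm (y - x) + t • g.symm v := by
      rw [← map_smul, ← map_add, g.eq_symm_apply, sub_add_eq_add_sub, eq_sub_iff_add_eq, ← e]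
      exact add_comm _ _
    rwa [← this]
  · rintro ⟨y, v, hv, h⟩
    refine ⟨x + g y, g v, by simpa using hv, fun t => ⟨_, h t, ?_⟩⟩
    simp [add_assoc]

theorem exp_dualMap_add (ξ : StrongDual ℝ E) (y : E) :
    Real.exp (dualMap g ξ (x + g y)) = Real.exp (ξ (g.symm x)) * Real.exp (ξ y) := by
  rw [map_add, dualMap_apply_self, dualMap_apply, Real.exp_add]

variable [FiniteDimensional ℝ E]

theorem quotProj_map (L : Submodule ℝ E) (y : E) :
    quotProj (L.map (g.toLinearEquiv : E →ₗ[ℝ] E)) (g y) = g (quotProj L y) := by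
  refine quotProj_eq_of_sub_mem ?_ ⟨_, sub_quotProj_mem L y, map_sub g _ _⟩
  rintro _ ⟨u, hu, rfl⟩
  have := quotProj_mem L y u hu
  rw [← g.inner_map_map] at this
  exact this

theorem quotLattice_mapLattice (L : Submodule ℝ E) :
    quotLattice (mapLattice g Λ) (L.map (g.toLinearEquiv : E →ₗ[ℝ] E)) =
      mapLattice g (quotLattice Λ L) := by
  ext z
  constructor
  · rintro ⟨_, ⟨y, hy, rfl⟩, rfl⟩
    exact ⟨quotProj L y, ⟨y, hy, rfl⟩, (quotProj_map L y).symm⟩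
  · rintro ⟨_, ⟨y, hy, rfl⟩, rfl⟩
    exact ⟨g y, ⟨y, hy, rfl⟩, quotProj_map L y⟩

variable [MeasurableSpace E] [BorelSpace E] [DiscreteTopology Λ]

/-- Transport of sums over lattice points along `y ↦ x + g y`. -/
theorem comp_S {p : Set E} (hp : IsIntPoly Λ p)
    (hp' : IsIntPoly (mapLattice g Λ) ((fun y => x + g y) '' p)) (hne : p.Nonempty)
    (hx : x ∈ mapLattice g Λ) :
    Mer.comp (dualMap g) (S (mapLattice g Λ) ((fun y => x + g y) '' p)) =
      expMer (g.symm x) * S Λ p := by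
  have := discreteTopology_mapLattice (g := g) (Λ := Λ)
  by_cases hl : ContainsLine p
  · rw [S_eq_zero_of_containsLine hl, S_eq_zero_of_containsLine (containsLine_add_map.2 hl),
      map_zero, mul_zero]
  have hinj : Function.Injective fun y => x + g y := fun y z h => g.injective (add_left_cancel h)
  have hset : (fun y => x + g y) '' p ∩ (mapLattice g Λ : Set E) =
      (fun y => x + g y) '' (p ∩ (Λ : Set E)) := by
    ext z
    obtain ⟨y, rfl⟩ := exists_add_map (g := g) (x := x) z
    have h1 : x + g y ∈ mapLattice g Λ ↔ y ∈ Λ :=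
      (Submodule.add_mem_iff_right _ hx).trans mem_mapLattice
    rw [Set.mem_inter_iff, hinj.mem_set_image, hinj.mem_set_image, SetLike.mem_coe, h1]
    rfl
  have hsum : ∀ ξ : StrongDual ℝ E, ξ ∈ negForms p →
      Summable fun y : ↥(p ∩ (Λ : Set E)) => Real.exp (dualMap g ξ (x + g y)) := by
    intro ξ hξ
    simp only [exp_dualMap_add]
    exact (summable_exp_of_mem_negForms hp hξ).mul_left _
  refine ((agreesOn_S hp').comp (dualMap g)).unique
    ((agreesOn_toMer (analyticAt_exp_pairing (g.symm x)) Set.univ).mul (agreesOn_S hp))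
    (U := negForms p) (fun ξ hξ => ?_)
    (fun ξ hξ => ⟨trivial, summable_exp_of_mem_negForms hp hξ⟩)
    (hp.zero_mem_closure_interior hne hl) fun ξ hξ => ?_
  · change Summable fun z : ↥((fun y => x + g y) '' p ∩ (mapLattice g Λ : Set E)) =>
      Real.exp (dualMap g ξ z)
    rw [hset]
    exact (Equiv.Set.image _ _ hinj).summable_iff.1 (hsum ξ hξ)
  · change ∑' z : ↥((fun y => x + g y) '' p ∩ (mapLattice g Λ : Set E)),
      Real.exp (dualMap g ξ z) = _
    rw [hset, tsum_image (fun z => Real.exp (dualMap g ξ z)) hinj.injOn, ← tsum_mul_left]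
    exact tsum_congr fun y => exp_dualMap_add ξ y

/-- An isometry of lattices transports the normalized measures of affine subspaces. -/
theorem translateMeasure_map {L L' : Submodule ℝ E} (hL : IsRatSubspace Λ L)
    (hL' : L.map (g.toLinearEquiv : E →ₗ[ℝ] E) = L') (y : E) :
    translateMeasure (mapLattice g Λ) L' (x + g y) =
      (translateMeasure Λ L y).map fun z => x + g z := by
  obtain ⟨b, hb⟩ := exists_latticeBasis Λ hL
  let e : L ≃L[ℝ] L' := (g.toLinearEquiv.ofSubmodules L L' hL').toContinuousLinearEquiv
  have he : ∀ v : L, (e v : E) = g v := fun v => rfl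
  have h1 : latticeMeasure (mapLattice g Λ) L' = (latticeMeasure Λ L).map e := by
    rw [latticeMeasure_eq_addHaar b hb]
    refine latticeMeasure_eq_map b e fun v => ?_
    rw [he, mem_mapLattice, hb]
    rfl
  have hc : Continuous e := e.continuous
  have hg : Continuous g := g.continuous
  rw [translateMeasure, translateMeasure, h1, Measure.map_map (by fun_prop) hc.measurable,
    Measure.map_map (by fun_prop) (by fun_prop)]
  congr 1
  funext v
  simp only [Function.comp_apply, he, map_add, add_assoc]

/-- Transport of lattice-normalized integrals along `y ↦ x + g y`. -/
theorem comp_I {p : Set E} (hp : IsIntPoly Λ p)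
    (hp' : IsIntPoly (mapLattice g Λ) ((fun y => x + g y) '' p)) (hne : p.Nonempty)
    (hL : IsRatSubspace Λ (lin p))
    (hL' : IsRatSubspace (mapLattice g Λ) (lin ((fun y => x + g y) '' p)))
    (hlin : (lin p).map (g.toLinearEquiv : E →ₗ[ℝ] E) = lin ((fun y => x + g y) '' p)) :
    Mer.comp (dualMap g) (I (mapLattice g Λ) ((fun y => x + g y) '' p)) =
      expMer (g.symm x) * I Λ p := by
  have := discreteTopology_mapLattice (g := g) (Λ := Λ)
  by_cases hl : ContainsLine p
  · rw [I_eq_zero_of_containsLine hl, I_eq_zero_of_containsLine (containsLine_add_map.2 hl),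
      map_zero, mul_zero]
  obtain ⟨y₀, hy₀⟩ := hne
  have hinj : Function.Injective fun y => x + g y := fun y z h => g.injective (add_left_cancel h)
  have hemb : MeasurableEmbedding fun y => x + g y :=
    (measurableEmbedding_addLeft x).comp g.toHomeomorph.measurableEmbedding
  have hmeas : affineMeasure (mapLattice g Λ) ((fun y => x + g y) '' p) =
      (affineMeasure Λ p).map fun y => x + g y := by
    rw [affineMeasure_eq hL hy₀, affineMeasure_eq hL' (Set.mem_image_of_mem _ hy₀),
      translateMeasure_map hL hlin]
  have hpre : (fun y => x + g y) ⁻¹' ((fun y => x + g y) '' p) = p := hinj.preimage_image p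
  refine ((agreesOn_I hp' hL' (Set.Nonempty.image _ ⟨y₀, hy₀⟩)).comp (dualMap g)).unique
    ((agreesOn_toMer (analyticAt_exp_pairing (g.symm x)) Set.univ).mul
      (agreesOn_I hp hL ⟨y₀, hy₀⟩))
    (U := negForms p) (fun ξ hξ => ?_)
    (fun ξ hξ => ⟨trivial, integrableOn_exp_of_mem_negForms hp hL ⟨y₀, hy₀⟩ hξ⟩)
    (hp.zero_mem_closure_interior ⟨y₀, hy₀⟩ hl) fun ξ hξ => ?_
  · change IntegrableOn (fun z => Real.exp (dualMap g ξ z)) _ _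
    rw [hmeas, hemb.integrableOn_map_iff, hpre]
    refine ((integrableOn_exp_of_mem_negForms hp hL ⟨y₀, hy₀⟩ hξ).const_mul
      (Real.exp (ξ (g.symm x)))).congr (Filter.Eventually.of_forall fun y => ?_)
    exact (exp_dualMap_add ξ y).symm
  · change ∫ z in (fun y => x + g y) '' p, Real.exp (dualMap g ξ z)
      ∂affineMeasure (mapLattice g Λ) ((fun y => x + g y) '' p) = _
    rw [hmeas, hemb.setIntegral_map, hpre, ← integral_const_mul]
    simp only [exp_dualMap_add]

omit [FiniteDimensional ℝ E] [MeasurableSpace E] [BorelSpace E] [DiscreteTopology Λ] in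
theorem poly_congr {c' : ι → ℝ} (h : ∀ i ∈ A, c i = c' i) : poly Λ η c A = poly Λ η c' A := by
  ext x
  rw [mem_poly, mem_poly]
  exact and_congr_right fun _ => forall₂_congr fun i hi => by rw [h i hi]

omit [DiscreteTopology Λ] in
/-- The function `μ` commutes with isometries of lattices and is invariant under translations by
lattice vectors.  The map `y ↦ x + g y` multiplies `S`, and `I` of all faces, by the same
exponential; by induction the terms of the faces of positive dimension in `S_cone` correspond to
each other, hence so do the terms of the vertices. -/
theorem comp_mu (g : E ≃ₗᵢ[ℝ] E) {Λ : Submodule ℤ E} [DiscreteTopology Λ] {x s : E}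
    (hH : ∀ i ∈ H, IntegralOn Λ (η i)) (hs : s ∈ Submodule.span ℝ (Λ : Set E))
    (hsH : ∀ i ∈ H, η i s = c i) (hx : x ∈ mapLattice g Λ) :
    Mer.comp (dualMap g) (mu (mapLattice g Λ) (poly (mapLattice g Λ) (fun i => dualMap g (η i))
      (fun i => c i + dualMap g (η i) x) H)) = mu Λ (poly Λ η c H) := by
  generalize hn : Module.finrank ℝ (Submodule.span ℝ (Λ : Set E)) = n
  induction n using Nat.strong_induction_on generalizing Λ H x s with
  | _ n ih =>
  have := discreteTopology_mapLattice (g := g) (Λ := Λ)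
  have hxs := mem_span_of_mem hx
  have hne : (poly Λ η c H).Nonempty := ⟨s, mem_poly_of_forall_eq hs hsH⟩
  by_cases hbot : dirs Λ η H = ⊥
  swap
  · have hl := (containsLine_poly_iff hne).2 hbot
    rw [mu_eq_zero_of_containsLine hl, poly_mapLattice hxs,
      mu_eq_zero_of_containsLine (containsLine_add_map.2 hl), map_zero]
  have hH' : ∀ i ∈ H, IntegralOn (mapLattice g Λ) (dualMap g (η i)) := fun i hi =>
    (hH i hi).dualMap
  have hs' : x + g s ∈ Submodule.span ℝ (mapLattice g Λ : Set E) :=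
    add_mem hxs (mem_span_mapLattice.2 hs)
  have hsH' : ∀ i ∈ H, dualMap g (η i) (x + g s) = c i + dualMap g (η i) x := fun i hi => by
    rw [map_add, dualMap_apply_self, hsH i hi, add_comm]
  -- the difference of the coefficients of corresponding faces
  let d : Finset ι → Mer E := fun A => Mer.comp (dualMap g) (muFace (mapLattice g Λ)
    (fun i => dualMap g (η i)) (fun i => c i + dualMap g (η i) x) A) - muFace Λ η c A
  have hd : ∀ A ∈ actSets Λ η c H, dirs Λ η A ≠ ⊥ → d A = 0 := by
    intro A hA hA0
    have hAH := subset_of_mem_actSets hA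
    have hHA : ∀ i ∈ A, IntegralOn Λ (η i) := fun i hi => hH i (hAH hi)
    have := discreteTopology_quotLattice hHA
    obtain ⟨s₁, hs₁, hsA⟩ := exists_vertex_quotLattice hA
    have hx₁ : quotProj ((dirs Λ η A).map (g.toLinearEquiv : E →ₗ[ℝ] E)) x ∈
        mapLattice g (quotLattice Λ (dirs Λ η A)) := by
      rw [← quotLattice_mapLattice]
      exact ⟨x, hx, rfl⟩
    have h1 := ih _ (hn ▸ finrank_span_quotLattice_lt dirs_le_span_lattice hA0)
      (integralOn_quotLattice_dirs hHA) hs₁ hsA hx₁ rfl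
    simp only [d, sub_eq_zero, muFace, dirs_mapLattice, quotLattice_mapLattice]
    rw [← h1]
    congr 2
    refine poly_congr fun i hi => ?_
    rw [apply_quotProj]
    rintro _ ⟨v, hv, rfl⟩
    exact (dualMap_apply_self (η i) v).trans (hv.2 i hi)
  have hface : ∀ A ∈ actSets Λ η c H, Mer.comp (dualMap g) (I (mapLattice g Λ)
      (face (mapLattice g Λ) (fun i => dualMap g (η i)) (fun i => c i + dualMap g (η i) x) H A)) =
      expMer (g.symm x) * I Λ (face Λ η c H A) := by
    intro A hA
    have hA' := hA
    rw [← actSets_mapLattice hxs] at hA'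
    have hint := isIntPoly_face (c := fun i => c i + dualMap g (η i) x) hH'
      (subset_of_mem_actSets hA)
    have hrat := isRatSubspace_lin_face hH' hA'
    have hlin : lin (face (mapLattice g Λ) (fun i => dualMap g (η i))
        (fun i => c i + dualMap g (η i) x) H A) =
        (lin (face Λ η c H A)).map (g.toLinearEquiv : E →ₗ[ℝ] E) := by
      rw [lin, lin, lin_face hA', lin_face hA, dirs_mapLattice]
    rw [face_mapLattice hxs] at hint hrat hlin ⊢
    exact comp_I (isIntPoly_face hH (subset_of_mem_actSets hA)) hint (face_nonempty hA)
      (isRatSubspace_lin_face hH hA) hrat hlin.symm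
  have hS : Mer.comp (dualMap g) (S (mapLattice g Λ) (poly (mapLattice g Λ)
      (fun i => dualMap g (η i)) (fun i => c i + dualMap g (η i) x) H)) =
      expMer (g.symm x) * S Λ (poly Λ η c H) := by
    have hint := isIntPoly_poly (c := fun i => c i + dualMap g (η i) x) hH'
    rw [poly_mapLattice hxs] at hint ⊢
    exact comp_S (isIntPoly_poly hH) hint hne hx
  have hsum : ∑ A ∈ actSets Λ η c H, d A * I Λ (face Λ η c H A) = 0 := by
    refine mul_left_cancel₀ (expMer_ne_zero (g.symm x)) ?_
    rw [S_cone hs' hsH', S_cone hs hsH, map_sum, actSets_mapLattice hxs, Finset.mul_sum,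
      ← sub_eq_zero, ← Finset.sum_sub_distrib] at hS
    rw [mul_zero, ← hS, Finset.mul_sum]
    refine Finset.sum_congr rfl fun A hA => ?_
    rw [map_mul, hface A hA, mul_left_comm, mul_left_comm (expMer _) (muFace Λ η c A), ← sub_mul]
  have h2 := eq_zero_of_sum_faces hs hsH hbot hd hsum
  have hbot' : dirs (mapLattice g Λ) (fun i => dualMap g (η i)) H = ⊥ := by
    rw [dirs_mapLattice, hbot, Submodule.map_bot]
  simpa only [d, sub_eq_zero, muFace_of_dirs_eq_bot hbot, muFace_of_dirs_eq_bot hbot'] using h2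

end Isometry

/-! ### Orthogonal sums -/

section OrthogonalSum

variable {E : Type*} [NormedAddCommGroup E] [InnerProductSpace ℝ E] {ι : Type*}

/-- Two orthogonal lattices, with inequalities in `H₁` that only involve the span of the first one
and inequalities in `H₂` that only involve the span of the second one. -/
structure OrthSum (Λ₁ Λ₂ : Submodule ℤ E) (η : ι → StrongDual ℝ E) (H₁ H₂ : Finset ι) : Prop where
  orth : ∀ x ∈ Submodule.span ℝ (Λ₁ : Set E), ∀ y ∈ Submodule.span ℝ (Λ₂ : Set E), inner ℝ x y = 0
  left : ∀ i ∈ H₁, ∀ v ∈ Submodule.span ℝ (Λ₂ : Set E), η i v = 0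
  right : ∀ i ∈ H₂, ∀ v ∈ Submodule.span ℝ (Λ₁ : Set E), η i v = 0

variable {Λ₁ Λ₂ : Submodule ℤ E} {η : ι → StrongDual ℝ E} {c : ι → ℝ} {H₁ H₂ A₁ A₂ : Finset ι}

theorem OrthSum.mono (h : OrthSum Λ₁ Λ₂ η H₁ H₂) (h₁ : A₁ ⊆ H₁) (h₂ : A₂ ⊆ H₂) :
    OrthSum Λ₁ Λ₂ η A₁ A₂ :=
  ⟨h.orth, fun i hi => h.left i (h₁ hi), fun i hi => h.right i (h₂ hi)⟩

theorem span_sup_lattice : Submodule.span ℝ ((Λ₁ ⊔ Λ₂ : Submodule ℤ E) : Set E) =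
    Submodule.span ℝ (Λ₁ : Set E) ⊔ Submodule.span ℝ (Λ₂ : Set E) := by
  refine le_antisymm (Submodule.span_le.2 fun x hx => ?_)
    (sup_le (Submodule.span_mono (le_sup_left (a := Λ₁)))
      (Submodule.span_mono (le_sup_right (b := Λ₂))))
  obtain ⟨y, hy, z, hz, rfl⟩ := Submodule.mem_sup.1 hx
  exact add_mem (Submodule.mem_sup_left (mem_span_of_mem hy))
    (Submodule.mem_sup_right (mem_span_of_mem hz))

theorem exists_add_of_mem_span_sup {x : E}
    (hx : x ∈ Submodule.span ℝ ((Λ₁ ⊔ Λ₂ : Submodule ℤ E) : Set E)) :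
    ∃ x₁ ∈ Submodule.span ℝ (Λ₁ : Set E), ∃ x₂ ∈ Submodule.span ℝ (Λ₂ : Set E), x₁ + x₂ = x := by
  rw [span_sup_lattice] at hx
  exact Submodule.mem_sup.1 hx

/-- Uniqueness of the components in an orthogonal sum. -/
theorem add_eq_add_of_orth {W₁ W₂ : Submodule ℝ E} (h : ∀ x ∈ W₁, ∀ y ∈ W₂, inner ℝ x y = 0)
    {x₁ y₁ x₂ y₂ : E} (hx₁ : x₁ ∈ W₁) (hy₁ : y₁ ∈ W₁) (hx₂ : x₂ ∈ W₂) (hy₂ : y₂ ∈ W₂)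
    (e : x₁ + x₂ = y₁ + y₂) : x₁ = y₁ ∧ x₂ = y₂ := by
  have h1 : x₁ - y₁ = y₂ - x₂ := by
    rw [sub_eq_sub_iff_add_eq_add, e, add_comm]
  have h2 : x₁ - y₁ = 0 := by
    have := h _ (sub_mem hx₁ hy₁) _ (sub_mem hy₂ hx₂)
    rw [← h1] at this
    exact inner_self_eq_zero.1 this
  refine ⟨sub_eq_zero.1 h2, ?_⟩
  rw [h2] at h1
  exact (sub_eq_zero.1 h1.symm).symm

section

variable (h : OrthSum Λ₁ Λ₂ η H₁ H₂) {x₁ x₂ : E}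
  (hx₁ : x₁ ∈ Submodule.span ℝ (Λ₁ : Set E)) (hx₂ : x₂ ∈ Submodule.span ℝ (Λ₂ : Set E))
include h

theorem OrthSum.mem_lattice_iff (hx₁ : x₁ ∈ Submodule.span ℝ (Λ₁ : Set E))
    (hx₂ : x₂ ∈ Submodule.span ℝ (Λ₂ : Set E)) :
    x₁ + x₂ ∈ Λ₁ ⊔ Λ₂ ↔ x₁ ∈ Λ₁ ∧ x₂ ∈ Λ₂ := by
  refine ⟨fun hx => ?_, fun hx => Submodule.add_mem_sup hx.1 hx.2⟩
  obtain ⟨y₁, hy₁, y₂, hy₂, e⟩ := Submodule.mem_sup.1 hx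
  obtain ⟨rfl, rfl⟩ := add_eq_add_of_orth h.orth (mem_span_of_mem hy₁) hx₁
    (mem_span_of_mem hy₂) hx₂ e
  exact ⟨hy₁, hy₂⟩

include hx₂ in
theorem OrthSum.apply_left {i : ι} (hi : i ∈ H₁) : η i (x₁ + x₂) = η i x₁ := by
  rw [map_add, h.left i hi _ hx₂, add_zero]

include hx₁ in
theorem OrthSum.apply_right {i : ι} (hi : i ∈ H₂) : η i (x₁ + x₂) = η i x₂ := by
  rw [map_add, h.right i hi _ hx₁, zero_add]

variable [DecidableEq ι]

include hx₁ hx₂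

theorem OrthSum.add_mem_poly : x₁ + x₂ ∈ poly (Λ₁ ⊔ Λ₂) η c (H₁ ∪ H₂) ↔
    x₁ ∈ poly Λ₁ η c H₁ ∧ x₂ ∈ poly Λ₂ η c H₂ := by
  have hmem : x₁ + x₂ ∈ Submodule.span ℝ ((Λ₁ ⊔ Λ₂ : Submodule ℤ E) : Set E) := by
    rw [span_sup_lattice]
    exact Submodule.add_mem_sup hx₁ hx₂
  simp only [mem_poly, hmem, hx₁, hx₂, true_and, Finset.mem_union, or_imp, forall_and]
  refine and_congr (forall₂_congr fun i hi => ?_) (forall₂_congr fun i hi => ?_)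
  · rw [h.apply_left hx₂ hi]
  · rw [h.apply_right hx₁ hi]

theorem OrthSum.add_mem_dirs : x₁ + x₂ ∈ dirs (Λ₁ ⊔ Λ₂) η (H₁ ∪ H₂) ↔
    x₁ ∈ dirs Λ₁ η H₁ ∧ x₂ ∈ dirs Λ₂ η H₂ := by
  have hmem : x₁ + x₂ ∈ Submodule.span ℝ ((Λ₁ ⊔ Λ₂ : Submodule ℤ E) : Set E) := by
    rw [span_sup_lattice]
    exact Submodule.add_mem_sup hx₁ hx₂
  simp only [mem_dirs, hmem, hx₁, hx₂, true_and, Finset.mem_union, or_imp, forall_and]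
  refine and_congr (forall₂_congr fun i hi => ?_) (forall₂_congr fun i hi => ?_)
  · rw [h.apply_left hx₂ hi]
  · rw [h.apply_right hx₁ hi]

theorem OrthSum.actIneq_add :
    actIneq η c (H₁ ∪ H₂) (x₁ + x₂) = actIneq η c H₁ x₁ ∪ actIneq η c H₂ x₂ := by
  ext i
  simp only [mem_actIneq, Finset.mem_union, or_and_right]
  refine or_congr (and_congr_right fun hi => ?_) (and_congr_right fun hi => ?_)
  · rw [h.apply_left hx₂ hi]
  · rw [h.apply_right hx₁ hi]

omit hx₁ in
theorem OrthSum.actIneq_inter_left :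
    actIneq η c (H₁ ∪ H₂) (x₁ + x₂) ∩ H₁ = actIneq η c H₁ x₁ := by
  ext i
  simp only [mem_actIneq, Finset.mem_inter, Finset.mem_union]
  constructor
  · rintro ⟨⟨-, e⟩, hi⟩
    exact ⟨hi, (h.apply_left hx₂ hi).symm.trans e⟩
  · rintro ⟨hi, e⟩
    exact ⟨⟨Or.inl hi, (h.apply_left hx₂ hi).trans e⟩, hi⟩

omit hx₂ in
theorem OrthSum.actIneq_inter_right :
    actIneq η c (H₁ ∪ H₂) (x₁ + x₂) ∩ H₂ = actIneq η c H₂ x₂ := by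
  ext i
  simp only [mem_actIneq, Finset.mem_inter, Finset.mem_union]
  constructor
  · rintro ⟨⟨-, e⟩, hi⟩
    exact ⟨hi, (h.apply_right hx₁ hi).symm.trans e⟩
  · rintro ⟨hi, e⟩
    exact ⟨⟨Or.inr hi, (h.apply_right hx₁ hi).trans e⟩, hi⟩

end

section

variable [DecidableEq ι] (h : OrthSum Λ₁ Λ₂ η H₁ H₂)
include h

theorem OrthSum.poly_eq :
    poly (Λ₁ ⊔ Λ₂) η c (H₁ ∪ H₂) = poly Λ₁ η c H₁ + poly Λ₂ η c H₂ := by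
  ext x
  constructor
  · intro hx
    obtain ⟨x₁, hx₁, x₂, hx₂, rfl⟩ := exists_add_of_mem_span_sup hx.1
    obtain ⟨h1, h2⟩ := (h.add_mem_poly hx₁ hx₂).1 hx
    exact Set.add_mem_add h1 h2
  · rintro ⟨x₁, hx₁, x₂, hx₂, rfl⟩
    exact (h.add_mem_poly hx₁.1 hx₂.1).2 ⟨hx₁, hx₂⟩

theorem OrthSum.dirs_eq :
    dirs (Λ₁ ⊔ Λ₂) η (H₁ ∪ H₂) = dirs Λ₁ η H₁ ⊔ dirs Λ₂ η H₂ := by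
  ext x
  rw [Submodule.mem_sup]
  constructor
  · intro hx
    obtain ⟨x₁, hx₁, x₂, hx₂, rfl⟩ := exists_add_of_mem_span_sup hx.1
    obtain ⟨h1, h2⟩ := (h.add_mem_dirs hx₁ hx₂).1 hx
    exact ⟨x₁, h1, x₂, h2, rfl⟩
  · rintro ⟨x₁, hx₁, x₂, hx₂, rfl⟩
    exact (h.add_mem_dirs hx₁.1 hx₂.1).2 ⟨hx₁, hx₂⟩

theorem OrthSum.face_eq (h₁ : A₁ ⊆ H₁) (h₂ : A₂ ⊆ H₂) :
    face (Λ₁ ⊔ Λ₂) η c (H₁ ∪ H₂) (A₁ ∪ A₂) = face Λ₁ η c H₁ A₁ + face Λ₂ η c H₂ A₂ := by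
  have key : ∀ x₁ ∈ Submodule.span ℝ (Λ₁ : Set E), ∀ x₂ ∈ Submodule.span ℝ (Λ₂ : Set E),
      (x₁ + x₂ ∈ face (Λ₁ ⊔ Λ₂) η c (H₁ ∪ H₂) (A₁ ∪ A₂) ↔
        x₁ ∈ face Λ₁ η c H₁ A₁ ∧ x₂ ∈ face Λ₂ η c H₂ A₂) := by
    intro x₁ hx₁ x₂ hx₂
    simp only [mem_face, h.add_mem_poly hx₁ hx₂, Finset.mem_union, or_imp, forall_and]
    have e1 : (∀ i ∈ A₁, η i (x₁ + x₂) = c i) ↔ ∀ i ∈ A₁, η i x₁ = c i :=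
      forall₂_congr fun i hi => by rw [h.apply_left hx₂ (h₁ hi)]
    have e2 : (∀ i ∈ A₂, η i (x₁ + x₂) = c i) ↔ ∀ i ∈ A₂, η i x₂ = c i :=
      forall₂_congr fun i hi => by rw [h.apply_right hx₁ (h₂ hi)]
    rw [e1, e2]
    tauto
  ext x
  constructor
  · intro hx
    obtain ⟨x₁, hx₁, x₂, hx₂, rfl⟩ := exists_add_of_mem_span_sup hx.1.1
    obtain ⟨h1, h2⟩ := (key x₁ hx₁ x₂ hx₂).1 hx
    exact Set.add_mem_add h1 h2
  · rintro ⟨x₁, hx₁, x₂, hx₂, rfl⟩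
    exact (key x₁ hx₁.1.1 x₂ hx₂.1.1).2 ⟨hx₁, hx₂⟩

theorem OrthSum.union_mem_actSets (hA₁ : A₁ ∈ actSets Λ₁ η c H₁) (hA₂ : A₂ ∈ actSets Λ₂ η c H₂) :
    A₁ ∪ A₂ ∈ actSets (Λ₁ ⊔ Λ₂) η c (H₁ ∪ H₂) ∧ (A₁ ∪ A₂) ∩ H₁ = A₁ ∧ (A₁ ∪ A₂) ∩ H₂ = A₂ := by
  obtain ⟨x₁, hx₁, rfl⟩ := mem_actSets.1 hA₁
  obtain ⟨x₂, hx₂, rfl⟩ := mem_actSets.1 hA₂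
  rw [← h.actIneq_add hx₁.1 hx₂.1]
  exact ⟨mem_actSets.2 ⟨x₁ + x₂, (h.add_mem_poly hx₁.1 hx₂.1).2 ⟨hx₁, hx₂⟩, rfl⟩,
    h.actIneq_inter_left hx₂.1, h.actIneq_inter_right hx₁.1⟩

theorem OrthSum.inter_mem_actSets {A : Finset ι} (hA : A ∈ actSets (Λ₁ ⊔ Λ₂) η c (H₁ ∪ H₂)) :
    A ∩ H₁ ∈ actSets Λ₁ η c H₁ ∧ A ∩ H₂ ∈ actSets Λ₂ η c H₂ ∧ A ∩ H₁ ∪ A ∩ H₂ = A := by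
  refine ⟨?_, ?_, ?_⟩
  · obtain ⟨x, hx, rfl⟩ := mem_actSets.1 hA
    obtain ⟨x₁, hx₁, x₂, hx₂, rfl⟩ := exists_add_of_mem_span_sup hx.1
    rw [h.actIneq_inter_left hx₂]
    exact mem_actSets.2 ⟨x₁, ((h.add_mem_poly hx₁ hx₂).1 hx).1, rfl⟩
  · obtain ⟨x, hx, rfl⟩ := mem_actSets.1 hA
    obtain ⟨x₁, hx₁, x₂, hx₂, rfl⟩ := exists_add_of_mem_span_sup hx.1
    rw [h.actIneq_inter_right hx₁]
    exact mem_actSets.2 ⟨x₂, ((h.add_mem_poly hx₁ hx₂).1 hx).2, rfl⟩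
  · rw [← Finset.inter_union_distrib_left]
    exact Finset.inter_eq_left.2 (subset_of_mem_actSets hA)

end

variable [FiniteDimensional ℝ E]

theorem OrthSum.quotProj_add (h : OrthSum Λ₁ Λ₂ η H₁ H₂) {L₁ L₂ : Submodule ℝ E}
    (h₁ : L₁ ≤ Submodule.span ℝ (Λ₁ : Set E)) (h₂ : L₂ ≤ Submodule.span ℝ (Λ₂ : Set E))
    {x₁ x₂ : E} (hx₁ : x₁ ∈ Submodule.span ℝ (Λ₁ : Set E))
    (hx₂ : x₂ ∈ Submodule.span ℝ (Λ₂ : Set E)) :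
    quotProj (L₁ ⊔ L₂) (x₁ + x₂) = quotProj L₁ x₁ + quotProj L₂ x₂ := by
  have hm : ∀ {W L : Submodule ℝ E}, L ≤ W → ∀ {x : E}, x ∈ W → quotProj L x ∈ W := by
    intro W L hLW x hx
    have := sub_mem hx (hLW (sub_quotProj_mem L x))
    rwa [sub_sub_cancel] at this
  refine quotProj_eq_of_sub_mem ?_ ?_
  · intro u hu
    obtain ⟨u₁, hu₁, u₂, hu₂, rfl⟩ := Submodule.mem_sup.1 hu
    rw [inner_add_left, inner_add_right, inner_add_right, quotProj_mem L₁ x₁ u₁ hu₁,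
      quotProj_mem L₂ x₂ u₂ hu₂, h.orth u₁ (h₁ hu₁) _ (hm h₂ hx₂), real_inner_comm,
      h.orth _ (hm h₁ hx₁) u₂ (h₂ hu₂)]
    simp
  · rw [add_sub_add_comm]
    exact Submodule.add_mem_sup (sub_quotProj_mem L₁ x₁) (sub_quotProj_mem L₂ x₂)

theorem OrthSum.quotLattice_sup (h : OrthSum Λ₁ Λ₂ η H₁ H₂) {L₁ L₂ : Submodule ℝ E}
    (h₁ : L₁ ≤ Submodule.span ℝ (Λ₁ : Set E)) (h₂ : L₂ ≤ Submodule.span ℝ (Λ₂ : Set E)) :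
    quotLattice (Λ₁ ⊔ Λ₂) (L₁ ⊔ L₂) = quotLattice Λ₁ L₁ ⊔ quotLattice Λ₂ L₂ := by
  ext z
  rw [Submodule.mem_sup]
  constructor
  · rintro ⟨x, hx, rfl⟩
    obtain ⟨x₁, hx₁, x₂, hx₂, rfl⟩ := Submodule.mem_sup.1 hx
    exact ⟨_, ⟨x₁, hx₁, rfl⟩, _, ⟨x₂, hx₂, rfl⟩,
      (h.quotProj_add h₁ h₂ (mem_span_of_mem hx₁) (mem_span_of_mem hx₂)).symm⟩
  · rintro ⟨_, ⟨x₁, hx₁, rfl⟩, _, ⟨x₂, hx₂, rfl⟩, rfl⟩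
    exact ⟨x₁ + x₂, Submodule.add_mem_sup hx₁ hx₂,
      h.quotProj_add h₁ h₂ (mem_span_of_mem hx₁) (mem_span_of_mem hx₂)⟩

theorem OrthSum.quotLattice (h : OrthSum Λ₁ Λ₂ η H₁ H₂) {L₁ L₂ : Submodule ℝ E}
    (h₁ : L₁ ≤ Submodule.span ℝ (Λ₁ : Set E)) (h₂ : L₂ ≤ Submodule.span ℝ (Λ₂ : Set E)) :
    OrthSum (quotLattice Λ₁ L₁) (quotLattice Λ₂ L₂) η H₁ H₂ := by
  have e₁ := (span_quotLattice h₁).trans_le inf_le_left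
  have e₂ := (span_quotLattice h₂).trans_le inf_le_left
  exact ⟨fun x hx y hy => h.orth x (e₁ hx) y (e₂ hy), fun i hi v hv => h.left i hi v (e₂ hv),
    fun i hi v hv => h.right i hi v (e₁ hv)⟩

end OrthogonalSum

section SumOfSets

variable {E : Type*} [NormedAddCommGroup E] [InnerProductSpace ℝ E] [FiniteDimensional ℝ E]

/-- If the orthogonal sum of two sets contains a line, one of the projections of that line is a line
in a summand. -/
theorem containsLine_add_iff {W₁ W₂ : Submodule ℝ E} (h : ∀ x ∈ W₁, ∀ y ∈ W₂, inner ℝ x y = 0)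
    {p₁ p₂ : Set E} (hp₁ : p₁ ⊆ W₁) (hp₂ : p₂ ⊆ W₂) (hne₁ : p₁.Nonempty) (hne₂ : p₂.Nonempty) :
    ContainsLine (p₁ + p₂) ↔ ContainsLine p₁ ∨ ContainsLine p₂ := by
  constructor
  · rintro ⟨x, v, hv, hl⟩
    have hproj : ∀ y₁ ∈ p₁, ∀ y₂ ∈ p₂, W₁.starProjection (y₁ + y₂) = y₁ := by
      intro y₁ hy₁ y₂ hy₂
      have h2 : y₂ ∈ W₁ᗮ := fun u hu => h u hu y₂ (hp₂ hy₂)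
      rw [map_add, Submodule.starProjection_eq_self_iff.2 (hp₁ hy₁),
        (Submodule.starProjection_apply_eq_zero_iff _).2 h2, add_zero]
    by_cases hv1 : W₁.starProjection v = 0
    · refine Or.inr ⟨x - W₁.starProjection x, v, hv, fun t => ?_⟩
      obtain ⟨y₁, hy₁, y₂, hy₂, e⟩ := hl t
      have h1 := hproj y₁ hy₁ y₂ hy₂
      have e' : y₁ + y₂ = x + t • v := e
      rw [e', map_add, map_smul, hv1, smul_zero, add_zero] at h1
      have : x - W₁.starProjection x + t • v = y₂ := by
        rw [h1, sub_add_eq_add_sub, ← e', add_sub_cancel_left]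
      rwa [this]
    · refine Or.inl ⟨W₁.starProjection x, W₁.starProjection v, hv1, fun t => ?_⟩
      obtain ⟨y₁, hy₁, y₂, hy₂, e⟩ := hl t
      have h1 := hproj y₁ hy₁ y₂ hy₂
      have e' : y₁ + y₂ = x + t • v := e
      rw [e', map_add, map_smul] at h1
      rwa [h1]
  · rintro (⟨x, v, hv, hl⟩ | ⟨x, v, hv, hl⟩)
    · obtain ⟨y, hy⟩ := hne₂
      refine ⟨x + y, v, hv, fun t => ?_⟩
      rw [add_right_comm]
      exact Set.add_mem_add (hl t) hy
    · obtain ⟨y, hy⟩ := hne₁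
      refine ⟨y + x, v, hv, fun t => ?_⟩
      rw [add_assoc]
      exact Set.add_mem_add hy (hl t)

omit [FiniteDimensional ℝ E] in
theorem negForms_add_subset_left (p₁ p₂ : Set E) : negForms (p₁ + p₂) ⊆ negForms p₁ := by
  intro ξ hξ v hv hv0
  refine hξ v ?_ hv0
  rintro _ ⟨x, hx, y, hy, rfl⟩
  rw [add_right_comm]
  exact Set.add_mem_add (hv x hx) hy

omit [FiniteDimensional ℝ E] in
theorem negForms_add_subset_right (p₁ p₂ : Set E) : negForms (p₁ + p₂) ⊆ negForms p₂ := by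
  rw [add_comm]
  exact negForms_add_subset_left p₂ p₁

omit [FiniteDimensional ℝ E] in
theorem IsIntPoly.subset_span {Λ : Submodule ℤ E} {p : Set E} (hp : IsIntPoly Λ p) :
    p ⊆ Submodule.span ℝ (Λ : Set E) := by
  obtain ⟨H, -, rfl⟩ := hp
  exact fun x hx => hx.1

end SumOfSets

section Multiplicativity

variable {E : Type*} [NormedAddCommGroup E] [InnerProductSpace ℝ E] [FiniteDimensional ℝ E]
  [MeasurableSpace E] [BorelSpace E] {ι : Type*} {Λ₁ Λ₂ : Submodule ℤ E}
  {η : ι → StrongDual ℝ E} {c : ι → ℝ} {H₁ H₂ A₁ A₂ : Finset ι}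
  [DiscreteTopology Λ₁] [DiscreteTopology Λ₂] [DiscreteTopology ↥(Λ₁ ⊔ Λ₂)]

/-- Sums over lattice points are multiplicative on orthogonal sums. -/
theorem OrthSum.S_add (h : OrthSum Λ₁ Λ₂ η H₁ H₂) {p₁ p₂ : Set E} (hp₁ : IsIntPoly Λ₁ p₁)
    (hp₂ : IsIntPoly Λ₂ p₂) (hp : IsIntPoly (Λ₁ ⊔ Λ₂) (p₁ + p₂)) (hne₁ : p₁.Nonempty)
    (hne₂ : p₂.Nonempty) : S (Λ₁ ⊔ Λ₂) (p₁ + p₂) = S Λ₁ p₁ * S Λ₂ p₂ := by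
  have hline := containsLine_add_iff h.orth hp₁.subset_span hp₂.subset_span hne₁ hne₂
  by_cases hl : ContainsLine (p₁ + p₂)
  · rw [S_eq_zero_of_containsLine hl]
    rcases hline.1 hl with hl | hl
    · rw [S_eq_zero_of_containsLine hl, zero_mul]
    · rw [S_eq_zero_of_containsLine hl, mul_zero]
  have hs₁ : ∀ ξ ∈ negForms (p₁ + p₂), Summable fun x : ↥(p₁ ∩ (Λ₁ : Set E)) => Real.exp (ξ x) :=
    fun ξ hξ => summable_exp_of_mem_negForms hp₁ (negForms_add_subset_left _ _ hξ)
  have hs₂ : ∀ ξ ∈ negForms (p₁ + p₂), Summable fun x : ↥(p₂ ∩ (Λ₂ : Set E)) => Real.exp (ξ x) :=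
    fun ξ hξ => summable_exp_of_mem_negForms hp₂ (negForms_add_subset_right _ _ hξ)
  have hset : (p₁ + p₂) ∩ ((Λ₁ ⊔ Λ₂ : Submodule ℤ E) : Set E) =
      (fun q : E × E => q.1 + q.2) '' ((p₁ ∩ (Λ₁ : Set E)) ×ˢ (p₂ ∩ (Λ₂ : Set E))) := by
    ext x
    constructor
    · rintro ⟨⟨x₁, hx₁, x₂, hx₂, rfl⟩, hx⟩
      obtain ⟨h1, h2⟩ := (h.mem_lattice_iff (hp₁.subset_span hx₁) (hp₂.subset_span hx₂)).1 hx
      exact ⟨(x₁, x₂), ⟨⟨hx₁, h1⟩, hx₂, h2⟩, rfl⟩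
    · rintro ⟨⟨x₁, x₂⟩, ⟨⟨hx₁, h1⟩, hx₂, h2⟩, rfl⟩
      exact ⟨Set.add_mem_add hx₁ hx₂, Submodule.add_mem_sup h1 h2⟩
  have hinj : Set.InjOn (fun q : E × E => q.1 + q.2)
      ((p₁ ∩ (Λ₁ : Set E)) ×ˢ (p₂ ∩ (Λ₂ : Set E))) := by
    rintro ⟨x₁, x₂⟩ ⟨⟨-, hx₁⟩, -, hx₂⟩ ⟨y₁, y₂⟩ ⟨⟨-, hy₁⟩, -, hy₂⟩ e
    obtain ⟨e1, e2⟩ := add_eq_add_of_orth h.orth (mem_span_of_mem hx₁) (mem_span_of_mem hy₁)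
      (mem_span_of_mem hx₂) (mem_span_of_mem hy₂) e
    exact Prod.ext e1 e2
  refine (agreesOn_S hp).unique ((agreesOn_S hp₁).mul (agreesOn_S hp₂))
    (U := negForms (p₁ + p₂)) (fun ξ hξ => summable_exp_of_mem_negForms hp hξ)
    (fun ξ hξ => ⟨hs₁ ξ hξ, hs₂ ξ hξ⟩)
    (hp.zero_mem_closure_interior (hne₁.add hne₂) hl) fun ξ hξ => ?_
  have hexp : ∀ {s : Set E}, (Summable fun x : s => Real.exp (ξ x)) →
      Summable fun x : s => ‖Real.exp (ξ x)‖ := fun hs => hs.norm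
  rw [hset, tsum_image (fun z => Real.exp (ξ z)) hinj,
    tsum_mul_tsum_of_summable_norm (hexp (hs₁ ξ hξ)) (hexp (hs₂ ξ hξ)),
    ← (Equiv.Set.prod (p₁ ∩ (Λ₁ : Set E)) (p₂ ∩ (Λ₂ : Set E))).tsum_eq]
  refine tsum_congr fun q => ?_
  rw [map_add, Real.exp_add]
  rfl

omit [DiscreteTopology ↥(Λ₁ ⊔ Λ₂)] in
/-- The normalized measure of an orthogonal sum is the product measure. -/
theorem OrthSum.translateMeasure_sup (h : OrthSum Λ₁ Λ₂ η H₁ H₂) {L₁ L₂ L : Submodule ℝ E}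
    (h₁ : L₁ ≤ Submodule.span ℝ (Λ₁ : Set E)) (h₂ : L₂ ≤ Submodule.span ℝ (Λ₂ : Set E))
    (hL₁ : IsRatSubspace Λ₁ L₁) (hL₂ : IsRatSubspace Λ₂ L₂) (hL : L₁ ⊔ L₂ = L) (y₁ y₂ : E) :
    translateMeasure (Λ₁ ⊔ Λ₂) L (y₁ + y₂) =
      ((translateMeasure Λ₁ L₁ y₁).prod (translateMeasure Λ₂ L₂ y₂)).map fun q => q.1 + q.2 := by
  obtain ⟨b₁, hb₁⟩ := exists_latticeBasis Λ₁ hL₁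
  obtain ⟨b₂, hb₂⟩ := exists_latticeBasis Λ₂ hL₂
  let f : L₁ × L₂ →ₗ[ℝ] L := (L₁.subtype.coprod L₂.subtype).codRestrict L fun q =>
    hL ▸ Submodule.add_mem_sup q.1.2 q.2.2
  have hf : ∀ q, (f q : E) = q.1 + q.2 := fun q => rfl
  have hbij : Function.Bijective f := by
    refine ⟨fun q r e => ?_, fun z => ?_⟩
    · obtain ⟨e1, e2⟩ := add_eq_add_of_orth h.orth (h₁ q.1.2) (h₁ r.1.2) (h₂ q.2.2) (h₂ r.2.2)
        (congrArg Subtype.val e)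
      exact Prod.ext (Subtype.ext e1) (Subtype.ext e2)
    · obtain ⟨z₁, hz₁, z₂, hz₂, e⟩ := Submodule.mem_sup.1 (hL.ge z.2)
      exact ⟨(⟨z₁, hz₁⟩, ⟨z₂, hz₂⟩), Subtype.ext e⟩
  let e : (L₁ × L₂) ≃L[ℝ] L := (LinearEquiv.ofBijective f hbij).toContinuousLinearEquiv
  have he : ∀ q, (e q : E) = q.1 + q.2 := hf
  have hmem : ∀ q : L₁ × L₂, q ∈ Submodule.span ℤ (Set.range (b₁.prod b₂)) ↔
      (e q : E) ∈ Λ₁ ⊔ Λ₂ := by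
    intro q
    rw [he, h.mem_lattice_iff (h₁ q.1.2) (h₂ q.2.2)]
    have e1 : (q.1 : E) ∈ Λ₁ ↔ q.1 ∈ Submodule.span ℤ (Set.range b₁) := by
      rw [hb₁]
      rfl
    have e2 : (q.2 : E) ∈ Λ₂ ↔ q.2 ∈ Submodule.span ℤ (Set.range b₂) := by
      rw [hb₂]
      rfl
    rw [e1, e2, Module.Basis.mem_span_iff_repr_mem, Module.Basis.mem_span_iff_repr_mem,
      Module.Basis.mem_span_iff_repr_mem, Sum.forall]
    simp only [Module.Basis.prod_repr_inl, Module.Basis.prod_repr_inr]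
  have := isAddHaarMeasure_latticeMeasure hL₁
  have := isAddHaarMeasure_latticeMeasure hL₂
  have hm : latticeMeasure (Λ₁ ⊔ Λ₂) L =
      ((latticeMeasure Λ₁ L₁).prod (latticeMeasure Λ₂ L₂)).map e := by
    rw [latticeMeasure_eq_map (b₁.prod b₂) e hmem, Module.Basis.prod_addHaar,
      latticeMeasure_eq_addHaar b₁ hb₁, latticeMeasure_eq_addHaar b₂ hb₂]
  have hc : Measurable e := e.continuous.measurable
  rw [translateMeasure, translateMeasure, translateMeasure, hm,
    Measure.map_map (by fun_prop) hc, Measure.map_prod_map _ _ (by fun_prop) (by fun_prop),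
    Measure.map_map (by fun_prop) (by fun_prop)]
  congr 1
  funext q
  simp only [Function.comp_apply, he]
  exact add_add_add_comm _ _ _ _

/-- Lattice-normalized integrals are multiplicative on orthogonal sums. -/
theorem OrthSum.I_add (h : OrthSum Λ₁ Λ₂ η H₁ H₂) {p₁ p₂ : Set E} (hp₁ : IsIntPoly Λ₁ p₁)
    (hp₂ : IsIntPoly Λ₂ p₂) (hp : IsIntPoly (Λ₁ ⊔ Λ₂) (p₁ + p₂)) (hne₁ : p₁.Nonempty)
    (hne₂ : p₂.Nonempty) (h₁ : lin p₁ ≤ Submodule.span ℝ (Λ₁ : Set E))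
    (h₂ : lin p₂ ≤ Submodule.span ℝ (Λ₂ : Set E)) (hL₁ : IsRatSubspace Λ₁ (lin p₁))
    (hL₂ : IsRatSubspace Λ₂ (lin p₂)) (hL : IsRatSubspace (Λ₁ ⊔ Λ₂) (lin (p₁ + p₂)))
    (hlin : lin p₁ ⊔ lin p₂ = lin (p₁ + p₂)) :
    I (Λ₁ ⊔ Λ₂) (p₁ + p₂) = I Λ₁ p₁ * I Λ₂ p₂ := by
  have hline := containsLine_add_iff h.orth hp₁.subset_span hp₂.subset_span hne₁ hne₂
  by_cases hl : ContainsLine (p₁ + p₂)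
  · rw [I_eq_zero_of_containsLine hl]
    rcases hline.1 hl with hl | hl
    · rw [I_eq_zero_of_containsLine hl, zero_mul]
    · rw [I_eq_zero_of_containsLine hl, mul_zero]
  have hi₁ := fun ξ (hξ : ξ ∈ negForms (p₁ + p₂)) =>
    integrableOn_exp_of_mem_negForms hp₁ hL₁ hne₁ (negForms_add_subset_left _ _ hξ)
  have hi₂ := fun ξ (hξ : ξ ∈ negForms (p₁ + p₂)) =>
    integrableOn_exp_of_mem_negForms hp₂ hL₂ hne₂ (negForms_add_subset_right _ _ hξ)
  refine (agreesOn_I hp hL (hne₁.add hne₂)).unique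
    ((agreesOn_I hp₁ hL₁ hne₁).mul (agreesOn_I hp₂ hL₂ hne₂)) (U := negForms (p₁ + p₂))
    (fun ξ hξ => integrableOn_exp_of_mem_negForms hp hL (hne₁.add hne₂) hξ)
    (fun ξ hξ => ⟨hi₁ ξ hξ, hi₂ ξ hξ⟩)
    (hp.zero_mem_closure_interior (hne₁.add hne₂) hl) fun ξ hξ => ?_
  have := isFiniteMeasureOnCompacts_affineMeasure hL₁ hne₁
  have := isFiniteMeasureOnCompacts_affineMeasure hL₂ hne₂
  obtain ⟨y₁, hy₁⟩ := hne₁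
  obtain ⟨y₂, hy₂⟩ := hne₂
  have hm : affineMeasure (Λ₁ ⊔ Λ₂) (p₁ + p₂) =
      ((affineMeasure Λ₁ p₁).prod (affineMeasure Λ₂ p₂)).map fun q => q.1 + q.2 := by
    rw [affineMeasure_eq hL (Set.add_mem_add hy₁ hy₂), affineMeasure_eq hL₁ hy₁,
      affineMeasure_eq hL₂ hy₂, h.translateMeasure_sup h₁ h₂ hL₁ hL₂ hlin]
  have hae₁ : ∀ᵐ x ∂affineMeasure Λ₁ p₁, x ∈ Submodule.span ℝ (Λ₁ : Set E) := by
    rw [affineMeasure_eq hL₁ hy₁]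
    filter_upwards [ae_translateMeasure] with x hx
    have := add_mem (h₁ hx) (hp₁.subset_span hy₁)
    rwa [sub_add_cancel] at this
  have hae₂ : ∀ᵐ x ∂affineMeasure Λ₂ p₂, x ∈ Submodule.span ℝ (Λ₂ : Set E) := by
    rw [affineMeasure_eq hL₂ hy₂]
    filter_upwards [ae_translateMeasure] with x hx
    have := add_mem (h₂ hx) (hp₂.subset_span hy₂)
    rwa [sub_add_cancel] at this
  have hcont : Continuous fun x => Real.exp (ξ x) := by fun_prop
  rw [← integral_indicator hp.measurableSet, hm, integral_map (by fun_prop)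
    (hcont.measurable.indicator hp.measurableSet).aestronglyMeasurable,
    ← integral_indicator hp₁.measurableSet, ← integral_indicator hp₂.measurableSet,
    ← integral_prod_mul]
  refine integral_congr_ae ?_
  filter_upwards [Measure.quasiMeasurePreserving_fst.ae hae₁,
    Measure.quasiMeasurePreserving_snd.ae hae₂] with q hq₁ hq₂
  have hiff : q.1 + q.2 ∈ p₁ + p₂ ↔ q.1 ∈ p₁ ∧ q.2 ∈ p₂ := by
    refine ⟨?_, fun hq => Set.add_mem_add hq.1 hq.2⟩
    rintro ⟨x₁, hx₁, x₂, hx₂, e⟩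
    obtain ⟨e1, e2⟩ := add_eq_add_of_orth h.orth (hp₁.subset_span hx₁) hq₁
      (hp₂.subset_span hx₂) hq₂ e
    exact ⟨e1 ▸ hx₁, e2 ▸ hx₂⟩
  by_cases hq : q.1 + q.2 ∈ p₁ + p₂
  · rw [Set.indicator_of_mem hq, Set.indicator_of_mem (hiff.1 hq).1,
      Set.indicator_of_mem (hiff.1 hq).2, map_add, Real.exp_add]
  · rw [Set.indicator_of_notMem hq]
    by_cases hq1 : q.1 ∈ p₁
    · rw [Set.indicator_of_notMem (fun hq2 => hq (hiff.2 ⟨hq1, hq2⟩)), mul_zero]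
    · rw [Set.indicator_of_notMem hq1, zero_mul]

omit [DiscreteTopology Λ₁] [DiscreteTopology Λ₂] [DiscreteTopology ↥(Λ₁ ⊔ Λ₂)] in
/-- The function `μ` is multiplicative on orthogonal sums: `S` and `I` are, the faces of `a₁ + a₂`
are the sums of faces of `a₁` and `a₂`, and by induction the product of the formulas `S_cone` for
`a₁` and `a₂` agrees with that for `a₁ + a₂` in the terms of all faces of positive dimension. -/
theorem mu_add [DecidableEq ι] {Λ₁ Λ₂ : Submodule ℤ E} [hd₁ : DiscreteTopology Λ₁]
    [hd₂ : DiscreteTopology Λ₂] [hd : DiscreteTopology ↥(Λ₁ ⊔ Λ₂)] (h : OrthSum Λ₁ Λ₂ η H₁ H₂)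
    (hH₁ : ∀ i ∈ H₁, IntegralOn Λ₁ (η i)) (hH₂ : ∀ i ∈ H₂, IntegralOn Λ₂ (η i)) {s₁ s₂ : E}
    (hs₁ : s₁ ∈ Submodule.span ℝ (Λ₁ : Set E)) (hs₂ : s₂ ∈ Submodule.span ℝ (Λ₂ : Set E))
    (hsH₁ : ∀ i ∈ H₁, η i s₁ = c i) (hsH₂ : ∀ i ∈ H₂, η i s₂ = c i) :
    mu (Λ₁ ⊔ Λ₂) (poly (Λ₁ ⊔ Λ₂) η c (H₁ ∪ H₂)) =
      mu Λ₁ (poly Λ₁ η c H₁) * mu Λ₂ (poly Λ₂ η c H₂) := by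
  generalize hn : Module.finrank ℝ (Submodule.span ℝ ((Λ₁ ⊔ Λ₂ : Submodule ℤ E) : Set E)) = n
  induction n using Nat.strong_induction_on generalizing Λ₁ Λ₂ H₁ H₂ s₁ s₂ with
  | _ n ih =>
  have hH : ∀ i ∈ H₁ ∪ H₂, IntegralOn (Λ₁ ⊔ Λ₂) (η i) := by
    intro i hi x hx
    obtain ⟨x₁, hx₁, x₂, hx₂, rfl⟩ := Submodule.mem_sup.1 hx
    rcases Finset.mem_union.1 hi with hi | hi
    · rw [h.apply_left (mem_span_of_mem hx₂) hi]
      exact hH₁ i hi x₁ hx₁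
    · rw [h.apply_right (mem_span_of_mem hx₁) hi]
      exact hH₂ i hi x₂ hx₂
  have hs : s₁ + s₂ ∈ Submodule.span ℝ ((Λ₁ ⊔ Λ₂ : Submodule ℤ E) : Set E) := by
    rw [span_sup_lattice]
    exact Submodule.add_mem_sup hs₁ hs₂
  have hsH : ∀ i ∈ H₁ ∪ H₂, η i (s₁ + s₂) = c i := by
    intro i hi
    rcases Finset.mem_union.1 hi with hi | hi
    · rw [h.apply_left hs₂ hi, hsH₁ i hi]
    · rw [h.apply_right hs₁ hi, hsH₂ i hi]
  have hne₁ : (poly Λ₁ η c H₁).Nonempty := ⟨s₁, mem_poly_of_forall_eq hs₁ hsH₁⟩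
  have hne₂ : (poly Λ₂ η c H₂).Nonempty := ⟨s₂, mem_poly_of_forall_eq hs₂ hsH₂⟩
  by_cases hbot : dirs (Λ₁ ⊔ Λ₂) η (H₁ ∪ H₂) = ⊥
  swap
  · rw [mu_eq_zero_of_containsLine ((containsLine_poly_iff
      ⟨_, mem_poly_of_forall_eq hs hsH⟩).2 hbot)]
    rw [h.dirs_eq, sup_eq_bot_iff, not_and_or] at hbot
    rcases hbot with hbot | hbot
    · rw [mu_eq_zero_of_containsLine ((containsLine_poly_iff hne₁).2 hbot), zero_mul]
    · rw [mu_eq_zero_of_containsLine ((containsLine_poly_iff hne₂).2 hbot), mul_zero]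
  -- the difference of the coefficients of corresponding faces
  let d : Finset ι → Mer E := fun A => muFace (Λ₁ ⊔ Λ₂) η c A -
    muFace Λ₁ η c (A ∩ H₁) * muFace Λ₂ η c (A ∩ H₂)
  have hd0 : ∀ A ∈ actSets (Λ₁ ⊔ Λ₂) η c (H₁ ∪ H₂), dirs (Λ₁ ⊔ Λ₂) η A ≠ ⊥ → d A = 0 := by
    intro A hA hA0
    obtain ⟨hA₁, hA₂, hAA⟩ := h.inter_mem_actSets hA
    have h' := h.mono (subset_of_mem_actSets hA₁) (subset_of_mem_actSets hA₂)
    have hHA₁ : ∀ i ∈ A ∩ H₁, IntegralOn Λ₁ (η i) := fun i hi =>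
      hH₁ i (subset_of_mem_actSets hA₁ hi)
    have hHA₂ : ∀ i ∈ A ∩ H₂, IntegralOn Λ₂ (η i) := fun i hi =>
      hH₂ i (subset_of_mem_actSets hA₂ hi)
    have := discreteTopology_quotLattice hHA₁
    have := discreteTopology_quotLattice hHA₂
    have hquot := h'.quotLattice_sup (L₁ := dirs Λ₁ η (A ∩ H₁)) (L₂ := dirs Λ₂ η (A ∩ H₂))
      dirs_le_span_lattice dirs_le_span_lattice
    rw [← h'.dirs_eq, hAA] at hquot
    have hdisc : DiscreteTopology ↥(quotLattice (Λ₁ ⊔ Λ₂) (dirs (Λ₁ ⊔ Λ₂) η A)) :=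
      discreteTopology_quotLattice fun i hi => hH i (subset_of_mem_actSets hA hi)
    obtain ⟨t₁, ht₁, htA₁⟩ := exists_vertex_quotLattice hA₁
    obtain ⟨t₂, ht₂, htA₂⟩ := exists_vertex_quotLattice hA₂
    have hlt := finrank_span_quotLattice_lt dirs_le_span_lattice hA0
    rw [hquot] at hdisc hlt
    have h1 := ih _ (hn ▸ hlt) (h'.quotLattice dirs_le_span_lattice dirs_le_span_lattice)
      (integralOn_quotLattice_dirs hHA₁) (integralOn_quotLattice_dirs hHA₂) ht₁ ht₂ htA₁ htA₂ rfl
    rw [← hquot, hAA] at h1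
    exact sub_eq_zero.2 h1
  have hI : ∀ A₁ ∈ actSets Λ₁ η c H₁, ∀ A₂ ∈ actSets Λ₂ η c H₂,
      I (Λ₁ ⊔ Λ₂) (face (Λ₁ ⊔ Λ₂) η c (H₁ ∪ H₂) (A₁ ∪ A₂)) =
        I Λ₁ (face Λ₁ η c H₁ A₁) * I Λ₂ (face Λ₂ η c H₂ A₂) := by
    intro A₁ hA₁ A₂ hA₂
    have hA := (h.union_mem_actSets hA₁ hA₂).1
    have h₁ := subset_of_mem_actSets hA₁
    have h₂ := subset_of_mem_actSets hA₂
    have hint := isIntPoly_face (c := c) hH (subset_of_mem_actSets hA)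
    have hrat := isRatSubspace_lin_face hH hA
    have hlin : lin (face (Λ₁ ⊔ Λ₂) η c (H₁ ∪ H₂) (A₁ ∪ A₂)) =
        lin (face Λ₁ η c H₁ A₁) ⊔ lin (face Λ₂ η c H₂ A₂) := by
      rw [lin, lin, lin, lin_face hA, lin_face hA₁, lin_face hA₂, (h.mono h₁ h₂).dirs_eq]
    rw [h.face_eq h₁ h₂] at hint hrat hlin ⊢
    exact h.I_add (isIntPoly_face hH₁ h₁) (isIntPoly_face hH₂ h₂) hint (face_nonempty hA₁)
      (face_nonempty hA₂) ((lin_face hA₁).trans_le dirs_le_span_lattice)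
      ((lin_face hA₂).trans_le dirs_le_span_lattice) (isRatSubspace_lin_face hH₁ hA₁)
      (isRatSubspace_lin_face hH₂ hA₂) hrat hlin.symm
  have hS := h.S_add (isIntPoly_poly (c := c) hH₁) (isIntPoly_poly (c := c) hH₂)
    (by rw [← h.poly_eq]; exact isIntPoly_poly hH) hne₁ hne₂
  have hprod : ∑ A ∈ actSets (Λ₁ ⊔ Λ₂) η c (H₁ ∪ H₂),
      muFace Λ₁ η c (A ∩ H₁) * muFace Λ₂ η c (A ∩ H₂) *
        I (Λ₁ ⊔ Λ₂) (face (Λ₁ ⊔ Λ₂) η c (H₁ ∪ H₂) A) =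
      (∑ A ∈ actSets Λ₁ η c H₁, muFace Λ₁ η c A * I Λ₁ (face Λ₁ η c H₁ A)) *
        ∑ A ∈ actSets Λ₂ η c H₂, muFace Λ₂ η c A * I Λ₂ (face Λ₂ η c H₂ A) := by
    rw [Finset.sum_mul_sum, ← Finset.sum_product']
    refine Finset.sum_nbij' (fun A => (A ∩ H₁, A ∩ H₂)) (fun q => q.1 ∪ q.2) ?_ ?_ ?_ ?_ ?_
    · intro A hA
      obtain ⟨hA₁, hA₂, -⟩ := h.inter_mem_actSets hA
      exact Finset.mk_mem_product hA₁ hA₂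
    · intro q hq
      obtain ⟨hq₁, hq₂⟩ := Finset.mem_product.1 hq
      exact (h.union_mem_actSets hq₁ hq₂).1
    · intro A hA
      exact (h.inter_mem_actSets hA).2.2
    · intro q hq
      obtain ⟨hq₁, hq₂⟩ := Finset.mem_product.1 hq
      obtain ⟨-, e1, e2⟩ := h.union_mem_actSets hq₁ hq₂
      exact Prod.ext e1 e2
    · intro A hA
      obtain ⟨hA₁, hA₂, hAA⟩ := h.inter_mem_actSets hA
      have h1 := hI _ hA₁ _ hA₂
      rw [hAA] at h1
      rw [h1]
      exact mul_mul_mul_comm _ _ _ _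
  have hsum : ∑ A ∈ actSets (Λ₁ ⊔ Λ₂) η c (H₁ ∪ H₂),
      d A * I (Λ₁ ⊔ Λ₂) (face (Λ₁ ⊔ Λ₂) η c (H₁ ∪ H₂) A) = 0 := by
    simp only [d, sub_mul, Finset.sum_sub_distrib]
    rw [hprod, ← S_cone hs hsH, ← S_cone hs₁ hsH₁, ← S_cone hs₂ hsH₂, h.poly_eq, hS, sub_self]
  have h2 := eq_zero_of_sum_faces hs hsH hbot hd0 hsum
  have hbot' := hbot
  rw [h.dirs_eq, sup_eq_bot_iff] at hbot'
  have e1 : (H₁ ∪ H₂) ∩ H₁ = H₁ := Finset.inter_eq_right.2 Finset.subset_union_left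
  have e2 : (H₁ ∪ H₂) ∩ H₂ = H₂ := Finset.inter_eq_right.2 Finset.subset_union_right
  simpa only [d, e1, e2, sub_eq_zero, muFace_of_dirs_eq_bot hbot, muFace_of_dirs_eq_bot hbot'.1,
    muFace_of_dirs_eq_bot hbot'.2] using h2

end Multiplicativity

/-! ### Finitely generated cones -/

section Weyl

variable {E : Type*} [NormedAddCommGroup E] [InnerProductSpace ℝ E] [FiniteDimensional ℝ E]
  {Λ : Submodule ℤ E}

open scoped Classical in
/-- The origin is defined by integral equations: the coordinates with respect to a basis of the
lattice. -/
theorem isHCone_zero [DiscreteTopology Λ] : IsHCone Λ ({0} : Set E) := by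
  have hL : IsRatSubspace Λ (Submodule.span ℝ (Λ : Set E)) :=
    Submodule.span_mono fun x hx => ⟨hx, mem_span_of_mem hx⟩
  obtain ⟨b, hb⟩ := exists_latticeBasis Λ hL
  let η : Fin (Module.finrank ℝ (Submodule.span ℝ (Λ : Set E))) → StrongDual ℝ E := fun i =>
    (LinearMap.toContinuousLinearMap (b.coord i)).comp
      (Submodule.span ℝ (Λ : Set E)).orthogonalProjectionOnto
  have hη : ∀ i, ∀ x : Submodule.span ℝ (Λ : Set E), η i x = b.repr x i := fun i x => by
    simp [η]
  let G : Finset (StrongDual ℝ E × ℝ) := Finset.univ.image fun i => (η i, (0 : ℝ))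
  have hflat : flat Λ G = {0} := by
    ext x
    rw [Set.mem_singleton_iff]
    constructor
    · rintro ⟨hx, h⟩
      have h0 : b.repr ⟨x, hx⟩ = 0 := by
        ext i
        have := h (η i, 0) (Finset.mem_image_of_mem _ (Finset.mem_univ i))
        rwa [hη i ⟨x, hx⟩] at this
      exact congrArg Subtype.val ((LinearEquiv.map_eq_zero_iff _).1 h0)
    · rintro rfl
      refine ⟨zero_mem _, Finset.forall_mem_image.2 fun i _ => map_zero _⟩
  rw [← hflat]
  refine isHCone_flat (y := 0) (Finset.forall_mem_image.2 fun i _ x hx => ?_) (.of_mem (zero_mem _))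
    (by rw [hflat]; rfl)
  have hxb : (⟨x, mem_span_of_mem hx⟩ : Submodule.span ℝ (Λ : Set E)) ∈
      Submodule.span ℤ (Set.range b) := hb.ge hx
  obtain ⟨n, hn⟩ := (b.mem_span_iff_repr_mem ℤ _).1 hxb i
  exact ⟨n, (hη i ⟨x, mem_span_of_mem hx⟩).trans hn.symm⟩

/-- Weyl's theorem: finitely generated cones are polyhedra. -/
theorem exists_hpoly_of_isCone [DiscreteTopology Λ] {C : Set E} (hC : IsCone Λ C) :
    ∃ H : Finset (StrongDual ℝ E × ℝ), (∀ h ∈ H, IntegralOn Λ h.1) ∧ (∀ h ∈ H, h.1 0 = h.2) ∧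
      C = hpoly Λ H := by
  classical
  obtain ⟨G, hG, rfl⟩ := hC
  induction G using Finset.induction_on with
  | empty =>
    obtain ⟨H, s, hs, hH, hsH, h0⟩ := isHCone_zero (Λ := Λ)
    have hs0 : s ∈ ({0} : Set E) := h0 ▸ mem_poly_of_forall_eq hs.mem_span hsH
    rw [Set.mem_singleton_iff] at hs0
    subst hs0
    refine ⟨H, hH, hsH, ?_⟩
    rw [← h0]
    ext x
    simp
  | insert v G hv ih =>
    obtain ⟨H, hH, h0, e⟩ := ih fun w hw => hG w (Finset.mem_insert_of_mem hw)
    obtain ⟨H', hH', h0', hmem⟩ := exists_hpoly_add_ray hH (hG v (Finset.mem_insert_self _ _))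
    refine ⟨H', hH', h0' 0 h0, ?_⟩
    ext x
    rw [hmem, ← e, Finset.coe_insert]
    refine Submodule.mem_span_insert.trans ⟨?_, ?_⟩
    · rintro ⟨t, z, hz, rfl⟩
      refine ⟨t, t.2, ?_⟩
      change t • v + z - t • v ∈ _
      rwa [add_sub_cancel_left]
    · rintro ⟨t, ht, hx⟩
      refine ⟨⟨t, ht⟩, x - t • v, hx, ?_⟩
      change x = t • v + (x - t • v)
      rw [add_sub_cancel]

theorem exists_hpoly_of_vadd_isCone [DiscreteTopology Λ] {s : E} (hs : IsRationalPoint Λ s)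
    {C : Set E} (hC : IsCone Λ C) :
    ∃ H : Finset (StrongDual ℝ E × ℝ), (∀ h ∈ H, IntegralOn Λ h.1) ∧ (∀ h ∈ H, h.1 s = h.2) ∧
      s +ᵥ C = hpoly Λ H := by
  classical
  obtain ⟨H, hH, h0, rfl⟩ := exists_hpoly_of_isCone hC
  refine ⟨shiftIneq s H, Finset.forall_mem_image.2 fun h hh => hH h hh,
    Finset.forall_mem_image.2 fun h hh => ?_, ?_⟩
  · change h.1 s = h.2 + h.1 s
    rw [← h0 h hh, map_zero, zero_add]
  · ext x
    rw [mem_hpoly_shiftIneq hs.mem_span, Set.mem_vadd_set_iff_neg_vadd_mem, vadd_eq_add,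
      neg_add_eq_sub]

theorem IsAffineCone.isHCone [DiscreteTopology Λ] {a : Set E} (ha : IsAffineCone Λ a) :
    IsHCone Λ a := by
  obtain ⟨s, C, hs, hC, rfl⟩ := ha
  obtain ⟨H, hH, hsH, e⟩ := exists_hpoly_of_vadd_isCone hs hC
  exact ⟨H, s, hs, hH, hsH, e⟩

open scoped Classical in
/-- The linear forms defining a cone may be chosen to vanish on the orthogonal complement of the
span of the lattice. -/
theorem IsHCone.exists_orthogonal {a : Set E} (ha : IsHCone Λ a) :
    ∃ (H : Finset (StrongDual ℝ E × ℝ)) (s : E), s ∈ Submodule.span ℝ (Λ : Set E) ∧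
      (∀ h ∈ H, IntegralOn Λ h.1) ∧ (∀ h ∈ H, h.1 s = h.2) ∧
      (∀ h ∈ H, ∀ v ∈ (Submodule.span ℝ (Λ : Set E))ᗮ, h.1 v = 0) ∧ a = hpoly Λ H := by
  obtain ⟨H, s, hs, hH, hsH, rfl⟩ := ha
  have hself : ∀ x ∈ Submodule.span ℝ (Λ : Set E),
      (Submodule.span ℝ (Λ : Set E)).starProjection x = x := fun x hx =>
    Submodule.starProjection_eq_self_iff.2 hx
  refine ⟨H.image fun h => (h.1.comp (Submodule.span ℝ (Λ : Set E)).starProjection, h.2), s,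
    hs.mem_span, Finset.forall_mem_image.2 fun h hh x hx => ?_,
    Finset.forall_mem_image.2 fun h hh => ?_, Finset.forall_mem_image.2 fun h hh v hv => ?_, ?_⟩
  · change ∃ n : ℤ, h.1 ((Submodule.span ℝ (Λ : Set E)).starProjection x) = n
    rw [hself x (mem_span_of_mem hx)]
    exact hH h hh x hx
  · change h.1 ((Submodule.span ℝ (Λ : Set E)).starProjection s) = h.2
    rw [hself s hs.mem_span]
    exact hsH h hh
  · change h.1 ((Submodule.span ℝ (Λ : Set E)).starProjection v) = 0
    rw [(Submodule.starProjection_apply_eq_zero_iff _).2 hv, map_zero]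
  · ext x
    rw [mem_poly, mem_poly, Finset.forall_mem_image]
    refine and_congr_right fun hx => forall₂_congr fun h _ => ?_
    change _ ↔ h.1 ((Submodule.span ℝ (Λ : Set E)).starProjection x) ≤ h.2
    rw [hself x hx]

end Weyl

/-! ### Properties of `μ` on affine cones -/

section Properties

theorem comp_eq_self {E : Type*} [NormedAddCommGroup E] [NormedSpace ℝ E]
    {T : StrongDual ℝ E ≃L[ℝ] StrongDual ℝ E} (hT : ∀ ξ, T ξ = ξ) (φ : Mer E) :
    Mer.comp T φ = φ := by
  have h : ∀ a : AnGerm E, Mer.comp T (algebraMap (AnGerm E) (Mer E) a) =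
      algebraMap (AnGerm E) (Mer E) a := by
    rintro ⟨_, f, hf, rfl⟩
    change Mer.comp T (toMer f hf) = toMer f hf
    rw [comp_toMer]
    exact toMer_congr _ _ (Filter.Eventually.of_forall fun ξ => by
      rw [Function.comp_apply, hT])
  obtain ⟨a, b, -, rfl⟩ := IsFractionRing.div_surjective (A := AnGerm E) φ
  rw [map_div₀, h, h]

variable {E : Type*} [NormedAddCommGroup E] [InnerProductSpace ℝ E] [FiniteDimensional ℝ E]
  [MeasurableSpace E] [BorelSpace E] {Λ : Submodule ℤ E}

theorem comp_mu_image [DiscreteTopology Λ] (g : E ≃ₗᵢ[ℝ] E) {a : Set E} (ha : IsHCone Λ a) {x : E}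
    (hx : x ∈ mapLattice g Λ) :
    Mer.comp (dualMap g) (mu (mapLattice g Λ) ((fun y => x + g y) '' a)) = mu Λ a := by
  obtain ⟨H, s, hs, hH, hsH, rfl⟩ := ha
  have h := comp_mu g hH hs.mem_span hsH hx
  rwa [poly_mapLattice (mem_span_of_mem hx)] at h

theorem mu_vadd [DiscreteTopology Λ] {a : Set E} (ha : IsHCone Λ a) {x : E} (hx : x ∈ Λ) :
    mu Λ (x +ᵥ a) = mu Λ a := by
  have hΛ : mapLattice (LinearIsometryEquiv.refl ℝ E) Λ = Λ := Submodule.map_id Λ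
  have h := comp_mu_image (LinearIsometryEquiv.refl ℝ E) ha (x := x) (by rwa [hΛ])
  rw [comp_eq_self fun ξ => rfl, hΛ] at h
  exact h

theorem comp_mu_isometry [DiscreteTopology Λ] {g : E ≃ₗᵢ[ℝ] E} (hg : g '' (Λ : Set E) = Λ)
    {a : Set E} (ha : IsHCone Λ a) : Mer.comp (dualMap g) (mu Λ (g '' a)) = mu Λ a := by
  have hΛ : mapLattice g Λ = Λ := SetLike.coe_injective hg
  have h := comp_mu_image g ha (x := 0) (zero_mem _)
  simpa only [hΛ, zero_add] using h

theorem mu_add_of_orth {Λ₁ Λ₂ : Submodule ℤ E} [DiscreteTopology ↥(Λ₁ ⊔ Λ₂)]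
    (horth : ∀ x ∈ Λ₁, ∀ y ∈ Λ₂, inner ℝ x y = 0) {a₁ a₂ : Set E}
    (ha₁ : IsAffineCone Λ₁ a₁) (ha₂ : IsAffineCone Λ₂ a₂) :
    mu (Λ₁ ⊔ Λ₂) (a₁ + a₂) = mu Λ₁ a₁ * mu Λ₂ a₂ := by
  classical
  have hd : ∀ {Γ : Submodule ℤ E}, Γ ≤ Λ₁ ⊔ Λ₂ → DiscreteTopology Γ := fun {Γ} hΓ =>
    DiscreteTopology.of_continuous_injective (f := Submodule.inclusion hΓ)
      (continuous_subtype_val.subtype_mk _) (Submodule.inclusion_injective hΓ)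
  have := hd (le_sup_left (a := Λ₁))
  have := hd (le_sup_right (b := Λ₂))
  have hW : Submodule.span ℝ (Λ₁ : Set E) ⟂ Submodule.span ℝ (Λ₂ : Set E) :=
    Submodule.isOrtho_span.2 fun _ hx _ hy => horth _ hx _ hy
  obtain ⟨H₁, s₁, hs₁, hH₁, hsH₁, hv₁, rfl⟩ := ha₁.isHCone.exists_orthogonal
  obtain ⟨H₂, s₂, hs₂, hH₂, hsH₂, hv₂, rfl⟩ := ha₂.isHCone.exists_orthogonal
  have h : OrthSum Λ₁ Λ₂ Prod.fst H₁ H₂ :=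
    ⟨fun x hx y hy => Submodule.isOrtho_iff_inner_eq.1 hW x hx y hy,
      fun i hi v hv => hv₁ i hi v (hW.symm hv), fun i hi v hv => hv₂ i hi v (hW hv)⟩
  rw [← h.poly_eq]
  exact mu_add h hH₁ hH₂ hs₁ hs₂ hsH₁ hsH₂

theorem sum_mu_eq_zero [DiscreteTopology Λ] {s : E} (hs : IsRationalPoint Λ s) {κ : Type*}
    (K : Finset κ) {C : κ → Set E} {r : κ → ℝ} (hC : ∀ k ∈ K, IsCone Λ (C k))
    (h0 : ∀ x, ∑ k ∈ K, r k * chi (C k) x = 0) :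
    ∑ k ∈ K, constMer (r k) * mu Λ (s +ᵥ C k) = 0 := by
  classical
  have hex : ∀ k, ∃ H : Finset (StrongDual ℝ E × ℝ), k ∈ K → (∀ h ∈ H, IntegralOn Λ h.1) ∧
      (∀ h ∈ H, h.1 s = h.2) ∧ s +ᵥ C k = hpoly Λ H := fun k => by
    by_cases hk : k ∈ K
    · obtain ⟨H, hH⟩ := exists_hpoly_of_vadd_isCone hs (hC k hk)
      exact ⟨H, fun _ => hH⟩
    · exact ⟨∅, fun h => (hk h).elim⟩
  choose H hH using hex
  have h := coneRelations (StrongDual ℝ E × ℝ) κ Λ K Prod.fst Prod.snd H r s hs.mem_span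
    (fun k hk => (hH k hk).1) (fun k hk => (hH k hk).2.1) fun x => ?_
  · rw [← h]
    exact Finset.sum_congr rfl fun k hk => by rw [(hH k hk).2.2]
  · rw [← h0 (x - s)]
    refine Finset.sum_congr rfl fun k hk => congrArg (r k * ·) ?_
    refine chi_eq_of_iff ?_
    change x ∈ hpoly Λ (H k) ↔ _
    rw [← (hH k hk).2.2, Set.mem_vadd_set_iff_neg_vadd_mem, vadd_eq_add, neg_add_eq_sub]

end Properties

end LocalEM

open LocalEM in
theorem theorem20 {E : Type*} [NormedAddCommGroup E] [InnerProductSpace ℝ E]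
    [FiniteDimensional ℝ E] [MeasurableSpace E] [BorelSpace E]
    (Λ : Submodule ℤ E) [DiscreteTopology Λ]
    (hQ : ∀ x ∈ Λ, ∀ y ∈ Λ, ∃ q : ℚ, inner ℝ x y = (q : ℝ)) :
    -- invariance under lattice translations
    (∀ a : Set E, IsAffineCone Λ a → ∀ x ∈ Λ, mu Λ (x +ᵥ a) = mu Λ a) ∧
    -- equivariance under lattice-preserving isometries
    (∀ g : E ≃ₗᵢ[ℝ] E, g '' (Λ : Set E) = Λ → ∀ a : Set E, IsAffineCone Λ a →
      Mer.comp (g.toContinuousLinearEquiv.arrowCongr (ContinuousLinearEquiv.refl ℝ ℝ))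
        (mu Λ (g '' a)) = mu Λ a) ∧
    -- multiplicativity on orthogonal sums
    (∀ Λ₁ Λ₂ : Submodule ℤ E, (∀ x ∈ Λ₁, ∀ y ∈ Λ₂, inner ℝ x y = 0) → Λ₁ ⊔ Λ₂ = Λ →
      ∀ a₁ a₂ : Set E, IsAffineCone Λ₁ a₁ → IsAffineCone Λ₂ a₂ →
        mu Λ (a₁ + a₂) = mu Λ₁ a₁ * mu Λ₂ a₂) ∧
    -- valuation property for a fixed vertex
    (∀ s : E, IsRationalPoint Λ s → ∀ (n : ℕ) (c : Fin n → Set E) (r : Fin n → ℝ),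
      (∀ i, IsCone Λ (c i)) → (∀ x : E, ∑ i, r i * (c i).indicator (fun _ => (1 : ℝ)) x = 0) →
        ∑ i, constMer (r i) * mu Λ (s +ᵥ c i) = 0) ∧
    -- the local formula for polyhedra
    (∀ p : Set E, IsPolyhedron Λ p → (faces p).Finite ∧
      S Λ p = ∑ᶠ f ∈ faces p,
        mu (quotLattice Λ (lin f)) (transverseCone p f) * I Λ f) := by
  refine ⟨fun a ha x hx => mu_vadd ha.isHCone hx, fun g hg a ha => comp_mu_isometry hg ha.isHCone,
    ?_, fun s hs n c r hc h0 => sum_mu_eq_zero hs Finset.univ (fun i _ => hc i) h0,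
    fun p hp => local_formula hp⟩
  rintro Λ₁ Λ₂ horth rfl a₁ a₂ ha₁ ha₂
  exact mu_add_of_orth horth ha₁ ha₂
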